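/- **Theorem.** There is a randomized algorithm for the Feedback Vertex Set problem with the following properties. Its input consists of a finite simple undirected graph $G=(V,E)$ with $n$ vertices, a linear arrangement of $G$, i.e. a bijection $\ell\colon\{1,\dots,n\}\to V$, and an integer $k$. Let $$\operatorname{ctw}(\ell)=\max_{1\le i\le n}\bigl|\bigl\{\{\ell(j),\ell(m)\}\in E : j\le i<m\bigr\}\bigr|$$ denote the cutwidth of $\ell$ (equal to $0$ if $n=0$), and suppose that $\operatorname{ctw}(\ell)\le \mathrm{ctw}$. The algorithm decides whether there is a set $Y\subseteq V$ with $|Y|\le k$ such that $G-Y$ is a forest. * Running time: for every outcome of its coin tosses, the algorithm stops after time $O^*(2^{\mathrm{ctw}})$, that is, at most $C\cdot 2^{\mathrm{ctw}}\cdot(n+\operatorname{len}(k)+1)^{d}$, where $\operatorname{len}(k)$ is the number of binary digits of $|k|$ and $C,d$ are absolute constants. Time is measured on a random access machine with logarithmic cost that can toss fair coins. * No false positives: if no such $Y$ exists, the algorithm never answers "yes". * False negatives: if such a $Y$ exists, the algorithm answers "yes" with probability at least $1/2$. -/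

import Mathlib

open MeasureTheory
open scoped ENNReal

noncomputable section

/-! ## Linear arrangements, cutwidth, feedback vertex sets -/

/-- The `i`-th cut of the linear arrangement `ℓ` of `G`: the edges joining a vertex at a position
`≤ i` to a vertex at a position `> i`. -/
def cutAt {V : Type*} {n : ℕ} (G : SimpleGraph V) (ℓ : Fin n ≃ V) (i : Fin n) : Set (Sym2 V) :=
  {e | e ∈ G.edgeSet ∧ ∃ j k : Fin n, j ≤ i ∧ i < k ∧ e = s(ℓ j, ℓ k)}

/-- The cutwidth of a linear arrangement: the maximum number of edges in one of its cuts
(`0` if there are no vertices). -/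
def cutwidth {V : Type*} {n : ℕ} (G : SimpleGraph V) (ℓ : Fin n ≃ V) : ℕ :=
  Finset.univ.sup fun i : Fin n => (cutAt G ℓ i).ncard

/-- `Y` is a feedback vertex set of `G`: deleting `Y` leaves a forest. -/
def IsFeedbackVertexSet {V : Type*} (G : SimpleGraph V) (Y : Set V) : Prop :=
  (G.induce Yᶜ).IsAcyclic

/-- The pair `(G, k)` is a yes-instance of Feedback Vertex Set. -/
def HasFeedbackVertexSet {V : Type*} (G : SimpleGraph V) (k : ℤ) : Prop :=
  ∃ Y : Finset V, (Y.card : ℤ) ≤ k ∧ IsFeedbackVertexSet G (Y : Set V)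

/-! ## The machine model: a probabilistic random access machine with logarithmic cost

The memory consists of cells numbered `0, 1, 2, …`, each holding a natural number. Programs are
structured (sequence, branch, loop), use indirect addressing and the arithmetic operations `+`,
truncated `-`, `*` and `/` with rounding down, and can toss fair coins. -/

namespace RAM

/-- The contents of the memory cells. -/
abbrev Memory : Type := ℕ → ℕ

/-- Arithmetic expressions; `cell a` is the content of the cell whose address is the value
of `a`. -/
inductive Expr : Type
  | const (c : ℕ) : Expr
  | cell (a : Expr) : Expr
  | add (a b : Expr) : Expr
  | sub (a b : Expr) : Expr
  | mul (a b : Expr) : Expr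
  | div (a b : Expr) : Expr

/-- The value of an expression. -/
def Expr.eval (m : Memory) : Expr → ℕ
  | const c => c
  | cell a => m (a.eval m)
  | add a b => a.eval m + b.eval m
  | sub a b => a.eval m - b.eval m
  | mul a b => a.eval m * b.eval m
  | div a b => a.eval m / b.eval m

/-- The logarithmic cost of evaluating an expression: every node of the expression is charged one
unit plus the bit length of its value. Hence every operation is charged for its operands (an address
being the operand of `cell`) and for its result. -/
def Expr.cost (m : Memory) : Expr → ℕ
  | const c => 1 + c.size
  | cell a => a.cost m + 1 + ((cell a).eval m).size
  | add a b => a.cost m + b.cost m + 1 + ((add a b).eval m).size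
  | sub a b => a.cost m + b.cost m + 1 + ((sub a b).eval m).size
  | mul a b => a.cost m + b.cost m + 1 + ((mul a b).eval m).size
  | div a b => a.cost m + b.cost m + 1 + ((div a b).eval m).size

/-- Programs. `assign a e` stores the value of `e` in the cell with address `a`, `flip a` stores
a random bit there; a condition counts as true when its value is nonzero. -/
inductive Program : Type
  | skip : Program
  | assign (a e : Expr) : Program
  | flip (a : Expr) : Program
  | seq (p q : Program) : Program
  | ite (e : Expr) (p q : Program) : Program
  | loop (e : Expr) (p : Program) : Program

/-- A configuration: the memory, and the infinite sequence of the coin tosses still to come. -/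
structure Config : Type where
  mem : Memory
  coins : ℕ → Bool

/-- `Exec p c c' t`: started in the configuration `c`, the program `p` terminates in the
configuration `c'`, and the total logarithmic cost of this execution is `t`. (Once the coin tosses
in `c` are fixed, the execution is deterministic.) -/
inductive Exec : Program → Config → Config → ℕ → Prop
  | skip (c : Config) : Exec .skip c c 1
  | assign (a e : Expr) (c : Config) :
      Exec (.assign a e) c ⟨Function.update c.mem (a.eval c.mem) (e.eval c.mem), c.coins⟩
        (a.cost c.mem + e.cost c.mem + 1)
  | flip (a : Expr) (c : Config) :
      Exec (.flip a) c
        ⟨Function.update c.mem (a.eval c.mem) (c.coins 0).toNat, fun i => c.coins (i + 1)⟩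
        (a.cost c.mem + 1)
  | seq {p q : Program} {c c' c'' : Config} {t t' : ℕ} :
      Exec p c c' t → Exec q c' c'' t' → Exec (.seq p q) c c'' (t + t')
  | iteTrue {e : Expr} {p q : Program} {c c' : Config} {t : ℕ} :
      e.eval c.mem ≠ 0 → Exec p c c' t → Exec (.ite e p q) c c' (e.cost c.mem + 1 + t)
  | iteFalse {e : Expr} {p q : Program} {c c' : Config} {t : ℕ} :
      e.eval c.mem = 0 → Exec q c c' t → Exec (.ite e p q) c c' (e.cost c.mem + 1 + t)
  | loopTrue {e : Expr} {p : Program} {c c' c'' : Config} {t t' : ℕ} :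
      e.eval c.mem ≠ 0 → Exec p c c' t → Exec (.loop e p) c' c'' t' →
        Exec (.loop e p) c c'' (e.cost c.mem + 1 + t + t')
  | loopFalse {e : Expr} {p : Program} {c : Config} :
      e.eval c.mem = 0 → Exec (.loop e p) c c (e.cost c.mem + 1)

/-- With initial memory `m` and coin tosses `ω`, the program `p` terminates within time `T`. -/
def HaltsWithin (p : Program) (m : Memory) (ω : ℕ → Bool) (T : ℕ) : Prop :=
  ∃ c t, Exec p ⟨m, ω⟩ c t ∧ t ≤ T

/-- With initial memory `m` and coin tosses `ω`, the program `p` terminates and answers "yes",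
that is, it leaves a nonzero number in cell `0`. -/
def Accepts (p : Program) (m : Memory) (ω : ℕ → Bool) : Prop :=
  ∃ c t, Exec p ⟨m, ω⟩ c t ∧ c.mem 0 ≠ 0

/-- The law of an infinite sequence of independent fair coin tosses. -/
def coinMeasure : Measure (ℕ → Bool) :=
  Measure.infinitePi fun _ : ℕ => (PMF.uniformOfFintype Bool).toMeasure

end RAM

/-! ## Encoding of the instances -/

open Classical in
/-- The input written as a list of numbers: the number `n` of vertices, the sign and the absolute
value of `k`, the vertices in the order of the linear arrangement, and the adjacency matrix, row by
row. -/
def fvsInput {n : ℕ} (G : SimpleGraph (Fin n)) (ℓ : Fin n ≃ Fin n) (k : ℤ) : List ℕ :=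
  [n, if k < 0 then 1 else 0, k.natAbs] ++
    ((List.finRange n).map fun i => (ℓ i : ℕ)) ++
    (List.finRange n).flatMap fun u => (List.finRange n).map fun v => if G.Adj u v then 1 else 0

/-- The initial memory: the input in the cells `0, 1, 2, …`, and `0` in all other cells. -/
def fvsMemory {n : ℕ} (G : SimpleGraph (Fin n)) (ℓ : Fin n ≃ Fin n) (k : ℤ) : RAM.Memory :=
  fun a => (fvsInput G ℓ k).getD a 0

end

/-! Call an edge set even if it has even degree at every vertex. A forest has only the empty even
edge set, because every nonempty set of its edges has a leaf. In a graph with a cycle, symmetric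
difference with that cycle pairs off the even edge sets. So the number of even edge sets is odd
exactly for forests (`odd_card_evenEdgeSets`).

Consequently the sum over all vertex sets `X` of `∏ v ∈ X, x v` times the number of even edge sets
inside `X` is, modulo 2, the generating polynomial of the induced forests. It equals a sum over edge
sets `F` of a product of local factors, one per vertex: 1 if `F` avoids the vertex, plus `x v` if
its degree in `F` is even (`sum_prod_eq_sum_card_evenEdgeSets`). Such a sum is computed along the
linear arrangement. It suffices to remember which edges of the current cut lie in `F` and, for the
vertex being processed, whether it is deleted or kept with even or odd degree. This gives three
tables with one entry per subset of the cut (`mainLoop_tri`).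

The program works with integers and puts `x v = d ^ w v * D` with random weights `w v < 2 ^ β`. The
base `d = 2 ^ (n * n + n + 1)` exceeds the sum of all coefficients, so the base-`d` digits of the
result are the coefficients, without carries; `d` is even, so the parity of a digit is that of a
quotient by a power of `d`. The shift `D = d ^ (n * 2 ^ β + 1)` outweighs every sum of weights, so
dividing by `D ^ (n - k)` removes exactly the sets with fewer than `n - k` vertices
(`exists_odd_digit_iff`). An odd digit that remains certifies a large induced forest, which excludes
false positives.

Conversely, the sum of the monomials of the large induced forests is a nonzero polynomial of degree
at most `n`. Evaluate it over the domain of polynomials in `T` over `ZMod 2`, at `T ^ (M + w v)`.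
There are at least `2 * n` values for each variable, so by Schwartz–Zippel the result is nonzero
with probability at least 1/2, that is, some digit is odd (`two_mul_card_even_coefficients_le`).

For the time, polynomially many passes over tables of size `O(2 ^ ctw)` use numbers of polynomial
bit length. All numbers are kept below one bound `B`, so the logarithmic cost is at most an
operation count times `B.size + 1`. -/

/-! ## Reasoning about the machine

The memory of the machine is viewed as a read-only input below address `(n + 2) ^ 2`, and above it
four interleaved arrays: the registers (array `0`) and three tables. -/

namespace RAM

/-- The contents of the four arrays. -/
abbrev Store : Type := Fin 4 → ℕ → ℕ

/-- The infinite sequence of coin tosses still to come. -/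
abbrev Coins : Type := ℕ → Bool

/-- Store the value `v` in the entry `a` of the array `j`. -/
def Store.set (σ : Store) (j : Fin 4) (a v : ℕ) : Store :=
  fun j' a' => if j' = j ∧ a' = a then v else σ j' a'

theorem Store.set_apply (σ : Store) (j j' : Fin 4) (a a' v : ℕ) :
    σ.set j a v j' a' = if j' = j ∧ a' = a then v else σ j' a' := rfl

/-- The memory with input `inp` and arrays `σ`. -/
def memOf (n : ℕ) (inp : ℕ → ℕ) (σ : Store) : Memory := fun a =>
  if a < (n + 2) ^ 2 then inp a else σ (Fin.ofNat 4 (a - (n + 2) ^ 2)) ((a - (n + 2) ^ 2) / 4)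

theorem memOf_inp {n : ℕ} {inp : ℕ → ℕ} {σ : Store} {a : ℕ} (h : a < (n + 2) ^ 2) :
    memOf n inp σ a = inp a := if_pos h

theorem memOf_array (n : ℕ) (inp : ℕ → ℕ) (σ : Store) (j : Fin 4) (a : ℕ) :
    memOf n inp σ ((n + 2) ^ 2 + (4 * a + j)) = σ j a := by
  have hj := j.isLt
  have h1 : Fin.ofNat 4 (4 * a + j) = j := by
    apply Fin.ext
    simp only [Fin.ofNat]
    omega
  have h2 : (4 * a + (j : ℕ)) / 4 = a := by omega
  rw [memOf, if_neg (by omega), Nat.add_sub_cancel_left, h1, h2]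

/-- The offset from the base has the array as its remainder modulo 4 and the index as its quotient,
so distinct entries occupy distinct cells and no write reaches the input. -/
theorem update_memOf (n : ℕ) (inp : ℕ → ℕ) (σ : Store) (j : Fin 4) (a v : ℕ) :
    Function.update (memOf n inp σ) ((n + 2) ^ 2 + (4 * a + j)) v = memOf n inp (σ.set j a v) := by
  have hj := j.isLt
  funext b
  by_cases hb : b < (n + 2) ^ 2
  · rw [Function.update_of_ne (by omega), memOf_inp hb, memOf_inp hb]
  · obtain ⟨c, rfl⟩ := Nat.exists_eq_add_of_le (not_lt.1 hb)
    have hc : c = 4 * (c / 4) + (Fin.ofNat 4 c : ℕ) := by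
      simp only [Fin.ofNat]
      omega
    rw [hc, memOf_array, Store.set_apply]
    by_cases h : Fin.ofNat 4 c = j ∧ c / 4 = a
    · obtain ⟨h1, h2⟩ := h
      rw [h1, h2]
      simp
    · rw [if_neg h, Function.update_of_ne, memOf_array]
      intro h'
      apply h
      have h0 := (Fin.ofNat 4 c).isLt
      constructor
      · apply Fin.ext
        omega
      · omega

/-- Terms: `var i` is a register, `get j a` an entry of the array `j`, `inp a` an input cell. -/
inductive Tm : Type
  | lit (c : ℕ) : Tm
  | var (i : ℕ) : Tm
  | get (j : Fin 4) (a : Tm) : Tm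
  | inp (a : Tm) : Tm
  | add (a b : Tm) : Tm
  | sub (a b : Tm) : Tm
  | mul (a b : Tm) : Tm
  | div (a b : Tm) : Tm

/-! ### Values, admissibility and operation counts of terms. -/

namespace Tm

instance : Add Tm := ⟨Tm.add⟩
instance : Sub Tm := ⟨Tm.sub⟩
instance : Mul Tm := ⟨Tm.mul⟩
instance : Div Tm := ⟨Tm.div⟩

/-- The value of a term. -/
def eval (i : ℕ → ℕ) (σ : Store) : Tm → ℕ
  | lit c => c
  | var k => σ 0 k
  | get j a => σ j (a.eval i σ)
  | inp a => i (a.eval i σ)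
  | add a b => a.eval i σ + b.eval i σ
  | sub a b => a.eval i σ - b.eval i σ
  | mul a b => a.eval i σ * b.eval i σ
  | div a b => a.eval i σ / b.eval i σ

/-- All numbers and addresses occurring in the evaluation of the term are admissible. -/
def Ok (n B : ℕ) (i : ℕ → ℕ) (σ : Store) : Tm → Prop
  | lit c => c ≤ B
  | var k => k < 64
  | get _ a => a.Ok n B i σ ∧ (n + 2) ^ 2 + 4 * a.eval i σ + 3 ≤ B
  | inp a => a.Ok n B i σ ∧ a.eval i σ < (n + 2) ^ 2
  | add a b => a.Ok n B i σ ∧ b.Ok n B i σ ∧ a.eval i σ + b.eval i σ ≤ B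
  | sub a b => a.Ok n B i σ ∧ b.Ok n B i σ
  | mul a b => a.Ok n B i σ ∧ b.Ok n B i σ ∧ a.eval i σ * b.eval i σ ≤ B
  | div a b => a.Ok n B i σ ∧ b.Ok n B i σ

/-- The number of operations needed to evaluate a term. -/
def nodes : Tm → ℕ
  | lit _ => 1
  | var _ => 16
  | get _ a => a.nodes + 15
  | inp a => a.nodes + 1
  | add a b => a.nodes + b.nodes + 1
  | sub a b => a.nodes + b.nodes + 1
  | mul a b => a.nodes + b.nodes + 1
  | div a b => a.nodes + b.nodes + 1

section
variable {n B : ℕ} {i : ℕ → ℕ} {σ : Store} {a b : Tm}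

@[simp] theorem eval_lit (c : ℕ) : (lit c).eval i σ = c := rfl
@[simp] theorem eval_var (k : ℕ) : (var k).eval i σ = σ 0 k := rfl
@[simp] theorem eval_get (j : Fin 4) : (get j a).eval i σ = σ j (a.eval i σ) := rfl
@[simp] theorem eval_inp : (inp a).eval i σ = i (a.eval i σ) := rfl
@[simp] theorem eval_add : (a + b).eval i σ = a.eval i σ + b.eval i σ := rfl
@[simp] theorem eval_sub : (a - b).eval i σ = a.eval i σ - b.eval i σ := rfl
@[simp] theorem eval_mul : (a * b).eval i σ = a.eval i σ * b.eval i σ := rfl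
@[simp] theorem eval_div : (a / b).eval i σ = a.eval i σ / b.eval i σ := rfl
@[simp] theorem ok_lit {c : ℕ} : (lit c).Ok n B i σ ↔ c ≤ B := Iff.rfl
@[simp] theorem ok_var {k : ℕ} : (var k).Ok n B i σ ↔ k < 64 := Iff.rfl
@[simp] theorem ok_get {j : Fin 4} :
    (get j a).Ok n B i σ ↔ a.Ok n B i σ ∧ (n + 2) ^ 2 + 4 * a.eval i σ + 3 ≤ B := Iff.rfl
@[simp] theorem ok_inp : (inp a).Ok n B i σ ↔ a.Ok n B i σ ∧ a.eval i σ < (n + 2) ^ 2 := Iff.rfl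
@[simp] theorem ok_add :
    (a + b).Ok n B i σ ↔ a.Ok n B i σ ∧ b.Ok n B i σ ∧ a.eval i σ + b.eval i σ ≤ B := Iff.rfl
@[simp] theorem ok_sub : (a - b).Ok n B i σ ↔ a.Ok n B i σ ∧ b.Ok n B i σ := Iff.rfl
@[simp] theorem ok_mul :
    (a * b).Ok n B i σ ↔ a.Ok n B i σ ∧ b.Ok n B i σ ∧ a.eval i σ * b.eval i σ ≤ B := Iff.rfl
@[simp] theorem ok_div : (a / b).Ok n B i σ ↔ a.Ok n B i σ ∧ b.Ok n B i σ := Iff.rfl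
@[simp] theorem nodes_lit (c : ℕ) : (lit c).nodes = 1 := rfl
@[simp] theorem nodes_var (k : ℕ) : (var k).nodes = 16 := rfl
@[simp] theorem nodes_get (j : Fin 4) : (get j a).nodes = a.nodes + 15 := rfl
@[simp] theorem nodes_inp : (inp a).nodes = a.nodes + 1 := rfl
@[simp] theorem nodes_add : (a + b).nodes = a.nodes + b.nodes + 1 := rfl
@[simp] theorem nodes_sub : (a - b).nodes = a.nodes + b.nodes + 1 := rfl
@[simp] theorem nodes_mul : (a * b).nodes = a.nodes + b.nodes + 1 := rfl
@[simp] theorem nodes_div : (a / b).nodes = a.nodes + b.nodes + 1 := rfl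

end

end Tm

/-- The first address after the input. -/
def baseExpr : Expr :=
  .mul (.add (.cell (.const 0)) (.const 2)) (.add (.cell (.const 0)) (.const 2))

/-- The address of the entry `a` of the array `j`. -/
def arrayExpr (j : Fin 4) (a : Expr) : Expr :=
  .add baseExpr (.add (.mul (.const 4) a) (.const j))

/-- Translation of terms to expressions of the machine. -/
def Tm.compile : Tm → Expr
  | lit c => .const c
  | var k => .cell (arrayExpr 0 (.const k))
  | get j a => .cell (arrayExpr j a.compile)
  | inp a => .cell a.compile
  | add a b => .add a.compile b.compile
  | sub a b => .sub a.compile b.compile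
  | mul a b => .mul a.compile b.compile
  | div a b => .div a.compile b.compile

/-- `B` bounds the input and the addresses of the input and of the registers. -/
structure Frame (n B : ℕ) (inp : ℕ → ℕ) : Prop where
  inp_zero : inp 0 = n
  inp_le : ∀ a, inp a ≤ B
  room : (n + 2) ^ 2 + 256 ≤ B

section
variable {n B : ℕ} {i : ℕ → ℕ} {σ : Store}

/-- The factor 9 is the number of nodes of `baseExpr`. Each node has a value at most `B`, hence
costs at most `B.size + 1`. -/
theorem baseExpr_spec (hF : Frame n B i) :
    baseExpr.eval (memOf n i σ) = (n + 2) ^ 2 ∧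
      baseExpr.cost (memOf n i σ) ≤ 9 * (B.size + 1) := by
  have h0 : memOf n i σ 0 = n := by rw [memOf_inp (by positivity), hF.inp_zero]
  have h1 := hF.room
  have hs2 : Nat.size 2 ≤ B.size := Nat.size_le_size (by omega)
  have hn : n + 2 ≤ B := by nlinarith
  have hsn : n.size ≤ B.size := Nat.size_le_size (by omega)
  have hsn2 : (n + 2).size ≤ B.size := Nat.size_le_size hn
  have hsq : ((n + 2) * (n + 2)).size ≤ B.size := Nat.size_le_size (by nlinarith)
  refine ⟨by simp [baseExpr, Expr.eval, h0, sq], ?_⟩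
  simp only [baseExpr, Expr.eval, Expr.cost, h0, Nat.size_zero]
  omega

/-- Five nodes are added to the nine of `baseExpr`, which gives 14. -/
theorem arrayExpr_spec (hF : Frame n B i) (j : Fin 4) {a : Expr}
    (h : (n + 2) ^ 2 + 4 * a.eval (memOf n i σ) + 3 ≤ B) :
    (arrayExpr j a).eval (memOf n i σ) = (n + 2) ^ 2 + (4 * a.eval (memOf n i σ) + j) ∧
      (arrayExpr j a).cost (memOf n i σ) ≤ a.cost (memOf n i σ) + 14 * (B.size + 1) := by
  obtain ⟨hb, hc⟩ := baseExpr_spec (σ := σ) hF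
  have h1 := hF.room
  have hj := j.isLt
  have e : (arrayExpr j a).eval (memOf n i σ) = (n + 2) ^ 2 + (4 * a.eval (memOf n i σ) + j) := by
    simp [arrayExpr, Expr.eval, hb]
  refine ⟨e, ?_⟩
  have s1 : Nat.size 4 ≤ B.size := Nat.size_le_size (by omega)
  have s2 : (4 * a.eval (memOf n i σ)).size ≤ B.size := Nat.size_le_size (by omega)
  have s3 : (j : ℕ).size ≤ B.size := Nat.size_le_size (by omega)
  have s4 : (4 * a.eval (memOf n i σ) + j).size ≤ B.size := Nat.size_le_size (by omega)
  have s5 : ((n + 2) ^ 2 + (4 * a.eval (memOf n i σ) + j)).size ≤ B.size :=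
    Nat.size_le_size (by omega)
  simp only [arrayExpr, Expr.cost, Expr.eval, hb] at *
  omega

/-- A register costs 14 nodes for address arithmetic, one for its constant index and one for the
access. The 64 registers are interleaved with three tables, hence the 256 cells in `Frame.room`.
Differences and quotients never exceed their first operand, so `Ok` bounds only sums, products and
addresses. -/
theorem Tm.compile_spec (hF : Frame n B i) (hσ : ∀ j a, σ j a ≤ B) :
    ∀ e : Tm, e.Ok n B i σ → e.eval i σ ≤ B ∧
      e.compile.eval (memOf n i σ) = e.eval i σ ∧
      e.compile.cost (memOf n i σ) ≤ e.nodes * (B.size + 1)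
  | lit c, h => by
    have : c.size ≤ B.size := Nat.size_le_size h
    refine ⟨h, rfl, ?_⟩
    simp only [compile, Expr.cost, nodes]
    omega
  | var k, h => by
    have hr := hF.room
    have hk : k < 64 := h
    have := arrayExpr_spec (σ := σ) hF 0 (a := .const k) (by simp only [Expr.eval]; omega)
    have h1 := Nat.size_le_size (hσ 0 k)
    have h2 : k.size ≤ B.size := Nat.size_le_size (by omega)
    have h3 : (Tm.var k).compile.eval (memOf n i σ) = σ 0 k := by
      simp only [compile, Expr.eval, this.1]
      exact memOf_array n i σ 0 k
    refine ⟨hσ 0 k, h3, ?_⟩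
    simp only [compile] at h3
    simp only [compile, Expr.cost, nodes, h3] at this ⊢
    omega
  | get j a, h => by
    obtain ⟨h1, h2, h3⟩ := a.compile_spec hF hσ h.1
    have := arrayExpr_spec (σ := σ) hF j (a := a.compile) (by rw [h2]; exact h.2)
    have h4 := Nat.size_le_size (hσ j (a.eval i σ))
    have h5 : (Tm.get j a).compile.eval (memOf n i σ) = σ j (a.eval i σ) := by
      simp only [compile, Expr.eval, this.1, h2]
      exact memOf_array n i σ j _
    refine ⟨hσ _ _, h5, ?_⟩
    simp only [compile] at h5
    simp only [compile, Expr.cost, nodes, h5]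
    linarith [this.2]
  | inp a, h => by
    obtain ⟨h1, h2, h3⟩ := a.compile_spec hF hσ h.1
    have h5 : (Tm.inp a).compile.eval (memOf n i σ) = i (a.eval i σ) := by
      simp only [compile, Expr.eval, h2]
      exact memOf_inp h.2
    have h4 := Nat.size_le_size (hF.inp_le (a.eval i σ))
    refine ⟨hF.inp_le _, h5, ?_⟩
    simp only [compile] at h5
    simp only [compile, Expr.cost, nodes, h5]
    linarith
  | add a b, h => by
    obtain ⟨h1, h2, h3⟩ := a.compile_spec hF hσ h.1
    obtain ⟨h1', h2', h3'⟩ := b.compile_spec hF hσ h.2.1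
    have h4 := Nat.size_le_size h.2.2
    refine ⟨h.2.2, by simp only [compile, Expr.eval, eval, h2, h2'], ?_⟩
    simp only [compile, Expr.cost, Expr.eval, nodes, h2, h2']
    linarith
  | sub a b, h => by
    obtain ⟨h1, h2, h3⟩ := a.compile_spec hF hσ h.1
    obtain ⟨h1', h2', h3'⟩ := b.compile_spec hF hσ h.2
    have h5 : (sub a b).eval i σ ≤ B := (Nat.sub_le _ _).trans h1
    have h4 := Nat.size_le_size h5
    refine ⟨h5, by simp only [compile, Expr.eval, eval, h2, h2'], ?_⟩
    simp only [eval] at h4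
    simp only [compile, Expr.cost, Expr.eval, nodes, h2, h2']
    linarith
  | mul a b, h => by
    obtain ⟨h1, h2, h3⟩ := a.compile_spec hF hσ h.1
    obtain ⟨h1', h2', h3'⟩ := b.compile_spec hF hσ h.2.1
    have h4 := Nat.size_le_size h.2.2
    refine ⟨h.2.2, by simp only [compile, Expr.eval, eval, h2, h2'], ?_⟩
    simp only [compile, Expr.cost, Expr.eval, nodes, h2, h2']
    linarith
  | div a b, h => by
    obtain ⟨h1, h2, h3⟩ := a.compile_spec hF hσ h.1
    obtain ⟨h1', h2', h3'⟩ := b.compile_spec hF hσ h.2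
    have h5 : (div a b).eval i σ ≤ B := (Nat.div_le_self _ _).trans h1
    have h4 := Nat.size_le_size h5
    refine ⟨h5, by simp only [compile, Expr.eval, eval, h2, h2'], ?_⟩
    simp only [eval] at h4
    simp only [compile, Expr.cost, Expr.eval, nodes, h2, h2']
    linarith

end

/-- `Tri n B inp p σ ω Q T`: started with the arrays `σ` and the coin tosses `ω`, the program `p`
stops within `T` operations on numbers bounded by `B`, and the result satisfies `Q`. -/
def Tri (n B : ℕ) (inp : ℕ → ℕ) (p : Program) (σ : Store) (ω : Coins) (Q : Store → Coins → Prop)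
    (T : ℕ) : Prop :=
  Frame n B inp → (∀ j a, σ j a ≤ B) → ∃ σ' ω' t,
    Exec p ⟨memOf n inp σ, ω⟩ ⟨memOf n inp σ', ω'⟩ t ∧ t ≤ T * (B.size + 1) ∧
      (∀ j a, σ' j a ≤ B) ∧ Q σ' ω'

/-- Assignments `j[a] := e`. -/
structure Asg : Type where
  arr : Fin 4
  idx : Tm
  val : Tm

/-- Assignment to a register. -/
@[simps] def Asg.reg (i : ℕ) (e : Tm) : Asg := ⟨0, .lit i, e⟩

/-- Straight-line programs. -/
def block : List Asg → Program
  | [] => .skip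
  | s :: l => .seq (.assign (arrayExpr s.arr s.idx.compile) s.val.compile) (block l)

/-- The arrays after the execution of a straight-line program. -/
def blockSem (inp : ℕ → ℕ) : List Asg → Store → Store
  | [], σ => σ
  | s :: l, σ => blockSem inp l (σ.set s.arr (s.idx.eval inp σ) (s.val.eval inp σ))

/-- All numbers and addresses in the execution of a straight-line program are admissible. -/
def blockOk (n B : ℕ) (inp : ℕ → ℕ) : List Asg → Store → Prop
  | [], _ => True
  | s :: l, σ => s.idx.Ok n B inp σ ∧ (n + 2) ^ 2 + 4 * s.idx.eval inp σ + 3 ≤ B ∧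
      s.val.Ok n B inp σ ∧ blockOk n B inp l (σ.set s.arr (s.idx.eval inp σ) (s.val.eval inp σ))

/-- The number of operations of a straight-line program. -/
def blockCost : List Asg → ℕ
  | [] => 1
  | s :: l => s.idx.nodes + s.val.nodes + 15 + blockCost l

/-! ### Rules for total correctness with time bounds. -/

section
variable {n B : ℕ} {inp : ℕ → ℕ} {σ : Store} {ω : Coins} {Q Q' : Store → Coins → Prop} {T T' : ℕ}
  {p q : Program}

theorem Tri.mono (h : Tri n B inp p σ ω Q T) (hQ : ∀ σ' ω', Q σ' ω' → Q' σ' ω') (hT : T ≤ T') :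
    Tri n B inp p σ ω Q' T' := fun hF hσ => by
  obtain ⟨σ', ω', t, h1, h2, h3, h4⟩ := h hF hσ
  exact ⟨σ', ω', t, h1, h2.trans (Nat.mul_le_mul_right _ hT), h3, hQ _ _ h4⟩

theorem Tri.seq {T₁ T₂ : ℕ} (h : Tri n B inp p σ ω (fun σ' ω' => Tri n B inp q σ' ω' Q T₂) T₁)
    (hT : T₁ + T₂ ≤ T) : Tri n B inp (.seq p q) σ ω Q T := fun hF hσ => by
  obtain ⟨σ', ω', t, h1, h2, h3, h4⟩ := h hF hσ
  obtain ⟨σ'', ω'', t', h1', h2', h3', h4'⟩ := h4 hF h3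
  refine ⟨σ'', ω'', t + t', .seq h1 h1', ?_, h3', h4'⟩
  calc t + t' ≤ T₁ * (B.size + 1) + T₂ * (B.size + 1) := add_le_add h2 h2'
    _ = (T₁ + T₂) * (B.size + 1) := by ring
    _ ≤ _ := Nat.mul_le_mul_right _ hT

theorem Tri.skip (hQ : Q σ ω) (hT : 1 ≤ T) : Tri n B inp .skip σ ω Q T := fun _ hσ =>
  ⟨σ, ω, 1, .skip _, by nlinarith [Nat.zero_le B.size], hσ, hQ⟩

/-- Makes the standing assumptions on the input and the arrays available while the goal is still a
triple. -/
theorem Tri.of_frame (h : Frame n B inp → (∀ j a, σ j a ≤ B) → Tri n B inp p σ ω Q T) :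
    Tri n B inp p σ ω Q T := fun hF hσ => h hF hσ hF hσ

theorem set_le {j a v} (hσ : ∀ j a, σ j a ≤ B) (hv : v ≤ B) (j' a') : σ.set j a v j' a' ≤ B := by
  rw [Store.set_apply]
  split_ifs
  exacts [hv, hσ _ _]

/-- Reduces straight-line code to evaluating `blockSem`, which simplification can do. The 15 per
assignment consists of 14 for the address arithmetic and one for the assignment. -/
theorem Tri.block : ∀ {l : List Asg} {σ : Store} {T : ℕ}, blockOk n B inp l σ → Q (blockSem inp l σ) ω →
    blockCost l ≤ T → Tri n B inp (block l) σ ω Q T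
  | [], _, _, _, hQ, hT => Tri.skip hQ hT
  | s :: l, σ, _, hok, hQ, hT => by
    obtain ⟨ho1, ho2, ho3, ho4⟩ := hok
    refine Tri.seq (T₁ := s.idx.nodes + s.val.nodes + 15) (T₂ := blockCost l) ?_ hT
    intro hF hσ
    obtain ⟨h1, h2, h3⟩ := s.idx.compile_spec hF hσ ho1
    obtain ⟨h1', h2', h3'⟩ := s.val.compile_spec hF hσ ho3
    have ha := arrayExpr_spec (σ := σ) hF s.arr (a := s.idx.compile) (by rw [h2]; exact ho2)
    refine ⟨_, ω, (arrayExpr s.arr s.idx.compile).cost (memOf n inp σ) +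
      s.val.compile.cost (memOf n inp σ) + 1, ?_, ?_, set_le (j := s.arr) (a := s.idx.eval inp σ) hσ h1',
      Tri.block (l := l) ho4 hQ le_rfl⟩
    · have := Exec.assign (arrayExpr s.arr s.idx.compile) s.val.compile ⟨memOf n inp σ, ω⟩
      rwa [ha.1, h2, h2', update_memOf] at this
    · linarith [ha.2]

theorem Tri.flip {i : ℕ} (hi : i < 64) (hQ : Q (σ.set 0 i (ω 0).toNat) (fun k => ω (k + 1)))
    (hT : 16 ≤ T) : Tri n B inp (.flip (arrayExpr 0 (.const i))) σ ω Q T := fun hF hσ => by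
  have hr := hF.room
  have ha := arrayExpr_spec (σ := σ) hF 0 (a := .const i) (by simp only [Expr.eval]; omega)
  refine ⟨_, _, (arrayExpr 0 (.const i)).cost (memOf n inp σ) + 1, ?_, ?_,
    set_le (j := 0) (a := i) (v := (ω 0).toNat) hσ ?_, hQ⟩
  · have := Exec.flip (arrayExpr 0 (.const i)) ⟨memOf n inp σ, ω⟩
    rwa [ha.1, show (Expr.const i).eval (memOf n inp σ) = i from rfl, update_memOf] at this
  · have h2 : i.size ≤ B.size := Nat.size_le_size (by omega)
    have h3 := ha.2
    simp only [Expr.cost] at h3 ⊢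
    calc _ ≤ 16 * (B.size + 1) := by omega
      _ ≤ _ := Nat.mul_le_mul_right _ hT
  · have := (ω 0).toNat_le
    omega

theorem Tri.ite {e : Tm} (he : e.Ok n B inp σ) (hp : e.eval inp σ ≠ 0 → Tri n B inp p σ ω Q T')
    (hq : e.eval inp σ = 0 → Tri n B inp q σ ω Q T') (hT : T' + e.nodes + 1 ≤ T) :
    Tri n B inp (.ite e.compile p q) σ ω Q T := fun hF hσ => by
  obtain ⟨h1, h2, h3⟩ := e.compile_spec hF hσ he
  have key : ∀ t, t ≤ T' * (B.size + 1) →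
      e.compile.cost (memOf n inp σ) + 1 + t ≤ T * (B.size + 1) := fun t ht => by
    calc _ ≤ (T' + e.nodes + 1) * (B.size + 1) := by linarith [Nat.zero_le B.size]
      _ ≤ _ := Nat.mul_le_mul_right _ hT
  by_cases h : e.eval inp σ = 0
  · obtain ⟨σ', ω', t, h1, h2', h3, h4⟩ := hq h hF hσ
    exact ⟨σ', ω', _, .iteFalse (by simpa [h2] using h) h1, key _ h2', h3, h4⟩
  · obtain ⟨σ', ω', t, h1, h2', h3, h4⟩ := hp h hF hσ
    exact ⟨σ', ω', _, .iteTrue (by simpa [h2] using h) h1, key _ h2', h3, h4⟩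

/-- A loop whose invariant `I` is indexed by the number of rounds still to go. -/
theorem Tri.loop_down {e : Tm} (I : ℕ → Store → Coins → Prop)
    (hok : ∀ k σ ω, (∀ j a, σ j a ≤ B) → I k σ ω → e.Ok n B inp σ)
    (hstep : ∀ k σ ω, (∀ j a, σ j a ≤ B) → I (k + 1) σ ω → e.eval inp σ ≠ 0 ∧
      Tri n B inp p σ ω (I k) T')
    (hend : ∀ σ ω, (∀ j a, σ j a ≤ B) → I 0 σ ω → e.eval inp σ = 0) :
    ∀ (k : ℕ) (σ : Store) (ω : Coins), I k σ ω →
      Tri n B inp (.loop e.compile p) σ ω (I 0) (k * (T' + e.nodes + 1) + (e.nodes + 1))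
  | 0, σ, ω, h => fun hF hσ => by
    obtain ⟨h1, h2, h3⟩ := e.compile_spec hF hσ (hok _ _ _ hσ h)
    refine ⟨σ, ω, _, .loopFalse ?_, ?_, hσ, h⟩
    · simpa [h2] using hend _ _ hσ h
    · dsimp only
      linarith [Nat.zero_le B.size]
  | k + 1, σ, ω, h => fun hF hσ => by
    obtain ⟨h1, h2, h3⟩ := e.compile_spec hF hσ (hok _ _ _ hσ h)
    obtain ⟨hne, hb⟩ := hstep k σ ω hσ h
    obtain ⟨σ', ω', t, g1, g2, g3, g4⟩ := hb hF hσ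
    obtain ⟨σ'', ω'', t', g1', g2', g3', g4'⟩ :=
      Tri.loop_down I hok hstep hend k σ' ω' g4 hF g3
    refine ⟨σ'', ω'', _, .loopTrue (by simpa [h2] using hne) g1 g1', ?_, g3', g4'⟩
    dsimp only
    linarith [Nat.zero_le B.size]

/-- A loop with at most `N` rounds whose invariant `I` is indexed by the number of rounds done. -/
theorem Tri.loop {e : Tm} (I : ℕ → Store → Coins → Prop) (N : ℕ)
    (h0 : I 0 σ ω)
    (hok : ∀ k σ ω, (∀ j a, σ j a ≤ B) → k ≤ N → I k σ ω → e.Ok n B inp σ)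
    (hstep : ∀ k σ ω, (∀ j a, σ j a ≤ B) → k < N → I k σ ω → e.eval inp σ ≠ 0 ∧
      Tri n B inp p σ ω (I (k + 1)) T')
    (hend : ∀ σ ω, (∀ j a, σ j a ≤ B) → I N σ ω → e.eval inp σ = 0)
    (hQ : ∀ σ ω, I N σ ω → Q σ ω)
    (hT : N * (T' + e.nodes + 1) + (e.nodes + 1) ≤ T) :
    Tri n B inp (.loop e.compile p) σ ω Q T := by
  refine (Tri.loop_down (fun k σ ω => k ≤ N ∧ I (N - k) σ ω) ?_ ?_ ?_ N σ ω
    ⟨le_rfl, by simpa using h0⟩).mono ?_ hT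
  · exact fun k σ ω hσ h => hok (N - k) σ ω hσ (Nat.sub_le _ _) h.2
  · intro k σ ω hσ h
    obtain ⟨h1, h2⟩ := hstep (N - (k + 1)) σ ω hσ (by omega) h.2
    refine ⟨h1, h2.mono (fun σ' ω' h' => ⟨by omega, ?_⟩) le_rfl⟩
    rwa [show N - (k + 1) + 1 = N - k by omega] at h'
  · exact fun σ ω hσ h => hend σ ω hσ (by simpa using h.2)
  · exact fun σ ω h => hQ σ ω (by simpa using h.2)

end

/-- The execution of a program is determined by the initial configuration. -/
theorem Exec.deterministic {p : Program} {c c₁ c₂ : Config} {t₁ t₂ : ℕ} (h₁ : Exec p c c₁ t₁)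
    (h₂ : Exec p c c₂ t₂) : c₁ = c₂ := by
  induction h₁ generalizing c₂ t₂ with
  | skip c => cases h₂; rfl
  | assign a e c => cases h₂; rfl
  | flip a c => cases h₂; rfl
  | seq _ _ ih ih' =>
    cases h₂ with
    | seq g g' => cases ih g; exact ih' g'
  | iteTrue h _ ih =>
    cases h₂ with
    | iteTrue _ g => exact ih g
    | iteFalse h' _ => exact absurd h' h
  | iteFalse h _ ih =>
    cases h₂ with
    | iteTrue h' _ => exact absurd h h'
    | iteFalse _ g => exact ih g
  | loopTrue h _ _ ih ih' =>
    cases h₂ with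
    | loopTrue _ g g' => cases ih g; exact ih' g'
    | loopFalse h' => exact absurd h' h
  | loopFalse h =>
    cases h₂ with
    | loopTrue h' _ _ => exact absurd h h'
    | loopFalse _ => rfl

end RAM

/-! ## The passes over the tables -/

namespace RAM

open Tm

/-- Register `10` counts from `0` to the content of register `6`; in each round the body `l` is
executed. -/
def pass (l : List Asg) : Program :=
  .seq (block [.reg 10 (lit 0)])
    (.loop (var 6 - var 10).compile (block (l ++ [.reg 10 (var 10 + lit 1)])))

/-- Start a new vertex, whose indeterminate is stored in register `4`. -/
def startPass : Program :=
  pass [.reg 11 (get 1 (var 10) + get 2 (var 10)), ⟨1, var 10, var 11⟩,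
    ⟨2, var 10, var 11 * var 4⟩, ⟨3, var 10, lit 0⟩]

section
variable {n B : ℕ} {inp : ℕ → ℕ} {σ : Store} {ω : Coins}

/-- Closing the previous vertex keeps the states "deleted" and "even" and drops "odd". The new
vertex has seen no edge, so it starts as deleted with factor 1 or as kept with even degree and
factor the indeterminate. -/
theorem startPass_tri {b : ℕ} (hb : ∀ s, σ 1 s ≤ b ∧ σ 2 s ≤ b) (hb' : 2 * b ≤ B)
    (hb'' : 2 * b * σ 0 4 ≤ B) (hB : (n + 2) ^ 2 + 256 + 4 * σ 0 6 ≤ B) :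
    Tri n B inp startPass σ ω (fun σ' ω' => ω' = ω ∧ (∀ a < 10, σ' 0 a = σ 0 a) ∧
      (σ' 1 = fun s => if s < σ 0 6 then σ 1 s + σ 2 s else σ 1 s) ∧
      (σ' 2 = fun s => if s < σ 0 6 then (σ 1 s + σ 2 s) * σ 0 4 else σ 2 s) ∧
      (σ' 3 = fun s => if s < σ 0 6 then 0 else σ 3 s)) (1000 * (σ 0 6 + 1)) := by
  set C := σ 0 6 with hC
  refine Tri.seq (T₁ := 100) (T₂ := 900 * (C + 1)) (Tri.block ?_ ?_ ?_) (by omega)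
  · simp [blockOk]
    omega
  · refine Tri.loop (T' := 500) (fun t σ' ω' => ω' = ω ∧ (∀ a < 10, σ' 0 a = σ 0 a) ∧
      σ' 0 10 = t ∧ (σ' 1 = fun s => if s < t then σ 1 s + σ 2 s else σ 1 s) ∧
      (σ' 2 = fun s => if s < t then (σ 1 s + σ 2 s) * σ 0 4 else σ 2 s) ∧
      (σ' 3 = fun s => if s < t then 0 else σ 3 s)) C ?_ ?_ ?_ ?_ ?_ ?_
    · refine ⟨rfl, fun a ha => ?_, ?_⟩
      · have n10 : a ≠ 10 := by omega
        simp [blockSem, Store.set_apply, n10]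
      · simp [blockSem, Store.set_apply]
        refine ⟨?_, ?_, ?_⟩ <;> rfl
    · rintro t σ' ω' - ht ⟨-, -, -⟩
      simp
    · rintro t σ' ω' - ht ⟨rfl, h1, h2, h3, h4, h5⟩
      have h6 := h1 6 (by omega)
      have h4' := h1 4 (by omega)
      have e1 : σ' 1 t = σ 1 t := by simp [h3]
      have e2 : σ' 2 t = σ 2 t := by simp [h4]
      obtain ⟨b1, b2⟩ := hb t
      have b3 : (σ 1 t + σ 2 t) * σ 0 4 ≤ 2 * b * σ 0 4 := by gcongr; omega
      refine ⟨by simp [h6, h2]; omega, Tri.block ?_ ?_ ?_⟩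
      · simp [blockOk, Store.set_apply, h2, h4', e1, e2]
        omega
      · refine ⟨rfl, fun a ha => ?_, ?_, ?_, ?_, ?_⟩
        · obtain ⟨n10, n11⟩ : a ≠ 10 ∧ a ≠ 11 := by omega
          simp [blockSem, Store.set_apply, n10, n11, h1 a ha]
        · simp [blockSem, Store.set_apply, h2]
        all_goals
          funext s
          rcases lt_trichotomy s t with h | h | h
          · simp [blockSem, Store.set_apply, h2, h3, h4, h5, h4', h, h.ne, h.trans (Nat.lt_succ_self t)]
          · simp [blockSem, Store.set_apply, h2, h4', e1, e2, h]
          · simp [blockSem, Store.set_apply, h2, h3, h4, h5, h.ne', h.not_gt, h.not_ge]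
      · simp [blockCost]
    · rintro σ' ω' - ⟨-, h1, h2, -⟩
      simp [h1, h2, hC]
    · rintro σ' ω' ⟨h1, h2, h3, h4⟩
      exact ⟨h1, h2, h4⟩
    · simp
      omega
  · simp [blockCost]

/-- Forget the edge at the lowest bit. -/
def forgetPass : Program :=
  .seq (block [.reg 6 (var 6 / lit 2)])
    (pass [⟨1, var 10, get 1 (lit 2 * var 10)⟩,
      .reg 11 (get 2 (lit 2 * var 10) + get 3 (lit 2 * var 10 + lit 1)),
      ⟨3, var 10, get 3 (lit 2 * var 10) + get 2 (lit 2 * var 10 + lit 1)⟩,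
      ⟨2, var 10, var 11⟩])

/-- The entries `2 * s` and `2 * s + 1` belong to the lowest edge being absent and present. A
present edge swaps the parities and is incompatible with a deleted endpoint, so the first table
keeps only the even entries. -/
theorem forgetPass_tri {b C : ℕ} (hb : ∀ s, σ 2 s ≤ b ∧ σ 3 s ≤ b) (hb' : 2 * b ≤ B)
    (hC : σ 0 6 = 2 * C) (hB : (n + 2) ^ 2 + 256 + 4 * (2 * C) ≤ B) :
    Tri n B inp forgetPass σ ω (fun σ' ω' => ω' = ω ∧ σ' 0 6 = C ∧
      (∀ a < 10, a ≠ 6 → σ' 0 a = σ 0 a) ∧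
      (σ' 1 = fun s => if s < C then σ 1 (2 * s) else σ 1 s) ∧
      (σ' 2 = fun s => if s < C then σ 2 (2 * s) + σ 3 (2 * s + 1) else σ 2 s) ∧
      (σ' 3 = fun s => if s < C then σ 3 (2 * s) + σ 2 (2 * s + 1) else σ 3 s))
      (1000 * (C + 1)) := by
  refine Tri.seq (T₁ := 50) (T₂ := 900 * (C + 1) + 50) (Tri.block ?_ ?_ ?_) (by omega)
  · simp [blockOk]
    omega
  · refine Tri.seq (T₁ := 50) (T₂ := 900 * (C + 1)) (Tri.block ?_ ?_ ?_) (by omega)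
    · simp [blockOk]
      omega
    · refine Tri.loop (T' := 500) (fun t σ' ω' => ω' = ω ∧ σ' 0 6 = C ∧
        (∀ a < 10, a ≠ 6 → σ' 0 a = σ 0 a) ∧ σ' 0 10 = t ∧
        (σ' 1 = fun s => if s < t then σ 1 (2 * s) else σ 1 s) ∧
        (σ' 2 = fun s => if s < t then σ 2 (2 * s) + σ 3 (2 * s + 1) else σ 2 s) ∧
        (σ' 3 = fun s => if s < t then σ 3 (2 * s) + σ 2 (2 * s + 1) else σ 3 s))
        C ?_ ?_ ?_ ?_ ?_ ?_
      · refine ⟨rfl, by simp [blockSem, Store.set_apply, hC], fun a ha ha' => ?_, ?_⟩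
        · have n10 : a ≠ 10 := by omega
          simp [blockSem, Store.set_apply, n10, ha']
        · simp [blockSem, Store.set_apply]
          refine ⟨?_, ?_, ?_⟩ <;> rfl
      · rintro t σ' ω' - ht ⟨-, -, -⟩
        simp
      · rintro t σ' ω' - ht ⟨rfl, h6, h1, h2, h3, h4, h5⟩
        -- The pass is in place and ascending; the addresses `2 * t` and `2 * t + 1` are not below
        -- `t`, so they still hold the original values.
        have e1 : σ' 1 (2 * t) = σ 1 (2 * t) := by
          simp only [h3, if_neg (by omega : ¬ 2 * t < t)]
        have e2 : σ' 2 (2 * t) = σ 2 (2 * t) := by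
          simp only [h4, if_neg (by omega : ¬ 2 * t < t)]
        have e3 : σ' 3 (2 * t) = σ 3 (2 * t) := by
          simp only [h5, if_neg (by omega : ¬ 2 * t < t)]
        have e2' : σ' 2 (2 * t + 1) = σ 2 (2 * t + 1) := by
          simp only [h4, if_neg (by omega : ¬ 2 * t + 1 < t)]
        have e3' : σ' 3 (2 * t + 1) = σ 3 (2 * t + 1) := by
          simp only [h5, if_neg (by omega : ¬ 2 * t + 1 < t)]
        obtain ⟨b2, b3⟩ := hb (2 * t)
        obtain ⟨b2', b3'⟩ := hb (2 * t + 1)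
        refine ⟨by simp [h6, h2]; omega, Tri.block ?_ ?_ ?_⟩
        · simp [blockOk, Store.set_apply, h2, e2, e3, e2', e3']
          omega
        · refine ⟨rfl, by simp [blockSem, Store.set_apply, h6], fun a ha ha' => ?_, ?_, ?_, ?_, ?_⟩
          · obtain ⟨n10, n11⟩ : a ≠ 10 ∧ a ≠ 11 := by omega
            simp [blockSem, Store.set_apply, n10, n11, h1 a ha ha']
          · simp [blockSem, Store.set_apply, h2]
          all_goals
            funext s
            rcases lt_trichotomy s t with h | h | h
            · simp [blockSem, Store.set_apply, h2, h3, h4, h5, h, h.ne,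
                h.trans (Nat.lt_succ_self t)]
            · simp [blockSem, Store.set_apply, h2, e1, e2, e3, e2', e3', h]
            · simp [blockSem, Store.set_apply, h2, h3, h4, h5, h.ne', h.not_gt, h.not_ge]
        · simp [blockCost]
      · rintro σ' ω' - ⟨-, h6, -, h2, -⟩
        simp [h6, h2]
      · rintro σ' ω' ⟨h1, h6, h2, h3, h4⟩
        exact ⟨h1, h6, h2, h4⟩
      · simp
        omega
    · simp [blockCost]
  · simp [blockCost]

end

/-- The bit of `s` at the position with value `P`. -/
def bitOf (P s : ℕ) : ℕ := s / P % 2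

/-- The number `s` with the bit at the position with value `P` deleted. -/
def delBit (P s : ℕ) : ℕ := s / (2 * P) * P + s % P

/-- The machine has no remainder operation, so remainders are formed from a quotient, a product and
a difference. -/
theorem bitOf_eq (P s : ℕ) : (s - s / (2 * P) * (2 * P)) / P = bitOf P s := by
  rw [mul_comm (s / (2 * P)), ← Nat.mod_eq_sub_mul_div, mul_comm, Nat.mod_mul_right_div_self, bitOf]

theorem bitOf_le (P s : ℕ) : bitOf P s ≤ 1 := by
  unfold bitOf
  omega

theorem delBit_eq (P s : ℕ) :
    s / (2 * P) * P + (s - s / (2 * P) * (2 * P) - bitOf P s * P) = delBit P s := by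
  rw [delBit, ← bitOf_eq, mul_comm (s / (2 * P)) (2 * P), ← Nat.mod_eq_sub_mul_div,
    mul_comm (s % (2 * P) / P) P, ← Nat.mod_eq_sub_mul_div, Nat.mod_mul_left_mod]

/-- Insertion in place is safe in descending order because no entry is read from above its own
address. -/
theorem delBit_le (P s : ℕ) : delBit P s ≤ s := by
  unfold delBit
  have h1 := Nat.div_add_mod s P
  have h2 : s / (2 * P) ≤ s / P := by
    rcases Nat.eq_zero_or_pos P with rfl | hP
    · simp
    · exact Nat.div_le_div_left (by omega) hP
  nlinarith

/-- Insert an edge at the bit whose value is stored in register `7`. -/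
def insertPass : Program :=
  .seq (block [.reg 6 (var 6 * lit 2), .reg 10 (var 6)])
    (.loop (var 10).compile (block [.reg 10 (var 10 - lit 1),
      .reg 11 (var 10 / (lit 2 * var 7)),
      .reg 12 (var 10 - var 11 * (lit 2 * var 7)),
      .reg 13 (var 12 / var 7),
      .reg 14 (var 11 * var 7 + (var 12 - var 13 * var 7)),
      .reg 15 (get 2 (var 14)),
      .reg 16 (get 3 (var 14)),
      ⟨1, var 10, get 1 (var 14) * (lit 1 - var 13)⟩,
      ⟨2, var 10, var 15 * (lit 1 - var 13) + var 16 * var 13⟩,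
      ⟨3, var 10, var 16 * (lit 1 - var 13) + var 15 * var 13⟩]))

section
variable {n B : ℕ} {inp : ℕ → ℕ} {σ : Store} {ω : Coins}

/-- If the new edge is present, the entry without it is used with swapped parities, and a deleted
endpoint contributes 0. Every new entry is a copy of an old one or 0, so bounds on the tables
survive. -/
theorem insertPass_tri {C P : ℕ} (hC : σ 0 6 = C) (hP : σ 0 7 = P) (hPC : P ≤ C)
    (hσB : ∀ j a, σ j a ≤ B)
    (hB : (n + 2) ^ 2 + 256 + 4 * (2 * C) ≤ B) :
    Tri n B inp insertPass σ ω (fun σ' ω' => ω' = ω ∧ σ' 0 6 = 2 * C ∧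
      (∀ a < 10, a ≠ 6 → σ' 0 a = σ 0 a) ∧
      (σ' 1 = fun s => if s < 2 * C then if bitOf P s = 0 then σ 1 (delBit P s) else 0
        else σ 1 s) ∧
      (σ' 2 = fun s => if s < 2 * C then if bitOf P s = 0 then σ 2 (delBit P s) else
        σ 3 (delBit P s) else σ 2 s) ∧
      (σ' 3 = fun s => if s < 2 * C then if bitOf P s = 0 then σ 3 (delBit P s) else
        σ 2 (delBit P s) else σ 3 s)) (2000 * (C + 1)) := by
  refine Tri.seq (T₁ := 100) (T₂ := 1900 * (C + 1)) (Tri.block ?_ ?_ ?_) (by omega)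
  · simp [blockOk, hC]
    omega
  · refine Tri.loop (T' := 930) (fun t σ' ω' => ω' = ω ∧ σ' 0 6 = 2 * C ∧
        (∀ a < 10, a ≠ 6 → σ' 0 a = σ 0 a) ∧ σ' 0 10 = 2 * C - t ∧
      (σ' 1 = fun s => if 2 * C - t ≤ s ∧ s < 2 * C then
        if bitOf P s = 0 then σ 1 (delBit P s) else 0 else σ 1 s) ∧
      (σ' 2 = fun s => if 2 * C - t ≤ s ∧ s < 2 * C then
        if bitOf P s = 0 then σ 2 (delBit P s) else σ 3 (delBit P s) else σ 2 s) ∧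
      (σ' 3 = fun s => if 2 * C - t ≤ s ∧ s < 2 * C then
        if bitOf P s = 0 then σ 3 (delBit P s) else σ 2 (delBit P s) else σ 3 s))
      (2 * C) ?_ ?_ ?_ ?_ ?_ ?_
    · refine ⟨rfl, by simp [blockSem, Store.set_apply, hC, mul_comm], fun a ha ha' => ?_, ?_⟩
      · have n10 : a ≠ 10 := by omega
        simp [blockSem, Store.set_apply, n10, ha']
      · simp [blockSem, Store.set_apply, hC, mul_comm]
        refine ⟨?_, ?_, ?_⟩ <;>
        · funext s
          rw [if_neg (by omega)]
          simp [Store.set_apply]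
    · rintro t σ' ω' - ht ⟨-, -, -⟩
      simp
    · rintro t σ' ω' - ht ⟨rfl, h6, h1, h2, h3, h4, h5⟩
      obtain ⟨u, hu⟩ : ∃ u, u = 2 * C - t - 1 := ⟨_, rfl⟩
      have hd := delBit_le P u
      have hb := bitOf_le P u
      have h7 := h1 7 (by omega) (by omega)
      -- The source lies below all addresses written so far.
      have hd' : ¬ 2 * C - t ≤ delBit P u := by omega
      have e1 : σ' 1 (delBit P u) = σ 1 (delBit P u) := by simp [h3, hd']
      have e2 : σ' 2 (delBit P u) = σ 2 (delBit P u) := by simp [h4, hd']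
      have e3 : σ' 3 (delBit P u) = σ 3 (delBit P u) := by simp [h5, hd']
      have hb' : bitOf P u = 0 ∨ bitOf P u = 1 := by omega
      have q1 := hσB 1 (delBit P u)
      have q2 := hσB 2 (delBit P u)
      have q3 := hσB 3 (delBit P u)
      refine ⟨by simp [h2]; omega, Tri.block ?_ ?_ ?_⟩
      · have m1 : u / (2 * P) * (2 * P) ≤ u := Nat.div_mul_le_self _ _
        have m2 : u / (2 * P) * P ≤ u := by nlinarith
        rcases hb' with hb' | hb' <;>
        · have hdd := delBit_eq P u
          rw [hb'] at hdd
          simp [blockOk, Store.set_apply, h2, h7, ← hu, bitOf_eq, hP, hb'] at hdd ⊢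
          simp [hdd, e1, e2, e3]
          omega
      · refine ⟨rfl, by simp [blockSem, Store.set_apply, h6], fun a ha ha' => ?_, ?_, ?_⟩
        · obtain ⟨n10, n11, n12, n13, n14, n15, n16⟩ : a ≠ 10 ∧ a ≠ 11 ∧ a ≠ 12 ∧ a ≠ 13 ∧
            a ≠ 14 ∧ a ≠ 15 ∧ a ≠ 16 := by omega
          simp [blockSem, Store.set_apply, n10, n11, n12, n13, n14, n15, n16, h1 a ha ha']
        · simp [blockSem, Store.set_apply, h2]
          omega
        · simp only [blockSem, Asg.reg_arr, Asg.reg_idx, Asg.reg_val]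
          simp [Store.set_apply, h2, h7, ← hu, bitOf_eq, hP, delBit_eq, e1, e2, e3]
          refine ⟨?_, ?_, ?_⟩ <;>
          · funext s
            rcases eq_or_ne s u with rfl | h
            · have c1 : 2 * C ≤ s + (t + 1) ∧ s < 2 * C := by omega
              rw [if_pos c1]
              rcases hb' with hb' | hb' <;> simp [Store.set_apply, hb']
            · have c1 : (2 * C ≤ s + (t + 1) ∧ s < 2 * C) ↔ (2 * C ≤ s + t ∧ s < 2 * C) := by omega
              simp only [c1]
              simp [Store.set_apply, h, h3, h4, h5]
      · simp [blockCost]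
    · rintro σ' ω' - ⟨-, h6, -, h2, -⟩
      simp [h2]
    · rintro σ' ω' ⟨h1, h6, h2, h3, h4⟩
      simp only [Nat.sub_self, Nat.zero_le, true_and] at h4
      exact ⟨h1, h6, h2, h4⟩
    · simp
      omega
  · simp [blockCost]

end
end RAM

/-! ## Semantics of the tables -/

namespace RAM

section
variable {ε : Type*} [DecidableEq ε]

/-- The number whose binary digits say which members of the list belong to `S`. -/
def code : List ε → Finset ε → ℕ
  | [], _ => 0
  | e :: es, S => (if e ∈ S then 1 else 0) + 2 * code es S

theorem code_lt (es : List ε) (S : Finset ε) : code es S < 2 ^ es.length := by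
  induction es with
  | nil => simp [code]
  | cons e es ih =>
    rw [code, List.length_cons, pow_succ]
    split_ifs <;> omega

theorem code_congr {es : List ε} {S T : Finset ε} (h : ∀ e ∈ es, e ∈ S ↔ e ∈ T) :
    code es S = code es T := by
  induction es with
  | nil => rfl
  | cons e es ih =>
    rw [code, code, ih fun x hx => h x (List.mem_cons_of_mem _ hx)]
    simp [h e]

theorem code_append (l₁ l₂ : List ε) (S : Finset ε) :
    code (l₁ ++ l₂) S = code l₁ S + 2 ^ l₁.length * code l₂ S := by
  induction l₁ with
  | nil => simp [code]
  | cons e es ih =>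
    rw [List.cons_append, code, code, ih, List.length_cons, pow_succ]
    ring

theorem code_insert_div (l₁ l₂ : List ε) (e : ε) (S : Finset ε) :
    code (l₁ ++ e :: l₂) S / 2 ^ l₁.length = (if e ∈ S then 1 else 0) + 2 * code l₂ S := by
  rw [code_append, code, Nat.add_mul_div_left _ _ (by positivity),
    Nat.div_eq_of_lt (code_lt _ _), zero_add]

theorem bitOf_code (l₁ l₂ : List ε) (e : ε) (S : Finset ε) :
    bitOf (2 ^ l₁.length) (code (l₁ ++ e :: l₂) S) = if e ∈ S then 1 else 0 := by
  rw [bitOf, code_insert_div]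
  split_ifs <;> omega

theorem delBit_code (l₁ l₂ : List ε) (e : ε) (S : Finset ε) :
    delBit (2 ^ l₁.length) (code (l₁ ++ e :: l₂) S) = code (l₁ ++ l₂) S := by
  have h1 : code (l₁ ++ e :: l₂) S / (2 * 2 ^ l₁.length) = code l₂ S := by
    rw [mul_comm, ← Nat.div_div_eq_div_mul, code_insert_div]
    split_ifs <;> omega
  have h2 : code (l₁ ++ e :: l₂) S % 2 ^ l₁.length = code l₁ S := by
    rw [code_append, Nat.add_mul_mod_self_left, Nat.mod_eq_of_lt (code_lt _ _)]
  rw [delBit, h1, h2, code_append]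
  ring

/-- The weights of an edge set `F` with respect to the current vertex: the previous vertices
contribute `W F`, the indeterminate of the current vertex is `x`, and the edges in `A` at the current
vertex have been seen. The index `1` stands for a deleted vertex, the indices `2` and `3` for a vertex
that is kept and has even and odd degree, respectively. -/
def phi (W : Finset ε → ℕ) (x : ℕ) (A : Finset ε) (j : Fin 4) (F : Finset ε) : ℕ :=
  W F * if j = 1 then (if F ∩ A = ∅ then 1 else 0)
    else if j = 2 then (if Even (F ∩ A).card then x else 0)
    else (if Even (F ∩ A).card then 0 else x)

theorem phi_of_notMem {W : Finset ε → ℕ} {x : ℕ} {A F : Finset ε} {e : ε} (h : e ∉ F) (j : Fin 4) :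
    phi W x (insert e A) j F = phi W x A j F := by
  rw [phi, phi, Finset.inter_insert_of_notMem h]

section
variable {W : Finset ε → ℕ} {x : ℕ} {A F : Finset ε} {e : ε} (hF : e ∈ F) (hA : e ∉ A)
include hF

theorem phi_one_of_mem : phi W x (insert e A) 1 F = 0 := by
  simp [phi, Finset.inter_insert_of_mem hF]

include hA

theorem even_inter_insert : Even (F ∩ insert e A).card ↔ ¬ Even (F ∩ A).card := by
  rw [Finset.inter_insert_of_mem hF, Finset.card_insert_of_notMem (by simp [hA]), Nat.even_add_one]

theorem phi_two_of_mem : phi W x (insert e A) 2 F = phi W x A 3 F := by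
  simp [phi, even_inter_insert hF hA, -Nat.not_even_iff_odd]

theorem phi_three_of_mem : phi W x (insert e A) 3 F = phi W x A 2 F := by
  simp [phi, even_inter_insert hF hA, -Nat.not_even_iff_odd]

end

/-- The tables hold, for every subset `S` of the current cut, the sums of the weights of the sets that
consist of `S` and a subset of `Q`. -/
def Rep (es : List ε) (Q : Finset ε) (φ : Fin 4 → Finset ε → ℕ) (σ : Store) : Prop :=
  ∀ S : Finset ε, (∀ e ∈ S, e ∈ es) → ∀ j ≠ 0, σ j (code es S) = ∑ F ∈ Q.powerset, φ j (F ∪ S)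

/-- As `Rep`, between two vertices. -/
def RepSum (es : List ε) (Q : Finset ε) (W : Finset ε → ℕ) (σ : Store) : Prop :=
  ∀ S : Finset ε, (∀ e ∈ S, e ∈ es) →
    σ 1 (code es S) + σ 2 (code es S) = ∑ F ∈ Q.powerset, W (F ∪ S)

theorem fin_four_cases {p : Fin 4 → Prop} (h1 : p 1) (h2 : p 2) (h3 : p 3) : ∀ j ≠ 0, p j := by
  intro j hj
  fin_cases j
  exacts [absurd rfl hj, h1, h2, h3]

section
variable {es l₁ l₂ : List ε} {Q A : Finset ε} {W : Finset ε → ℕ} {x : ℕ} {σ σ' : Store} {e : ε}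

/-- Against the empty set of seen edges every `F` has degree 0, so the odd table vanishes. -/
theorem RepSum.start (h : RepSum es Q W σ) {C : ℕ} (hC : C = 2 ^ es.length)
    (h1 : σ' 1 = fun s => if s < C then σ 1 s + σ 2 s else σ 1 s)
    (h2 : σ' 2 = fun s => if s < C then (σ 1 s + σ 2 s) * x else σ 2 s)
    (h3 : σ' 3 = fun s => if s < C then 0 else σ 3 s) : Rep es Q (phi W x ∅) σ' := by
  intro S hS
  have hlt : code es S < C := hC ▸ code_lt es S
  refine fin_four_cases ?_ ?_ ?_
  · simp [h1, hlt, h S hS, phi]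
  · simp [h2, hlt, h S hS, phi, Finset.sum_mul]
  · simp [h3, hlt, phi]

/-- An odd kept vertex contributes nothing, so its table is ignored and the factor of the finished
vertex moves into the weight. -/
theorem Rep.finish (h : Rep es Q (phi W x A) σ) :
    RepSum es Q (fun F => W F * ((if F ∩ A = ∅ then 1 else 0) + if Even (F ∩ A).card then x else 0))
      σ := by
  intro S hS
  rw [h S hS 1 (by decide), h S hS 2 (by decide), ← Finset.sum_add_distrib]
  refine Finset.sum_congr rfl fun F _ => ?_
  simp [phi, mul_add]

/-- A subset of `insert e Q` either avoids or contains `e`, and the two halves of the sum are the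
entries with lowest bit 0 and 1. The edge is counted at its right endpoint here; at its left
endpoint it was counted when it was introduced. -/
theorem Rep.forget (h : Rep (e :: es) Q (phi W x A) σ) (hQ : e ∉ Q) (hA : e ∉ A) (hes : e ∉ es)
    {C : ℕ} (hC : C = 2 ^ es.length)
    (h1 : σ' 1 = fun s => if s < C then σ 1 (2 * s) else σ 1 s)
    (h2 : σ' 2 = fun s => if s < C then σ 2 (2 * s) + σ 3 (2 * s + 1) else σ 2 s)
    (h3 : σ' 3 = fun s => if s < C then σ 3 (2 * s) + σ 2 (2 * s + 1) else σ 3 s) :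
    Rep es (insert e Q) (phi W x (insert e A)) σ' := by
  intro S hS
  have hlt : code es S < C := hC ▸ code_lt es S
  have heS : e ∉ S := fun h => hes (hS e h)
  have c0 : code (e :: es) S = 2 * code es S := by simp [code, heS]
  have c1 : code (e :: es) (insert e S) = 2 * code es S + 1 := by
    rw [code, if_pos (Finset.mem_insert_self _ _), add_comm, code_congr (S := insert e S) (T := S)]
    intro x hx
    have : x ≠ e := fun h => hes (h ▸ hx)
    simp [this]
  have g0 := h S fun x hx => List.mem_cons_of_mem _ (hS x hx)
  have g1 := h (insert e S) fun x hx => by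
    rcases Finset.mem_insert.1 hx with rfl | hx
    · exact List.mem_cons_self
    · exact List.mem_cons_of_mem _ (hS x hx)
  rw [c0] at g0
  rw [c1] at g1
  have k0 : ∀ j, ∑ F ∈ Q.powerset, phi W x (insert e A) j (F ∪ S) =
      ∑ F ∈ Q.powerset, phi W x A j (F ∪ S) := fun j =>
    Finset.sum_congr rfl fun F hF => phi_of_notMem (by
      simp only [Finset.mem_union, heS, or_false]
      exact fun h => hQ (Finset.mem_powerset.1 hF h)) j
  have k1 : ∀ F, insert e F ∪ S = F ∪ insert e S := fun F => by
    rw [Finset.insert_union, Finset.union_insert]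
  have k2 : ∀ F : Finset ε, e ∈ F ∪ insert e S := fun F => by simp
  refine fin_four_cases ?_ ?_ ?_ <;> rw [Finset.sum_powerset_insert hQ, k0]
  · simp [h1, hlt, g0, k1, phi_one_of_mem (k2 _), -Finset.union_insert]
  · simp [h2, hlt, g0, g1, k1, phi_two_of_mem (k2 _) hA, -Finset.union_insert]
  · simp [h3, hlt, g0, g1, k1, phi_three_of_mem (k2 _) hA, -Finset.union_insert]

/-- An entry whose subset contains `e` is computed from the subset without `e`: by `hW` the finished
vertices do not see `e`, so only the parity at the current vertex changes. -/
theorem Rep.introduce (h : Rep (l₁ ++ l₂) Q (phi W x A) σ) (hQ : e ∉ Q) (hA : e ∉ A)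
    (hW : ∀ F, W (insert e F) = W F) {C P : ℕ} (he : e ∉ l₁ ++ l₂)
    (hC : C = 2 ^ (l₁ ++ l₂).length) (hP : P = 2 ^ l₁.length)
    (h1 : σ' 1 = fun s => if s < 2 * C then if bitOf P s = 0 then σ 1 (delBit P s) else 0 else σ 1 s)
    (h2 : σ' 2 = fun s => if s < 2 * C then if bitOf P s = 0 then σ 2 (delBit P s) else
        σ 3 (delBit P s) else σ 2 s)
    (h3 : σ' 3 = fun s => if s < 2 * C then if bitOf P s = 0 then σ 3 (delBit P s) else
        σ 2 (delBit P s) else σ 3 s) :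
    Rep (l₁ ++ e :: l₂) Q (phi W x (insert e A)) σ' := by
  intro S hS
  have hlt : code (l₁ ++ e :: l₂) S < 2 * C := by
    have := code_lt (l₁ ++ e :: l₂) S
    rw [hC]
    simp only [List.length_append, List.length_cons] at this ⊢
    rwa [← add_assoc, pow_succ, mul_comm] at this
  have hb := bitOf_code l₁ l₂ e S
  have hd := delBit_code l₁ l₂ e S
  rw [← hP] at hb hd
  by_cases heS : e ∈ S
  · obtain ⟨T, heT, rfl⟩ : ∃ T, e ∉ T ∧ insert e T = S :=
      ⟨S.erase e, by simp, Finset.insert_erase heS⟩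
    rw [if_pos heS] at hb
    have hc : code (l₁ ++ l₂) (insert e T) = code (l₁ ++ l₂) T := code_congr fun x hx => by
      have : x ≠ e := fun h => he (h ▸ hx)
      simp [this]
    have g := h T fun x hx => by
      have h1 := hS x (Finset.mem_insert_of_mem hx)
      have h2 : x ≠ e := fun h => heT (h ▸ hx)
      simpa [h2] using h1
    -- Since `e ∉ A`, dropping `e` changes neither `W` nor the degree counted so far.
    have k1 : ∀ j, ∀ F ∈ Q.powerset, phi W x A j (F ∪ insert e T) = phi W x A j (F ∪ T) := by
      intro j F hF
      have : (insert e (F ∪ T)) ∩ A = (F ∪ T) ∩ A := Finset.insert_inter_of_notMem hA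
      rw [Finset.union_insert, phi, phi, hW, this]
    have k2 : ∀ F : Finset ε, e ∈ F ∪ insert e T := fun F => by simp
    refine fin_four_cases ?_ ?_ ?_
    · simp [h1, hlt, hb, phi_one_of_mem (k2 _), -Finset.union_insert]
    · simp only [h2, hlt, hb, if_true, one_ne_zero, if_false, hd, hc, g 3 (by decide),
        phi_two_of_mem (k2 _) hA]
      exact Finset.sum_congr rfl fun F hF => (k1 3 F hF).symm
    · simp only [h3, hlt, hb, if_true, one_ne_zero, if_false, hd, hc, g 2 (by decide),
        phi_three_of_mem (k2 _) hA]
      exact Finset.sum_congr rfl fun F hF => (k1 2 F hF).symm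
  · rw [if_neg heS] at hb
    have g := h S fun x hx => by
      have h2 : x ≠ e := fun h => heS (h ▸ hx)
      simpa [h2] using hS x hx
    have k0 : ∀ j, ∑ F ∈ Q.powerset, phi W x (insert e A) j (F ∪ S) =
        ∑ F ∈ Q.powerset, phi W x A j (F ∪ S) := fun j =>
      Finset.sum_congr rfl fun F hF => phi_of_notMem (by
        simp only [Finset.mem_union, heS, or_false]
        exact fun h => hQ (Finset.mem_powerset.1 hF h)) j
    refine fin_four_cases ?_ ?_ ?_ <;> rw [k0]
    · simp [h1, hlt, hb, hd, g]
    · simp [h2, hlt, hb, hd, g]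
    · simp [h3, hlt, hb, hd, g]

end

end

end RAM

/-! ## Processing one vertex -/

namespace RAM

open Tm

section
variable {ε : Type*} (n : ℕ) (H : ℕ → ℕ → Prop) [DecidableRel H] (e : ℕ → ℕ → ε)

/-- The edges `e a w` with `u ≤ a < i`. -/
def row (u i w : ℕ) : List ε := ((List.range' u (i - u)).filter fun a => H a w).map fun a => e a w

/-- The edges `e u w` with `u < i` and `a ≤ w < b`, ordered by `w` and then by `u`. -/
def cols (i a b : ℕ) : List ε := (List.range' a (b - a)).flatMap fun w => row H e 0 i w

variable {n H e}

theorem mem_row {u i w : ℕ} {x : ε} :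
    x ∈ row H e u i w ↔ ∃ a, u ≤ a ∧ a < i ∧ H a w ∧ x = e a w := by
  simp only [row, List.mem_map, List.mem_filter, List.mem_range'_1, decide_eq_true_eq]
  constructor
  · rintro ⟨a, ⟨⟨h1, h2⟩, h3⟩, rfl⟩
    exact ⟨a, h1, by omega, h3, rfl⟩
  · rintro ⟨a, h1, h2, h3, rfl⟩
    exact ⟨a, ⟨⟨h1, by omega⟩, h3⟩, rfl⟩

theorem mem_cols {i a b : ℕ} {x : ε} :
    x ∈ cols H e i a b ↔ ∃ u w, u < i ∧ a ≤ w ∧ w < b ∧ H u w ∧ x = e u w := by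
  simp only [cols, List.mem_flatMap, List.mem_range'_1, mem_row]
  constructor
  · rintro ⟨w, ⟨h1, h2⟩, u, -, h3, h4, h5⟩
    exact ⟨u, w, h3, h1, by omega, h4, h5⟩
  · rintro ⟨u, w, h1, h2, h3, h4, h5⟩
    exact ⟨w, ⟨h2, by omega⟩, u, Nat.zero_le _, h1, h4, h5⟩

theorem row_self (i w : ℕ) : row H e i i w = [] := by simp [row]

theorem row_eq_append {u i : ℕ} (h : u < i) (w : ℕ) :
    row H e u i w = (if H u w then [e u w] else []) ++ row H e (u + 1) i w := by
  rw [row, row, show i - u = (i - (u + 1)) + 1 by omega, List.range'_succ]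
  split_ifs with h' <;> simp [h']

theorem row_succ (i w : ℕ) :
    row H e 0 (i + 1) w = row H e 0 i w ++ if H i w then [e i w] else [] := by
  rw [row, row, Nat.sub_zero, Nat.sub_zero, List.range'_concat]
  split_ifs with h' <;> simp [h']

theorem cols_self (i a : ℕ) : cols H e i a a = [] := by simp [cols]

/-- Ordering the cut by right endpoints puts the edges ending at the next vertex into the lowest
bits, so that forgetting always treats bit 0. -/
theorem cols_eq_append {a b : ℕ} (h : a < b) (i : ℕ) :
    cols H e i a b = row H e 0 i a ++ cols H e i (a + 1) b := by
  rw [cols, cols, show b - a = (b - (a + 1)) + 1 by omega, List.range'_succ, List.flatMap_cons]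

theorem cols_succ {a b : ℕ} (h : a ≤ b) (i : ℕ) :
    cols H e i a (b + 1) = cols H e i a b ++ row H e 0 i b := by
  rw [cols, cols, show b + 1 - a = (b - a) + 1 by omega, List.range'_concat, List.flatMap_append]
  simp [show a + (b - a) = b by omega]

/-- The edges are pairwise distinct. -/
def Distinct (n : ℕ) (e : ℕ → ℕ → ε) : Prop :=
  ∀ u w u' w', u < w → w < n → u' < w' → w' < n → e u w = e u' w' → u = u' ∧ w = w'

variable [DecidableEq ε] (n H e)

open Classical in
/-- The edges `e u w` with `u < w` whose endpoints satisfy `p`. -/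
noncomputable def edgesWith (p : ℕ → ℕ → Prop) : Finset ε :=
  ((Finset.range n ×ˢ Finset.range n).filter fun q => q.1 < q.2 ∧ H q.1 q.2 ∧ p q.1 q.2).image
    fun q => e q.1 q.2

variable {n H e}

theorem mem_edgesWith {p : ℕ → ℕ → Prop} {x : ε} :
    x ∈ edgesWith n H e p ↔ ∃ u w, u < w ∧ w < n ∧ H u w ∧ p u w ∧ x = e u w := by
  simp only [edgesWith, Finset.mem_image, Finset.mem_filter, Finset.mem_product, Finset.mem_range,
    Prod.exists]
  constructor
  · rintro ⟨u, w, ⟨⟨-, hw⟩, h1, h2, h3⟩, rfl⟩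
    exact ⟨u, w, h1, hw, h2, h3, rfl⟩
  · rintro ⟨u, w, h1, hw, h2, h3, rfl⟩
    exact ⟨u, w, ⟨⟨h1.trans hw, hw⟩, h1, h2, h3⟩, rfl⟩

theorem edgesWith_congr {p q : ℕ → ℕ → Prop}
    (h : ∀ u w, u < w → w < n → H u w → (p u w ↔ q u w)) :
    edgesWith n H e p = edgesWith n H e q := by
  ext x
  simp only [mem_edgesWith]
  constructor
  · rintro ⟨u, w, h1, h2, h3, h4, h5⟩
    exact ⟨u, w, h1, h2, h3, (h u w h1 h2 h3).1 h4, h5⟩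
  · rintro ⟨u, w, h1, h2, h3, h4, h5⟩
    exact ⟨u, w, h1, h2, h3, (h u w h1 h2 h3).2 h4, h5⟩

theorem edgesWith_insert {p q : ℕ → ℕ → Prop} {a b : ℕ} (hab : a < b) (hb : b < n) (hH : H a b)
    (h : ∀ u w, u < w → w < n → (q u w ↔ p u w ∨ u = a ∧ w = b)) :
    insert (e a b) (edgesWith n H e p) = edgesWith n H e q := by
  ext x
  simp only [mem_edgesWith, Finset.mem_insert]
  constructor
  · rintro (rfl | ⟨u, w, h1, h2, h3, h4, h5⟩)
    · exact ⟨a, b, hab, hb, hH, (h a b hab hb).2 (Or.inr ⟨rfl, rfl⟩), rfl⟩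
    · exact ⟨u, w, h1, h2, h3, (h u w h1 h2).2 (Or.inl h4), h5⟩
  · rintro ⟨u, w, h1, h2, h3, h4, rfl⟩
    rcases (h u w h1 h2).1 h4 with h5 | ⟨rfl, rfl⟩
    · exact Or.inr ⟨u, w, h1, h2, h3, h5, rfl⟩
    · exact Or.inl rfl

theorem Distinct.mem_edgesWith (he : Distinct n e) {p : ℕ → ℕ → Prop} {u w : ℕ} (h : u < w)
    (hw : w < n) : e u w ∈ edgesWith n H e p ↔ H u w ∧ p u w := by
  rw [RAM.mem_edgesWith]
  constructor
  · rintro ⟨u', w', h1, h2, h3, h4, h5⟩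
    obtain ⟨rfl, rfl⟩ := he _ _ _ _ h hw h1 h2 h5
    exact ⟨h3, h4⟩
  · exact fun ⟨h1, h2⟩ => ⟨u, w, h, hw, h1, h2, rfl⟩

/-- The input describes the graph `H`. -/
structure Input (n : ℕ) (inp : ℕ → ℕ) (H : ℕ → ℕ → Prop) [DecidableRel H] : Prop where
  pos_lt : ∀ u < n, inp (3 + u) < n
  adj : ∀ u < n, ∀ w < n, inp (3 + n + inp (3 + u) * n + inp (3 + w)) = if H u w then 1 else 0

/-- The adjacency of the vertices whose positions are stored in two registers. -/
def adjTm (k l : ℕ) : Tm :=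
  inp (lit 3 + inp (lit 0) + inp (lit 3 + var k) * inp (lit 0) + inp (lit 3 + var l))

variable {inp : ℕ → ℕ} {B : ℕ} {σ : Store} {ω : Coins}

/-- `H` relates positions while the matrix is indexed by vertices, hence the lookups in the
arrangement. The index stays below `3 + n + n * n`, which lies inside the input area. -/
theorem adjTm_spec (hF : Frame n B inp) (hI : Input n inp H) {k l : ℕ} (hk : k < 64) (hl : l < 64)
    (hk' : σ 0 k < n) (hl' : σ 0 l < n) :
    (adjTm k l).Ok n B inp σ ∧
      (adjTm k l).eval inp σ = if H (σ 0 k) (σ 0 l) then 1 else 0 := by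
  have h1 := hF.room
  have h2 := hI.pos_lt _ hk'
  have h3 := hI.pos_lt _ hl'
  have h4 : inp (3 + σ 0 k) * n + n ≤ n * n := by nlinarith
  have h5 : n * n + 4 * n + 4 = (n + 2) ^ 2 := by ring
  refine ⟨?_, by simp [adjTm, hF.inp_zero, hI.adj _ hk' _ hl']⟩
  simp [adjTm, hF.inp_zero, hk, hl]
  omega

/-- Forget the edges from the left to the vertex at the position stored in register `3`. -/
def forgetLoop : Program :=
  .seq (block [.reg 9 (lit 0)])
    (.loop (var 3 - var 9).compile
      (.seq (.ite (adjTm 9 3).compile forgetPass .skip) (block [.reg 9 (var 9 + lit 1)])))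

variable {W : Finset ε → ℕ} {x b c i : ℕ}

/-- The column of edges into `i` is consumed from its lowest bit. Each forgotten edge adds two
entries, which at most doubles the bound and yields the factor `2 ^ i`. -/
theorem forgetLoop_tri (he : Distinct n e) (hI : Input n inp H) (hi : i < n) (h3 : σ 0 3 = i)
    (hC : σ 0 6 = 2 ^ (cols H e i i n).length) (hc : (cols H e i i n).length ≤ c)
    (hB : (n + 2) ^ 2 + 256 + 4 * (2 * 2 ^ c) ≤ B) (hb : ∀ j ≠ 0, ∀ s, σ j s ≤ b)
    (hbB : b * 2 ^ i ≤ B)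
    (hR : Rep (cols H e i i n) (edgesWith n H e fun _ w => w < i) (phi W x ∅) σ) :
    Tri n B inp forgetLoop σ ω (fun σ' ω' => ω' = ω ∧ (∀ a < 9, a ≠ 6 → σ' 0 a = σ 0 a) ∧
      σ' 0 6 = 2 ^ (cols H e i (i + 1) n).length ∧ (∀ j ≠ 0, ∀ s, σ' j s ≤ b * 2 ^ i) ∧
      Rep (cols H e i (i + 1) n) (edgesWith n H e fun _ w => w < i + 1)
        (phi W x (edgesWith n H e fun _ w => w = i)) σ') (4000 * (n * 2 ^ c)) := by
  have h2c : 1 ≤ 2 ^ c := Nat.one_le_two_pow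
  have hn2 : 2 ^ c ≤ n * 2 ^ c := Nat.le_mul_of_pos_left _ (by omega)
  refine Tri.of_frame fun hF _ => Tri.seq (T₁ := 50) (T₂ := i * (3000 * 2 ^ c) + 100)
    (Tri.block ?_ ?_ ?_) ?_
  · simp [blockOk]
    omega
  · refine Tri.loop (T' := 2900 * 2 ^ c) (fun u σ' ω' => ω' = ω ∧
      (∀ a < 9, a ≠ 6 → σ' 0 a = σ 0 a) ∧ σ' 0 9 = u ∧
      σ' 0 6 = 2 ^ (row H e u i i ++ cols H e i (i + 1) n).length ∧
      (row H e u i i ++ cols H e i (i + 1) n).length ≤ c ∧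
      (∀ j ≠ 0, ∀ s, σ' j s ≤ b * 2 ^ u) ∧
      Rep (row H e u i i ++ cols H e i (i + 1) n)
        (edgesWith n H e fun v w => w < i ∨ w = i ∧ v < u)
        (phi W x (edgesWith n H e fun v w => w = i ∧ v < u)) σ') i ?_ ?_ ?_ ?_ ?_ ?_
    · rw [← cols_eq_append hi]
      refine ⟨rfl, fun a ha ha' => ?_, ?_, ?_, hc, fun j hj s => ?_, ?_⟩
      · have n9 : a ≠ 9 := by omega
        simp [blockSem, Store.set_apply, n9]
      · simp [blockSem, Store.set_apply]
      · simp [blockSem, Store.set_apply, hC]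
      · simp [blockSem, Store.set_apply, hj, hb j hj s]
      · intro S hS j hj
        have := hR S hS j hj
        simp only [not_lt_zero, and_false, or_false]
        rw [show edgesWith n H e (fun _ _ => False) = ∅ by
          ext; simp [RAM.mem_edgesWith], ← this]
        simp [blockSem, Store.set_apply, hj]
    · rintro u σ' ω' - hu -
      simp
    · rintro u σ' ω' hσ' hu ⟨rfl, g1, g2, g3, g4, g5, g6⟩
      have g7 : σ' 0 3 = i := by rw [g1 3 (by omega) (by omega), h3]
      obtain ⟨ho, hev⟩ := adjTm_spec (σ := σ') (H := H) hF hI (k := 9) (l := 3) (by omega)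
        (by omega) (by omega) (by omega)
      rw [g2, g7] at hev
      have hpow : b * 2 ^ (u + 1) ≤ B :=
        (Nat.mul_le_mul_left _ (Nat.pow_le_pow_right (by omega) hu)).trans hbB
      have hmono : b * 2 ^ u ≤ b * 2 ^ (u + 1) :=
        Nat.mul_le_mul_left _ (Nat.pow_le_pow_right (by omega) (by omega))
      have hb2 : 2 * (b * 2 ^ u) = b * 2 ^ (u + 1) := by ring
      refine ⟨by simp [g7, g2]; omega, ?_⟩
      refine Tri.seq (T₁ := 2800 * 2 ^ c) (T₂ := 100) ?_ (by omega)
      refine Tri.mono (Q := fun σ' ω'' => ω'' = ω' ∧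
        (∀ a < 9, a ≠ 6 → σ' 0 a = σ 0 a) ∧ σ' 0 9 = u ∧
        σ' 0 6 = 2 ^ (row H e (u + 1) i i ++ cols H e i (i + 1) n).length ∧
        (row H e (u + 1) i i ++ cols H e i (i + 1) n).length ≤ c ∧
        (∀ j ≠ 0, ∀ s, σ' j s ≤ b * 2 ^ (u + 1)) ∧
        Rep (row H e (u + 1) i i ++ cols H e i (i + 1) n)
          (edgesWith n H e fun v w => w < i ∨ w = i ∧ v < u + 1)
          (phi W x (edgesWith n H e fun v w => w = i ∧ v < u + 1)) σ') (T := 2800 * 2 ^ c)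
          ?_ ?_ le_rfl
      · refine Tri.ite (T' := 2000 * 2 ^ c) ho (fun h => ?_) (fun h => ?_) ?_
        · have hH : H u i := by
            by_contra hH
            simp [hev, hH] at h
          rw [row_eq_append hu, if_pos hH, List.singleton_append, List.cons_append] at g3 g4 g6
          set L := row H e (u + 1) i i ++ cols H e i (i + 1) n with hL
          rw [List.length_cons] at g3 g4
          rw [pow_succ'] at g3
          have hpc : 2 * 2 ^ L.length ≤ 2 ^ c := by
            rw [← pow_succ']
            exact Nat.pow_le_pow_right (by omega) g4
          refine (forgetPass_tri (b := b * 2 ^ u) (fun s => ⟨g5 2 (by decide) s,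
            g5 3 (by decide) s⟩) (by omega) g3 (by omega)).mono ?_ (by omega)
          rintro σ'' ω'' ⟨rfl, k1, k2, k3, k4, k5⟩
          refine ⟨rfl, fun a ha ha' => ?_, ?_, k1, by omega, ?_, ?_⟩
          · rw [k2 a (by omega) ha', g1 a ha ha']
          · rw [k2 9 (by omega) (by omega), g2]
          · have q2 := g5 2 (by decide)
            have q3 := g5 3 (by decide)
            have q1 := g5 1 (by decide)
            refine fin_four_cases ?_ ?_ ?_ <;> intro s
            · rw [k3]
              dsimp only
              split_ifs
              exacts [(q1 _).trans hmono, (q1 _).trans hmono]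
            · rw [k4]
              dsimp only
              have z1 := q2 (2 * s)
              have z2 := q3 (2 * s + 1)
              split_ifs
              exacts [by omega, (q2 _).trans hmono]
            · rw [k5]
              dsimp only
              have z1 := q3 (2 * s)
              have z2 := q2 (2 * s + 1)
              split_ifs
              exacts [by omega, (q3 _).trans hmono]
          · have := g6.forget (σ' := σ'') (by rw [he.mem_edgesWith hu hi]; omega)
              (by rw [he.mem_edgesWith hu hi]; omega) (fun hm => by
                rw [hL, List.mem_append, mem_row, mem_cols] at hm
                rcases hm with ⟨a, h1, h2, -, h4⟩ | ⟨a, w, h1, h2, h3, -, h4⟩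
                · have := he _ _ _ _ hu hi h2 hi h4
                  omega
                · have := he _ _ _ _ hu hi (by omega) h3 h4
                  omega) rfl k3 k4 k5
            rwa [edgesWith_insert (q := fun v w => w < i ∨ w = i ∧ v < u + 1) hu hi hH
              (fun v w _ _ => by omega), edgesWith_insert (q := fun v w => w = i ∧ v < u + 1)
              hu hi hH (fun v w _ _ => by omega)] at this
        · have hH : ¬ H u i := by
            intro hH
            simp [hev, hH] at h
          rw [row_eq_append hu, if_neg hH, List.nil_append] at g3 g4 g6
          -- The predicates before and after this round differ only at the pair `(u, i)`; as it is
          -- not an edge, they define the same edge sets.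
          have hne : ∀ v w, H v w → w = i → v ≠ u := fun v w h1 h2 h3 => hH (h3 ▸ h2 ▸ h1)
          rw [edgesWith_congr (p := fun v w => w < i ∨ w = i ∧ v < u)
            (q := fun v w => w < i ∨ w = i ∧ v < u + 1) (fun v w _ _ h => by
              have := hne v w h
              omega), edgesWith_congr (p := fun v w => w = i ∧ v < u)
            (q := fun v w => w = i ∧ v < u + 1) (fun v w _ _ h => by
              have := hne v w h
              omega)] at g6
          exact Tri.skip ⟨rfl, g1, g2, g3, g4, fun j hj s => (g5 j hj s).trans hmono, g6⟩ (by omega)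
        · simp [adjTm]
          omega
      · rintro σ'' ω'' ⟨rfl, k1, k2, k3, k4, k5, k6⟩
        have hnB : n ≤ B := hF.inp_zero ▸ hF.inp_le 0
        refine Tri.block ?_ ?_ ?_
        · simp [blockOk, k2]
          omega
        · refine ⟨rfl, fun a ha ha' => ?_, ?_, ?_, k4, fun j hj s => ?_, fun S hS j hj => ?_⟩
          · have n9 : a ≠ 9 := by omega
            simp [blockSem, Store.set_apply, n9, k1 a ha ha']
          · simp [blockSem, Store.set_apply, k2]
          · simp [blockSem, Store.set_apply, k3]
          · simp [blockSem, Store.set_apply, hj, k5 j hj s]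
          · rw [← k6 S hS j hj]
            simp [blockSem, Store.set_apply, hj]
        · simp [blockCost]
    · rintro σ' ω' - ⟨-, g1, g2, -⟩
      simp [g2, g1 3, h3]
    · rintro σ' ω' ⟨g0, g1, g2, g3, g4, g5, g6⟩
      rw [row_self, List.nil_append] at g3 g6
      rw [edgesWith_congr (p := fun v w => w < i ∨ w = i ∧ v < i) (q := fun v w => w < i + 1)
        (fun v w h _ _ => by omega), edgesWith_congr (p := fun v w => w = i ∧ v < i)
        (q := fun v w => w = i) (fun v w h _ _ => by omega)] at g6
      exact ⟨g0, g1, g3, g5, g6⟩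
    · simp
      nlinarith
  · simp [blockCost]
  · nlinarith

end
end RAM

/-! ### Introducing the edges to the right. -/

namespace RAM

open Tm

/-- Double register `7` for every edge between the position in register `8` and a position before
the one in register `3`. -/
def countLoop : Program :=
  .seq (block [.reg 9 (lit 0)])
    (.loop (var 3 - var 9).compile
      (.seq (.ite (adjTm 9 8).compile (block [.reg 7 (var 7 * lit 2)]) .skip)
        (block [.reg 9 (var 9 + lit 1)])))

/-- Introduce the edges from the vertex at the position stored in register `3` to the right. -/
def introduceLoop : Program :=
  .seq (block [.reg 7 (lit 1), .reg 8 (var 3 + lit 1)])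
    (.loop (inp (lit 0) - var 8).compile
      (.seq countLoop
        (.seq (.ite (adjTm 3 8).compile (.seq insertPass (block [.reg 7 (var 7 * lit 2)])) .skip)
          (block [.reg 8 (var 8 + lit 1)]))))

section
variable {ε : Type*} {n : ℕ} {H : ℕ → ℕ → Prop} [DecidableRel H] {e : ℕ → ℕ → ε}
  {inp : ℕ → ℕ} {B : ℕ} {σ : Store} {ω : Coins} {i : ℕ}

theorem length_row_mono {u i : ℕ} (h : u ≤ i) (w : ℕ) :
    (row H e 0 u w).length ≤ (row H e 0 i w).length := by
  induction i, h using Nat.le_induction with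
  | base => exact le_rfl
  | succ k hk ih =>
    refine ih.trans ?_
    rw [row_succ]
    simp

/-- The new edge `e i w` belongs behind the edges `e u w` with `u < i` already in the cut; the bit
value in register `7` is moved past them. -/
theorem countLoop_tri (hI : Input n inp H) {w P : ℕ} (hi : i < n) (hw : w < n) (h3 : σ 0 3 = i)
    (h8 : σ 0 8 = w) (h7 : σ 0 7 = P) (hP : P * 2 ^ (row H e 0 i w).length ≤ B) :
    Tri n B inp countLoop σ ω (fun σ' ω' => ω' = ω ∧ (∀ a < 9, a ≠ 7 → σ' 0 a = σ 0 a) ∧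
      σ' 0 7 = P * 2 ^ (row H e 0 i w).length ∧ ∀ j ≠ 0, σ' j = σ j) (600 * n) := by
  refine Tri.of_frame fun hF _ => Tri.seq (T₁ := 50) (T₂ := 500 * n + 50)
    (Tri.block ?_ ?_ ?_) (by omega)
  · have := hF.room
    simp [blockOk]
    omega
  · refine Tri.loop (T' := 450) (fun u σ' ω' => ω' = ω ∧ (∀ a < 9, a ≠ 7 → σ' 0 a = σ 0 a) ∧
      σ' 0 9 = u ∧ σ' 0 7 = P * 2 ^ (row H e 0 u w).length ∧ ∀ j ≠ 0, σ' j = σ j) i ?_ ?_ ?_ ?_ ?_ ?_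
    · refine ⟨rfl, fun a ha ha' => ?_, ?_, ?_, fun j hj => ?_⟩
      · have n9 : a ≠ 9 := by omega
        simp [blockSem, Store.set_apply, n9]
      · simp [blockSem, Store.set_apply]
      · simp [blockSem, Store.set_apply, h7, row_self]
      · funext s
        simp [blockSem, Store.set_apply, hj]
    · rintro u σ' ω' - hu -
      simp
    · rintro u σ' ω' hσ' hu ⟨rfl, g1, g2, g3, g4⟩
      have g7 : σ' 0 3 = i := by rw [g1 3 (by omega) (by omega), h3]
      have g8 : σ' 0 8 = w := by rw [g1 8 (by omega) (by omega), h8]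
      obtain ⟨ho, hev⟩ := adjTm_spec (σ := σ') (H := H) hF hI (k := 9) (l := 8) (by omega)
        (by omega) (by omega) (by omega)
      rw [g2, g8] at hev
      have hr := hF.room
      have hnB : n ≤ B := hF.inp_zero ▸ hF.inp_le 0
      refine ⟨by simp [g7, g2]; omega, ?_⟩
      refine Tri.seq (T₁ := 350) (T₂ := 100) ?_ (by omega)
      refine Tri.mono (Q := fun σ' ω'' => ω'' = ω' ∧ (∀ a < 9, a ≠ 7 → σ' 0 a = σ 0 a) ∧
        σ' 0 9 = u ∧ σ' 0 7 = P * 2 ^ (row H e 0 (u + 1) w).length ∧ ∀ j ≠ 0, σ' j = σ j)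
        (T := 350) ?_ ?_ le_rfl
      · refine Tri.ite (T' := 100) ho (fun h => ?_) (fun h => ?_) (by simp [adjTm])
        · have hH : H u w := by
            by_contra hH
            simp [hev, hH] at h
          have hl := length_row_mono (H := H) (e := e) (show u + 1 ≤ i from hu) w
          have hlen : (row H e 0 (u + 1) w).length = (row H e 0 u w).length + 1 := by
            rw [row_succ, if_pos hH]
            simp
          have hbd : P * 2 ^ (row H e 0 (u + 1) w).length ≤ B :=
            le_trans (Nat.mul_le_mul_left _ (Nat.pow_le_pow_right (by omega) hl)) hP
          rw [hlen, pow_succ, ← mul_assoc] at hbd ⊢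
          refine Tri.block ?_ ?_ ?_
          · simp [blockOk, g3]
            omega
          · refine ⟨rfl, fun a ha ha' => ?_, ?_, ?_, fun j hj => ?_⟩
            · simp [blockSem, Store.set_apply, ha', g1 a ha]
            · simp [blockSem, Store.set_apply, g2]
            · simp [blockSem, Store.set_apply, g3]
            · funext s
              simp [blockSem, Store.set_apply, hj, g4 j hj]
          · simp [blockCost]
        · have hH : ¬ H u w := by
            intro hH
            simp [hev, hH] at h
          refine Tri.skip ⟨rfl, g1, g2, ?_, g4⟩ (by omega)
          rw [g3, row_succ, if_neg hH, List.append_nil]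
      · rintro σ'' ω'' ⟨rfl, k1, k2, k3, k4⟩
        refine Tri.block ?_ ?_ ?_
        · simp [blockOk, k2]
          omega
        · refine ⟨rfl, fun a ha ha' => ?_, ?_, ?_, fun j hj => ?_⟩
          · have n9 : a ≠ 9 := by omega
            simp [blockSem, Store.set_apply, n9, k1 a ha ha']
          · simp [blockSem, Store.set_apply, k2]
          · simp [blockSem, Store.set_apply, k3]
          · funext s
            simp [blockSem, Store.set_apply, hj, k4 j hj]
        · simp [blockCost]
    · rintro σ' ω' - ⟨-, g1, g2, -⟩
      simp [g2, g1 3, h3]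
    · rintro σ' ω' ⟨g0, g1, g2, g3, g4⟩
      exact ⟨g0, g1, g3, g4⟩
    · simp
      omega
  · simp [blockCost]

end

section
variable {ε : Type*} [DecidableEq ε] {n : ℕ} {H : ℕ → ℕ → Prop} [DecidableRel H] {e : ℕ → ℕ → ε}
  {inp : ℕ → ℕ} {B : ℕ} {σ : Store} {ω : Coins} {W : Finset ε → ℕ} {x b c i : ℕ}

theorem Rep.of_eq {es : List ε} {Q : Finset ε} {φ : Fin 4 → Finset ε → ℕ} {σ' : Store}
    (h : Rep es Q φ σ) (hσ : ∀ j ≠ 0, σ' j = σ j) : Rep es Q φ σ' := fun S hS j hj => by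
  rw [hσ j hj]
  exact h S hS j hj

/-- When `w` is reached, the columns before `w` already contain their edges from `i`, while those
from `w` on do not. Register `7` holds 2 to the length of the first group, so it supplies the
insertion point. -/
theorem introduceLoop_tri (he : Distinct n e) (hI : Input n inp H) (hi : i < n) (h3 : σ 0 3 = i)
    (hW : ∀ w, i < w → w < n → ∀ F, W (insert (e i w) F) = W F)
    (hC : σ 0 6 = 2 ^ (cols H e i (i + 1) n).length)
    (hc : (cols H e (i + 1) (i + 1) n).length ≤ c)
    (hB : (n + 2) ^ 2 + 256 + 4 * (2 * 2 ^ c) ≤ B) (hb : ∀ j ≠ 0, ∀ s, σ j s ≤ b)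
    (hR : Rep (cols H e i (i + 1) n) (edgesWith n H e fun _ w => w < i + 1)
        (phi W x (edgesWith n H e fun _ w => w = i)) σ) :
    Tri n B inp introduceLoop σ ω (fun σ' ω' => ω' = ω ∧ (∀ a < 6, σ' 0 a = σ 0 a) ∧
      σ' 0 6 = 2 ^ (cols H e (i + 1) (i + 1) n).length ∧ (∀ j ≠ 0, ∀ s, σ' j s ≤ b) ∧
      Rep (cols H e (i + 1) (i + 1) n) (edgesWith n H e fun _ w => w < i + 1)
        (phi W x (edgesWith n H e fun v w => v = i ∨ w = i)) σ') (6000 * (n * n * 2 ^ c)) := by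
  have h2c : 1 ≤ 2 ^ c := Nat.one_le_two_pow
  have hn2 : n ≤ n * 2 ^ c := Nat.le_mul_of_pos_right _ (by omega)
  have hn3 : 2 ^ c ≤ n * 2 ^ c := Nat.le_mul_of_pos_left _ (by omega)
  -- The list only grows as `w` increases, so the cut reached at `w = n` bounds all intermediate
  -- lengths.
  have hlen : ∀ w, i + 1 ≤ w → w ≤ n →
      (cols H e (i + 1) (i + 1) w ++ cols H e i w n).length ≤ c := by
    intro w hw hwn
    refine le_trans ?_ hc
    obtain ⟨d, hd⟩ := Nat.exists_eq_add_of_le hwn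
    clear hwn
    induction d generalizing w with
    | zero =>
      obtain rfl : n = w := hd
      simp [cols_self]
    | succ d ih =>
      refine le_trans ?_ (ih (w + 1) (by omega) (by omega))
      rw [cols_succ (by omega), cols_eq_append (by omega : w < n), row_succ]
      simp
  refine Tri.of_frame fun hF _ => Tri.seq (T₁ := 100) (T₂ := n * (5500 * (n * 2 ^ c)) + 100)
    (Tri.block ?_ ?_ ?_) ?_
  · have hnB : n ≤ B := hF.inp_zero ▸ hF.inp_le 0
    simp [blockOk, Store.set_apply, h3]
    omega
  · refine Tri.loop (T' := 5400 * (n * 2 ^ c)) (fun t σ' ω' => ω' = ω ∧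
      (∀ a < 6, σ' 0 a = σ 0 a) ∧ σ' 0 8 = i + 1 + t ∧
      σ' 0 7 = 2 ^ (cols H e (i + 1) (i + 1) (i + 1 + t)).length ∧
      σ' 0 6 = 2 ^ (cols H e (i + 1) (i + 1) (i + 1 + t) ++ cols H e i (i + 1 + t) n).length ∧
      (∀ j ≠ 0, ∀ s, σ' j s ≤ b) ∧
      Rep (cols H e (i + 1) (i + 1) (i + 1 + t) ++ cols H e i (i + 1 + t) n)
        (edgesWith n H e fun _ w => w < i + 1)
        (phi W x (edgesWith n H e fun v w => v = i ∧ w < i + 1 + t ∨ w = i)) σ')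
      (n - (i + 1)) ?_ ?_ ?_ ?_ ?_ ?_
    · refine ⟨rfl, fun a ha => ?_, ?_, ?_, ?_, fun j hj s => ?_, ?_⟩
      · obtain ⟨n7, n8⟩ : a ≠ 7 ∧ a ≠ 8 := by omega
        simp [blockSem, Store.set_apply, n7, n8]
      · simp [blockSem, Store.set_apply, h3]
      · simp [blockSem, Store.set_apply, cols_self]
      · simp [blockSem, Store.set_apply, cols_self, hC]
      · simp [blockSem, Store.set_apply, hj, hb j hj s]
      · rw [Nat.add_zero, cols_self, List.nil_append,
          edgesWith_congr (p := fun v w => v = i ∧ w < i + 1 ∨ w = i) (q := fun _ w => w = i)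
            (fun v w _ _ _ => by omega)]
        intro S hS j hj
        rw [← hR S hS j hj]
        simp [blockSem, Store.set_apply, hj]
    · rintro t σ' ω' - ht -
      simp
    · rintro t σ' ω' hσ' ht ⟨rfl, g1, g2, g3, g4, g5, g6⟩
      obtain ⟨w, hw⟩ : ∃ w, w = i + 1 + t := ⟨_, rfl⟩
      have hiw : i < w := by omega
      have hwn : w < n := by omega
      rw [← hw] at g2 g3 g4 g6
      rw [← add_assoc, ← hw]
      have g7 : σ' 0 3 = i := by rw [g1 3 (by omega), h3]
      have hnB : n ≤ B := hF.inp_zero ▸ hF.inp_le 0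
      have hl := hlen w (by omega) hwn.le
      have hl' := hlen (w + 1) (by omega) hwn
      rw [cols_eq_append hwn, ← List.append_assoc] at hl g4 g6
      refine ⟨by simp [hF.inp_zero, g2]; omega, ?_⟩
      refine Tri.seq (T₁ := 600 * (n * 2 ^ c)) (T₂ := 4800 * (n * 2 ^ c)) ?_ (by omega)
      refine (countLoop_tri hI hi hwn g7 g2 g3 (e := e) ?_).mono ?_ (by omega)
      · rw [← pow_add, ← List.length_append]
        have : 2 ^ (cols H e (i + 1) (i + 1) w ++ row H e 0 i w).length ≤ 2 ^ c :=
          Nat.pow_le_pow_right (by omega) (le_trans (by simp) hl)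
        omega
      rintro σ₁ ω₁ ⟨rfl, k1, k2, k3⟩
      rw [← pow_add, ← List.length_append] at k2
      have k4 : σ₁ 0 3 = i := by rw [k1 3 (by omega) (by omega), g7]
      have k5 : σ₁ 0 8 = w := by rw [k1 8 (by omega) (by omega), g2]
      have k6 := k1 6 (by omega) (by omega)
      rw [g4] at k6
      have k7 := g6.of_eq k3
      have k8 : ∀ j ≠ 0, ∀ s, σ₁ j s ≤ b := fun j hj s => by rw [k3 j hj]; exact g5 j hj s
      obtain ⟨ho, hev⟩ := adjTm_spec (σ := σ₁) (H := H) hF hI (k := 3) (l := 8) (by omega)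
        (by omega) (by omega) (by omega)
      rw [k4, k5] at hev
      have hcs : cols H e (i + 1) (i + 1) (w + 1) = (cols H e (i + 1) (i + 1) w ++ row H e 0 i w) ++
          if H i w then [e i w] else [] := by
        rw [cols_succ (by omega), row_succ, List.append_assoc]
      set l₁ := cols H e (i + 1) (i + 1) w ++ row H e 0 i w with hl₁
      set l₂ := cols H e i (w + 1) n with hl₂
      refine Tri.seq (T₁ := 4700 * (n * 2 ^ c)) (T₂ := 100) ?_ (by omega)
      refine Tri.mono (Q := fun σ' ω'' => ω'' = ω₁ ∧ (∀ a < 6, σ' 0 a = σ 0 a) ∧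
        σ' 0 8 = w ∧ σ' 0 7 = 2 ^ (cols H e (i + 1) (i + 1) (w + 1)).length ∧
        σ' 0 6 = 2 ^ (cols H e (i + 1) (i + 1) (w + 1) ++ l₂).length ∧
        (∀ j ≠ 0, ∀ s, σ' j s ≤ b) ∧
        Rep (cols H e (i + 1) (i + 1) (w + 1) ++ l₂) (edgesWith n H e fun _ w => w < i + 1)
          (phi W x (edgesWith n H e fun v w' => v = i ∧ w' < w + 1 ∨ w' = i)) σ')
        (T := 4700 * (n * 2 ^ c)) ?_ ?_ le_rfl
      · refine Tri.ite (T' := 4300 * (n * 2 ^ c)) ho (fun h => ?_) (fun h => ?_) ?_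
        · have hH : H i w := by
            by_contra hH
            simp [hev, hH] at h
          rw [if_pos hH] at hcs
          have happ : (l₁ ++ [e i w]) ++ l₂ = l₁ ++ e i w :: l₂ := by simp
          rw [hcs, happ] at hl' ⊢
          have hle : 2 * 2 ^ (l₁ ++ l₂).length ≤ 2 ^ c := by
            rw [← pow_succ']
            refine Nat.pow_le_pow_right (by omega) (le_trans ?_ hl')
            simp
          have hP : 2 ^ l₁.length ≤ 2 ^ (l₁ ++ l₂).length :=
            Nat.pow_le_pow_right (by omega) (by simp)
          refine Tri.of_frame fun _ hσ₁ => Tri.seq (T₁ := 4000 * 2 ^ c) (T₂ := 100) ?_ (by omega)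
          refine (insertPass_tri k6 k2 hP hσ₁ (by omega)).mono ?_ (by omega)
          rintro σ₂ ω₂ ⟨rfl, m1, m2, m3, m4, m5⟩
          have m7 : σ₂ 0 7 = 2 ^ l₁.length := by rw [m2 7 (by omega) (by omega), k2]
          refine Tri.block ?_ ?_ ?_
          · simp [blockOk, m7]
            omega
          · refine ⟨rfl, fun a ha => ?_, ?_, ?_, ?_, ?_, ?_⟩
            · obtain ⟨n6, n7⟩ : a ≠ 6 ∧ a ≠ 7 := by omega
              simp [blockSem, Store.set_apply, n7, m2 a (by omega) n6, k1 a (by omega) n7, g1 a ha]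
            · simp [blockSem, Store.set_apply, m2 8, k5]
            · simp [blockSem, Store.set_apply, m7, pow_succ]
            · simp [blockSem, Store.set_apply, m1]
              ring
            · have q1 := k8 1 (by decide)
              have q2 := k8 2 (by decide)
              have q3 := k8 3 (by decide)
              refine fin_four_cases ?_ ?_ ?_ <;> intro s
              · simp [blockSem, Store.set_apply, m3]
                split_ifs
                exacts [q1 _, Nat.zero_le _, q1 _]
              · simp [blockSem, Store.set_apply, m4]
                split_ifs
                exacts [q2 _, q3 _, q2 _]
              · simp [blockSem, Store.set_apply, m5]
                split_ifs
                exacts [q3 _, q2 _, q3 _]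
            · have hnot : e i w ∉ l₁ ++ l₂ := fun hm => by
                rw [hl₁, hl₂, List.mem_append, List.mem_append, mem_row, mem_cols, mem_cols] at hm
                rcases hm with (⟨u', w', h1, h2, h3, -, h4⟩ | ⟨u', -, h2, -, h4⟩) |
                  ⟨u', w', h1, h2, h3, -, h4⟩
                · have := he _ _ _ _ hiw hwn (by omega) (by omega) h4
                  omega
                · have := he _ _ _ _ hiw hwn (by omega) (by omega) h4
                  omega
                · have := he _ _ _ _ hiw hwn (by omega) (by omega) h4
                  omega
              have := k7.introduce (σ' := σ₂) (by rw [he.mem_edgesWith hiw hwn]; omega)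
                (by rw [he.mem_edgesWith hiw hwn]; omega) (hW w hiw hwn) hnot rfl rfl m3 m4 m5
              rw [edgesWith_insert (q := fun v w' => v = i ∧ w' < w + 1 ∨ w' = i) hiw hwn hH
                (fun v w _ _ => by omega)] at this
              intro S hS j hj
              rw [← this S hS j hj]
              simp [blockSem, Store.set_apply, hj]
          · simp [blockCost]
        · have hH : ¬ H i w := by
            intro hH
            simp [hev, hH] at h
          rw [if_neg hH, List.append_nil] at hcs
          rw [hcs]
          rw [edgesWith_congr (p := fun v w' => v = i ∧ w' < w ∨ w' = i)
            (q := fun v w' => v = i ∧ w' < w + 1 ∨ w' = i) (fun v w' _ _ h => by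
              have : v = i → w' ≠ w := fun h1 h2 => hH (h1 ▸ h2 ▸ h)
              omega)] at k7
          refine Tri.skip ⟨rfl, fun a ha => ?_, k5, k2, k6, k8, k7⟩ (by omega)
          rw [k1 a (by omega) (by omega), g1 a ha]
        · simp [adjTm]
          omega
      · rintro σ₂ ω₂ ⟨rfl, m1, m2, m3, m4, m5, m6⟩
        refine Tri.block ?_ ?_ ?_
        · simp [blockOk, m2]
          omega
        · refine ⟨rfl, fun a ha => ?_, ?_, ?_, ?_, fun j hj s => ?_, fun S hS j hj => ?_⟩
          · have n8 : a ≠ 8 := by omega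
            simp [blockSem, Store.set_apply, n8, m1 a ha]
          · simp [blockSem, Store.set_apply, m2]
          · simp [blockSem, Store.set_apply, m3]
          · simp [blockSem, Store.set_apply, m4]
          · simp [blockSem, Store.set_apply, hj, m5 j hj s]
          · rw [← m6 S hS j hj]
            simp [blockSem, Store.set_apply, hj]
        · simp [blockCost]
    · rintro σ' ω' - ⟨-, g1, g2, -⟩
      simp [g2, hF.inp_zero]
      omega
    · rintro σ' ω' ⟨g0, g1, g2, g3, g4, g5, g6⟩
      rw [show i + 1 + (n - (i + 1)) = n by omega, cols_self, List.append_nil] at g4 g6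
      rw [edgesWith_congr (p := fun v w => v = i ∧ w < n ∨ w = i) (q := fun v w => v = i ∨ w = i)
        (fun v w _ _ _ => by omega)] at g6
      exact ⟨g0, g1, g4, g5, g6⟩
    · simp
      have : n - (i + 1) ≤ n := Nat.sub_le _ _
      have : (n - (i + 1)) * (5400 * (n * 2 ^ c) + 19 + 1) ≤ n * (5500 * (n * 2 ^ c)) := by
        gcongr
        omega
      omega
  · simp [blockCost]
  · nlinarith

end
end RAM

/-! ## Processing all vertices -/

namespace RAM

open Tm

/-- The number with the binary digits `ω 0, …, ω (b - 1)`. -/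
def bitsVal : ℕ → Coins → ℕ
  | 0, _ => 0
  | b + 1, ω => 2 * bitsVal b ω + (ω b).toNat

theorem bitsVal_lt (b : ℕ) (ω : Coins) : bitsVal b ω < 2 ^ b := by
  induction b with
  | zero => simp [bitsVal]
  | succ b ih =>
    have := (ω b).toNat_le
    rw [bitsVal, pow_succ]
    omega

/-- The random weight of the vertex at position `i`. -/
def weight (β : ℕ) (ω : Coins) (i : ℕ) : ℕ := bitsVal β fun k => ω (k + i * β)

/-- Store the indeterminate of the current vertex in register `4`. -/
def draw : Program :=
  .seq (block [.reg 4 (lit 1), .reg 5 (lit 1)])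
    (.seq (.loop (var 0 - var 5).compile (.seq (.flip (arrayExpr 0 (.const 11)))
      (block [.reg 4 (var 4 * var 4 * (lit 1 + var 11 * (var 1 - lit 1))), .reg 5 (var 5 * lit 2)])))
    (block [.reg 4 (var 4 * var 2)]))

/-- Process all vertices. -/
def mainLoop : Program :=
  .loop (inp (lit 0) - var 3).compile
    (.seq draw (.seq startPass (.seq forgetLoop (.seq introduceLoop (block [.reg 3 (var 3 + lit 1)])))))

section
variable {n : ℕ} {inp : ℕ → ℕ} {B : ℕ} {σ : Store} {ω : Coins}

/-- The coins are read most significant bit first: the power of `d` is squared and multiplied by `d`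
to the new bit, written as `1 + bit * (d - 1)`. Register `5` runs through the powers of two up to `2
^ β`, which makes `β` rounds. -/
theorem draw_tri {β d D : ℕ} (h0 : σ 0 0 = 2 ^ β) (h1 : σ 0 1 = d) (h2 : σ 0 2 = D) (hd : 2 ≤ d)
    (hD : 1 ≤ D) (hB : d ^ 2 ^ β * D ≤ B) :
    Tri n B inp draw σ ω (fun σ' ω' => ω' = (fun k => ω (k + β)) ∧
      (∀ a < 10, a ≠ 4 → a ≠ 5 → σ' 0 a = σ 0 a) ∧ σ' 0 4 = d ^ bitsVal β ω * D ∧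
      ∀ j ≠ 0, σ' j = σ j) (600 * (β + 1)) := by
  have hB' : d ^ 2 ^ β ≤ B := le_trans (Nat.le_mul_of_pos_right _ hD) hB
  have hβ : 2 ^ β ≤ B := (Nat.lt_pow_self (by omega)).le.trans hB'
  have hone : 1 ≤ 2 ^ β := Nat.one_le_two_pow
  refine Tri.of_frame fun hF _ => Tri.seq (T₁ := 100) (T₂ := 500 * (β + 1)) (Tri.block ?_ ?_ ?_)
    (by omega)
  · have := hF.room
    simp [blockOk]
    omega
  · refine Tri.seq (T₁ := 400 * (β + 1)) (T₂ := 100) ?_ (by omega)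
    refine Tri.loop (T' := 350) (fun t σ' ω' => ω' = (fun k => ω (k + t)) ∧
      (∀ a < 10, a ≠ 4 → a ≠ 5 → σ' 0 a = σ 0 a) ∧ σ' 0 4 = d ^ bitsVal t ω ∧ σ' 0 5 = 2 ^ t ∧
      ∀ j ≠ 0, σ' j = σ j) β ?_ ?_ ?_ ?_ ?_ ?_
    · refine ⟨rfl, fun a ha h4 h5 => ?_, ?_, ?_, fun j hj => ?_⟩
      · simp [blockSem, Store.set_apply, h4, h5]
      · simp [blockSem, Store.set_apply, bitsVal]
      · simp [blockSem, Store.set_apply]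
      · funext s
        simp [blockSem, Store.set_apply, hj]
    · rintro t σ' ω' - ht -
      simp
    · rintro t σ' ω' - ht ⟨rfl, g1, g2, g3, g4⟩
      have hr := hF.room
      have g5 := g1 0 (by omega) (by omega) (by omega)
      have g6 := g1 1 (by omega) (by omega) (by omega)
      refine ⟨?_, ?_⟩
      · have : 2 ^ t < 2 ^ β := Nat.pow_lt_pow_right (by omega) ht
        simp [g5, g3, h0]
        omega
      refine Tri.seq (T₁ := 16) (T₂ := 320) ?_ (by omega)
      refine Tri.flip (by omega) ?_ le_rfl
      rw [zero_add]
      have hfac : 1 + (ω t).toNat * (d - 1) = d ^ (ω t).toNat := by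
        cases ω t <;> simp
        omega
      have hlt : bitsVal (t + 1) ω < 2 ^ (t + 1) := bitsVal_lt _ _
      have hle : 2 ^ (t + 1) ≤ 2 ^ β := Nat.pow_le_pow_right (by omega) ht
      have hval : d ^ bitsVal t ω * d ^ bitsVal t ω * d ^ (ω t).toNat = d ^ bitsVal (t + 1) ω := by
        rw [bitsVal, ← pow_add, ← pow_add]
        congr 1
        omega
      have hbig : d ^ bitsVal (t + 1) ω ≤ B :=
        (Nat.pow_le_pow_right (by omega) (by omega)).trans hB'
      have hsq : d ^ bitsVal t ω * d ^ bitsVal t ω ≤ B :=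
        le_trans (Nat.le_mul_of_pos_right _ (by positivity)) (hval ▸ hbig)
      have hfB : d ^ (ω t).toNat ≤ B := by
        have h' : d ^ (ω t).toNat ≤ d ^ 2 ^ β :=
          Nat.pow_le_pow_right (by omega) ((ω t).toNat_le.trans hone)
        exact h'.trans hB'
      refine Tri.block ?_ ?_ ?_
      · simp [blockOk, Store.set_apply, g2, g3, g6, h1, hfac, hval]
        omega
      · refine ⟨?_, fun a ha h4 h5 => ?_, ?_, ?_, fun j hj => ?_⟩
        · funext k
          rw [add_assoc, add_comm 1]
        · have n11 : a ≠ 11 := by omega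
          simp [blockSem, Store.set_apply, h4, h5, n11, g1 a ha h4 h5]
        · simp [blockSem, Store.set_apply, g2, g6, h1, hfac, hval]
        · simp [blockSem, Store.set_apply, g3, pow_succ]
        · funext s
          simp [blockSem, Store.set_apply, hj, g4 j hj]
      · simp [blockCost]
    · rintro σ' ω' - ⟨-, g1, -, g3, -⟩
      simp [g1 0, g3, h0]
    · rintro σ' ω' ⟨rfl, g1, g2, g3, g4⟩
      have g7 := g1 2 (by omega) (by omega) (by omega)
      have hbound : d ^ bitsVal β ω * D ≤ B :=
        (Nat.mul_le_mul_right _ (Nat.pow_le_pow_right (by omega) (bitsVal_lt _ _).le)).trans hB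
      refine Tri.block ?_ ?_ ?_
      · have := hF.room
        simp [blockOk, g2, g7, h2]
        omega
      · refine ⟨rfl, fun a ha h4 h5 => ?_, ?_, fun j hj => ?_⟩
        · simp [blockSem, Store.set_apply, h4, g1 a ha h4 h5]
        · simp [blockSem, Store.set_apply, g2, g7, h2]
        · funext s
          simp [blockSem, Store.set_apply, hj, g4 j hj]
      · simp [blockCost]
    · simp
      omega
  · simp [blockCost]

end

/-! ### Correctness of the sweep along the arrangement. -/

section
variable {ε : Type*} [DecidableEq ε] {n : ℕ} {H : ℕ → ℕ → Prop} [DecidableRel H] {e : ℕ → ℕ → ε}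
  {inp : ℕ → ℕ} {B : ℕ} {σ : Store} {ω : Coins} {β d D c : ℕ}

variable (n H e) in
/-- The factor that the vertex at position `v` with indeterminate `x` contributes to the weight of the
edge set `F`. -/
noncomputable def vertexWeight (v x : ℕ) (F : Finset ε) : ℕ :=
  (if F ∩ edgesWith n H e (fun u w => u = v ∨ w = v) = ∅ then 1 else 0) +
    if Even (F ∩ edgesWith n H e (fun u w => u = v ∨ w = v)).card then x else 0

theorem vertexWeight_insert (he : Distinct n e) {v x u w : ℕ} (huw : u < w) (hw : w < n)
    (hu : v < u) (F : Finset ε) :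
    vertexWeight n H e v x (insert (e u w) F) = vertexWeight n H e v x F := by
  rw [vertexWeight, Finset.insert_inter_of_notMem, vertexWeight]
  rw [he.mem_edgesWith huw hw]
  omega

/-- `Y` bounds the growth of the table entries during one round, so after `i` rounds they are at
most `Y ^ i`. Round `i` consumes its own block of `β` coins, starting at `i * β`. -/
theorem mainLoop_tri (he : Distinct n e) (hI : Input n inp H)
    (hc : ∀ i ≤ n, (cols H e i i n).length ≤ c)
    (h0 : σ 0 0 = 2 ^ β) (h1 : σ 0 1 = d) (h2 : σ 0 2 = D) (hd : 2 ≤ d)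
    (hD : 1 ≤ D) (h3 : σ 0 3 = 0) (h6 : σ 0 6 = 1) (ht1 : σ 1 0 = 1) (ht2 : σ 2 0 = 0)
    (ht : ∀ j ≠ 0, ∀ s, σ j s ≤ 1)
    (hB : (n + 2) ^ 2 + 256 + 4 * (2 * 2 ^ c) ≤ B)
    (hB' : d ^ 2 ^ β * D ≤ B) (hB'' : (d ^ 2 ^ β * D * 2 ^ (n + 1)) ^ n ≤ B) :
    Tri n B inp mainLoop σ ω (fun σ' _ => (∀ a < 3, σ' 0 a = σ 0 a) ∧
      σ' 1 0 + σ' 2 0 ≤ 2 * (d ^ 2 ^ β * D * 2 ^ (n + 1)) ^ n ∧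
      σ' 1 0 + σ' 2 0 = ∑ F ∈ (edgesWith n H e fun _ _ => True).powerset,
        ∏ v ∈ Finset.range n, vertexWeight n H e v (d ^ weight β ω v * D) F)
      (20000 * (n + 1) * (n * n * 2 ^ c + β + 1)) := by
  set X := d ^ 2 ^ β * D with hX
  have hXpos : 1 ≤ X := Nat.one_le_iff_ne_zero.2 (by positivity)
  set Y := X * 2 ^ (n + 1) with hY
  have hYpos : 1 ≤ Y := Nat.one_le_iff_ne_zero.2 (by positivity)
  have h2c : 1 ≤ 2 ^ c := Nat.one_le_two_pow
  have hnn : ∀ i < n, n ≤ n * n := fun i hi => Nat.le_mul_of_pos_left _ (by omega)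
  refine Tri.of_frame fun hF _ => ?_
  have hnB : n ≤ B := hF.inp_zero ▸ hF.inp_le 0
  refine Tri.loop (T' := 19000 * (n * n * 2 ^ c + β + 1)) (fun i σ' ω' =>
    ω' = (fun k => ω (k + i * β)) ∧ (∀ a < 3, σ' 0 a = σ 0 a) ∧ σ' 0 3 = i ∧
    σ' 0 6 = 2 ^ (cols H e i i n).length ∧ (∀ j ≠ 0, ∀ s, σ' j s ≤ Y ^ i) ∧
    RepSum (cols H e i i n) (edgesWith n H e fun _ w => w < i)
      (fun F => ∏ v ∈ Finset.range i, vertexWeight n H e v (d ^ weight β ω v * D) F) σ') n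
    ?_ ?_ ?_ ?_ ?_ ?_
  · have hnil : cols H e 0 0 n = [] := List.eq_nil_iff_forall_not_mem.2 fun x hx => by
      obtain ⟨u, w, h, -⟩ := mem_cols.1 hx
      omega
    have hE : edgesWith n H e (fun _ w => w < 0) = ∅ := by
      ext
      simp [RAM.mem_edgesWith]
    rw [hnil, hE]
    refine ⟨by simp, fun a ha => rfl, h3, by simpa using h6, by simpa using ht, fun S hS => ?_⟩
    simp [code, ht1, ht2]
  · rintro i σ' ω' - hi -
    simp
  · rintro i σ' ω' hσ' hi ⟨rfl, g1, g2, g3, g4, g5⟩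
    have hYi : Y ^ (i + 1) ≤ B := (Nat.pow_le_pow_right hYpos hi).trans hB''
    -- The factor 2 comes from merging two tables, `X` from the indeterminate, and `2 ^ n` from
    -- forgetting at most `n` edges.
    have hYe : Y ^ (i + 1) = 2 * Y ^ i * X * 2 ^ n := by rw [hY]; ring
    have hpi : 2 ^ i ≤ 2 ^ n := Nat.pow_le_pow_right (by omega) hi.le
    have hci := hc i hi.le
    have hcp : 2 ^ (cols H e i i n).length ≤ 2 ^ c := Nat.pow_le_pow_right (by omega) hci
    have hn' := hnn i hi
    have hn2 : n * 2 ^ c ≤ n * n * 2 ^ c := Nat.mul_le_mul_right _ hn'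
    have hn3 : 2 ^ c ≤ n * 2 ^ c := Nat.le_mul_of_pos_left _ (by omega)
    refine ⟨by simp [hF.inp_zero, g2]; omega, ?_⟩
    refine Tri.seq (T₁ := 600 * (β + 1)) (T₂ := 18000 * (n * n * 2 ^ c)) ?_ (by omega)
    refine (draw_tri (by rw [g1 0 (by omega), h0]) (by rw [g1 1 (by omega), h1])
      (by rw [g1 2 (by omega), h2]) hd hD hB').mono ?_ le_rfl
    rintro σ₁ ω₁ ⟨rfl, k1, k2, k3⟩
    have k4 := k1 3 (by omega) (by omega) (by omega)
    have k6 := k1 6 (by omega) (by omega) (by omega)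
    rw [g2] at k4
    rw [g3] at k6
    rw [show bitsVal β (fun k => ω (k + i * β)) = weight β ω i from rfl] at k2
    set x := d ^ weight β ω i * D with hx
    have hxX : x ≤ X := Nat.mul_le_mul_right _ (Nat.pow_le_pow_right (by omega) (bitsVal_lt _ _).le)
    have hb1 : 2 * Y ^ i * X ≤ Y ^ (i + 1) := hYe ▸ Nat.le_mul_of_pos_right _ (by positivity)
    have hb0 : 2 * Y ^ i ≤ 2 * Y ^ i * X := Nat.le_mul_of_pos_right _ hXpos
    have hb2 : 2 * Y ^ i * x ≤ 2 * Y ^ i * X := Nat.mul_le_mul_left _ hxX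
    refine Tri.seq (T₁ := 2000 * 2 ^ c) (T₂ := 16000 * (n * n * 2 ^ c)) ?_ (by omega)
    refine (startPass_tri (b := Y ^ i) (fun s => ?_) (by omega) (by rw [k2]; omega)
      (by rw [k6]; omega)).mono ?_ (by rw [k6]; omega)
    · rw [k3 1 (by decide), k3 2 (by decide)]
      exact ⟨g4 1 (by decide) s, g4 2 (by decide) s⟩
    rintro σ₂ ω₂ ⟨rfl, l1, l2, l3, l4⟩
    rw [k3 1 (by decide), k3 2 (by decide), k6] at l2
    rw [k3 1 (by decide), k3 2 (by decide), k6, k2] at l3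
    rw [k3 3 (by decide), k6] at l4
    have l5 := g5.start rfl l2 l3 l4
    have l6 : ∀ j ≠ 0, ∀ s, σ₂ j s ≤ 2 * Y ^ i * X := by
      have q1 := g4 1 (by decide)
      have q2 := g4 2 (by decide)
      have q3 := g4 3 (by decide)
      refine fin_four_cases ?_ ?_ ?_ <;> intro s
      · have := q1 s
        have := q2 s
        rw [l2]
        dsimp only
        split_ifs <;> omega
      · have z1 := q1 s
        have z2 := q2 s
        rw [l3]
        dsimp only
        split_ifs
        · exact Nat.mul_le_mul (by omega) hxX
        · omega
      · have := q3 s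
        rw [l4]
        dsimp only
        split_ifs <;> omega
    have l7 : 2 * Y ^ i * X * 2 ^ i ≤ Y ^ (i + 1) := hYe ▸ Nat.mul_le_mul_left _ hpi
    refine Tri.seq (T₁ := 4000 * (n * 2 ^ c)) (T₂ := 11000 * (n * n * 2 ^ c)) ?_ (by omega)
    refine (forgetLoop_tri he hI hi (by rw [l1 3 (by omega), k4]) (by rw [l1 6 (by omega), k6])
      hci hB l6 (l7.trans hYi) l5).mono ?_ le_rfl
    rintro σ₃ ω₃ ⟨rfl, m1, m2, m3, m4⟩
    refine Tri.seq (T₁ := 6000 * (n * n * 2 ^ c)) (T₂ := 100) ?_ (by omega)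
    have m5 : σ₃ 0 3 = i := by rw [m1 3 (by omega) (by omega), l1 3 (by omega), k4]
    refine (introduceLoop_tri he hI hi m5 ?_ m2 (hc (i + 1) hi) hB m3 m4).mono ?_ le_rfl
    · intro w hw hwn F
      refine Finset.prod_congr rfl fun v hv => vertexWeight_insert he hw hwn (Finset.mem_range.1 hv) F
    rintro σ₄ ω₄ ⟨rfl, p1, p2, p3, p4⟩
    have p5 := p4.finish
    refine Tri.block ?_ ?_ ?_
    · simp [blockOk, p1, m5]
      omega
    · refine ⟨?_, fun a ha => ?_, ?_, ?_, fun j hj s => ?_, fun S hS => ?_⟩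
      · funext k
        congr 1
        ring
      · have n3 : a ≠ 3 := by omega
        simp [blockSem, Store.set_apply, n3]
        rw [p1 a (by omega), m1 a (by omega) (by omega), l1 a (by omega),
          k1 a (by omega) (by omega) (by omega), g1 a ha]
      · simp [blockSem, Store.set_apply, p1, m5]
      · simp [blockSem, Store.set_apply, p2]
      · simp [blockSem, Store.set_apply, hj]
        exact (p3 j hj s).trans l7
      · have := p5 S hS
        simp only [Finset.prod_range_succ]
        simpa [blockSem, Store.set_apply, vertexWeight] using this
    · simp [blockCost]
  · rintro σ' ω' - ⟨-, -, g2, -⟩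
    simp [g2, hF.inp_zero]
  · rintro σ' ω' ⟨-, g1, g2, g3, g4, g5⟩
    have b1 := g4 1 (by decide) 0
    have b2 := g4 2 (by decide) 0
    refine ⟨g1, by omega, ?_⟩
    -- Beyond the last vertex the cut is empty, and its single entry is the complete sum.
    have := g5 ∅ (by simp)
    rw [cols_self] at this
    rw [edgesWith_congr (p := fun _ _ => True) (q := fun _ w => w < n)
      (fun u w _ h _ => by simp [h])]
    simpa [code] using this
  · simp
    nlinarith [Nat.zero_le (n * n * 2 ^ c), Nat.zero_le β]

end
end RAM

/-! ## The complete program -/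

namespace RAM

open Tm

/-- Multiply register `k` by `f` as often as register `12` says. -/
def powLoop (k : ℕ) (f : Tm) : Program :=
  .loop (var 12).compile (block [.reg k (var k * f), .reg 12 (var 12 - lit 1)])

/-- Compute the range of the random weights, the base and the shift. -/
def setup : Program :=
  .seq (block [.reg 0 (lit 1)])
    (.seq (.loop (lit 2 * inp (lit 0) - var 0).compile (block [.reg 0 (var 0 * lit 2)]))
    (.seq (block [.reg 1 (lit 2), .reg 12 (inp (lit 0) * inp (lit 0) + inp (lit 0))])
    (.seq (powLoop 1 (lit 2))
    (.seq (block [.reg 2 (var 1), .reg 12 (inp (lit 0) * var 0)])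
    (.seq (powLoop 2 (var 1))
    (block [.reg 6 (lit 1), ⟨1, lit 0, lit 1⟩]))))))

/-- Count the odd digits of the result from a certain position on. -/
def readOff : Program :=
  .seq (block [.reg 13 (get 1 (lit 0) + get 2 (lit 0)), .reg 12 (inp (lit 0) - inp (lit 2)),
    .reg 14 (lit 0)])
    (.seq (.loop (var 12).compile (block [.reg 13 (var 13 / var 2), .reg 12 (var 12 - lit 1)]))
    (.loop (var 13).compile (block [.reg 14 (var 14 + (var 13 - var 13 / lit 2 * lit 2)),
      .reg 13 (var 13 / var 1)])))

/-- The program for Feedback Vertex Set. -/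
def fvsProgram : Program :=
  .seq (.seq setup (.seq mainLoop readOff))
    (.assign (.const 0) (var 14 * (lit 1 - inp (lit 1))).compile)

section
variable {n : ℕ} {inp : ℕ → ℕ} {B : ℕ} {σ : Store} {ω : Coins}

/-- The factor is a term, so it may be a register; `hf` asks that its value survive changes to
registers `k` and `12`. -/
theorem powLoop_tri {k v m : ℕ} {f : Tm} (hk : k < 12) (hm : σ 0 12 = m) (hv : 1 ≤ v)
    (hf : ∀ σ' : Store, (∀ a, a ≠ k → a ≠ 12 → σ' 0 a = σ 0 a) →
      f.Ok n B inp σ' ∧ f.eval inp σ' = v) (hnodes : f.nodes ≤ 16) (hB : σ 0 k * v ^ m ≤ B) :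
    Tri n B inp (powLoop k f) σ ω (fun σ' ω' => ω' = ω ∧
      (∀ a, a ≠ k → a ≠ 12 → σ' 0 a = σ 0 a) ∧ σ' 0 k = σ 0 k * v ^ m ∧ ∀ j ≠ 0, σ' j = σ j)
      (200 * (m + 1)) := by
  refine Tri.of_frame fun hF _ => ?_
  have hr := hF.room
  refine Tri.loop (T' := 150) (fun t σ' ω' => ω' = ω ∧
    (∀ a, a ≠ k → a ≠ 12 → σ' 0 a = σ 0 a) ∧ σ' 0 12 = m - t ∧ σ' 0 k = σ 0 k * v ^ t ∧
    ∀ j ≠ 0, σ' j = σ j) m ⟨rfl, fun _ _ _ => rfl, by simpa using hm, by simp, fun _ _ => rfl⟩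
    ?_ ?_ ?_ ?_ ?_
  · rintro t σ' ω' - ht -
    simp
  · rintro t σ' ω' - ht ⟨rfl, g1, g2, g3, g4⟩
    refine ⟨by simp [g2]; omega, ?_⟩
    obtain ⟨ho, hev⟩ := hf σ' g1
    have h1 : σ 0 k * v ^ t * v ≤ B := by
      rw [mul_assoc, ← pow_succ]
      exact le_trans (Nat.mul_le_mul_left _ (Nat.pow_le_pow_right hv ht)) hB
    have hk' : k ≠ 12 := by omega
    refine Tri.block ?_ ?_ ?_
    · simp [blockOk, ho, hev, g3, h1]
      omega
    · refine ⟨rfl, fun a ha ha' => ?_, ?_, ?_, fun j hj => ?_⟩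
      · simp [blockSem, Store.set_apply, ha, ha', g1 a ha ha']
      · simp [blockSem, Store.set_apply, hk'.symm, g2]
        omega
      · simp [blockSem, Store.set_apply, hk', g3, hev, pow_succ, mul_assoc]
      · funext s
        simp [blockSem, Store.set_apply, hj, g4 j hj]
    · simp [blockCost]
      omega
  · rintro σ' ω' - ⟨-, -, g2, -⟩
    simp [g2]
  · rintro σ' ω' ⟨g0, g1, -, g3, g4⟩
    exact ⟨g0, g1, g3, g4⟩
  · simp
    omega

theorem setup_tri {β d D : ℕ} (hβ : β = Nat.clog 2 (2 * n)) (hd : d = 2 ^ (n * n + n + 1))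
    (hD : D = d ^ (n * 2 ^ β + 1)) (hB : d ^ 2 ^ β * D ≤ B) (hσ : σ = fun _ _ => 0) :
    Tri n B inp setup σ ω (fun σ' ω' => ω' = ω ∧ σ' 0 0 = 2 ^ β ∧ σ' 0 1 = d ∧ σ' 0 2 = D ∧
      σ' 0 3 = 0 ∧ σ' 0 6 = 1 ∧ σ' 1 0 = 1 ∧ σ' 2 0 = 0 ∧ ∀ j ≠ 0, ∀ s, σ' j s ≤ 1)
      (300 * (β + n * n + n * 2 ^ β + n + 10)) := by
  have hd2 : 2 ≤ d := by
    rw [hd, pow_succ]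
    have : 1 ≤ 2 ^ (n * n + n) := Nat.one_le_two_pow
    omega
  have hD1 : 1 ≤ D := by
    rw [hD]
    exact Nat.one_le_pow _ _ (by omega)
  have hDB : D ≤ B := le_trans (Nat.le_mul_of_pos_left _ (by positivity)) hB
  have hpB : d ^ 2 ^ β ≤ B := le_trans (Nat.le_mul_of_pos_right _ hD1) hB
  -- The loop counters are bounded by exponents of numbers that are at most `B`, hence are
  -- themselves below `B`.
  have hNB : 2 ^ β < B := (Nat.lt_pow_self (by omega)).trans_le hpB
  have hnNB : n * 2 ^ β < B := by
    have := Nat.lt_pow_self (n := n * 2 ^ β + 1) (show 1 < d by omega)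
    omega
  have hdB : d ≤ B := le_trans (Nat.le_self_pow (by positivity) d) hpB
  have hnnB : n * n + n < B := by
    have := Nat.lt_pow_self (n := n * n + n + 1) (show 1 < 2 by omega)
    omega
  refine Tri.of_frame fun hF _ => ?_
  have hr := hF.room
  have hinp := hF.inp_zero
  have hnn : n * 2 ≤ n * n + n := by
    rcases Nat.eq_zero_or_pos n with rfl | h
    · simp
    · nlinarith
  refine Tri.seq (T₁ := 50) (T₂ := 300 * (β + n * n + n * 2 ^ β + n + 9)) (Tri.block ?_ ?_ ?_)
    (by clear hr; omega)
  · simp [blockOk]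
    omega
  · refine Tri.seq (T₁ := 200 * (β + 1)) (T₂ := 300 * (n * n + n * 2 ^ β + n + 8)) ?_ (by clear hr; omega)
    refine Tri.loop (T' := 100) (fun t σ' ω' => ω' = ω ∧ σ' 0 0 = 2 ^ t ∧
      (∀ a ≠ 0, σ' 0 a = 0) ∧ ∀ j ≠ 0, ∀ s, σ' j s = 0) β ?_ ?_ ?_ ?_ ?_ ?_
    · refine ⟨rfl, by simp [blockSem, Store.set_apply], fun a ha => ?_, fun j hj s => ?_⟩
      · simp [blockSem, Store.set_apply, ha, hσ]
      · simp [blockSem, Store.set_apply, hj, hσ]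
    · rintro t σ' ω' - ht -
      simp [hinp]
      omega
    · rintro t σ' ω' - ht ⟨rfl, g1, g2, g3⟩
      have h1 : 2 ^ t < 2 * n := by
        by_contra h
        have := Nat.clog_le_of_le_pow (not_lt.1 h)
        omega
      have h4 : 4 * n ≤ (n + 2) ^ 2 := by nlinarith
      refine ⟨by simp [hinp, g1]; omega, ?_⟩
      refine Tri.block ?_ ?_ ?_
      · simp [blockOk, g1]
        omega
      · refine ⟨rfl, ?_, fun a ha => ?_, fun j hj s => ?_⟩
        · simp [blockSem, Store.set_apply, g1, pow_succ]
        · simp [blockSem, Store.set_apply, ha, g2]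
        · simp [blockSem, Store.set_apply, hj, g3]
      · simp [blockCost]
    · rintro σ' ω' - ⟨-, g1, -⟩
      have := Nat.le_pow_clog (b := 2) (by omega) (2 * n)
      rw [← hβ] at this
      simp [hinp, g1]
      omega
    · rintro σ' ω' ⟨rfl, g1, g2, g3⟩
      refine Tri.seq (T₁ := 100) (T₂ := 300 * (n * n + n * 2 ^ β + n + 7)) (Tri.block ?_ ?_ ?_)
        (by clear hr; omega)
      · simp [blockOk, hinp]
        omega
      · set σ₁ := blockSem inp [Asg.reg 1 (lit 2),
          .reg 12 (Tm.inp (lit 0) * Tm.inp (lit 0) + Tm.inp (lit 0))] σ' with hσ₁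
        have a0 : σ₁ 0 0 = 2 ^ β := by simp [hσ₁, blockSem, Store.set_apply, g1]
        have a1 : σ₁ 0 1 = 2 := by simp [hσ₁, blockSem, Store.set_apply]
        have a3 : σ₁ 0 3 = 0 := by simp [hσ₁, blockSem, Store.set_apply, g2]
        have a12 : σ₁ 0 12 = n * n + n := by simp [hσ₁, blockSem, Store.set_apply, hinp]
        have aj : ∀ j ≠ 0, ∀ s, σ₁ j s = 0 := fun j hj s => by
          simp [hσ₁, blockSem, Store.set_apply, hj, g3]
        clear_value σ₁
        refine Tri.seq (T₁ := 200 * (n * n + n + 1)) (T₂ := 300 * (n * 2 ^ β + 6)) ?_ (by clear hr; omega)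
        refine (powLoop_tri (v := 2) (by omega) a12 (by omega) (fun σ' _ => ⟨?_, rfl⟩) (by simp)
          ?_).mono ?_ le_rfl
        · simp
          omega
        · rw [a1, ← pow_succ', ← hd]
          exact hdB
        rintro σ₂ ω₂ ⟨rfl, k1, k2, k3⟩
        rw [a1, ← pow_succ', ← hd] at k2
        have b0 : σ₂ 0 0 = 2 ^ β := by rw [k1 0 (by omega) (by omega), a0]
        have b3 : σ₂ 0 3 = 0 := by rw [k1 3 (by omega) (by omega), a3]
        refine Tri.seq (T₁ := 100) (T₂ := 300 * (n * 2 ^ β + 5)) (Tri.block ?_ ?_ ?_)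
          (by clear hr; omega)
        · simp [blockOk, Store.set_apply, hinp, b0]
          omega
        · set σ₃ := blockSem inp [Asg.reg 2 (var 1), .reg 12 (Tm.inp (lit 0) * var 0)] σ₂ with hσ₃
          have c0 : σ₃ 0 0 = 2 ^ β := by simp [hσ₃, blockSem, Store.set_apply, b0]
          have c1 : σ₃ 0 1 = d := by simp [hσ₃, blockSem, Store.set_apply, k2]
          have c2 : σ₃ 0 2 = d := by simp [hσ₃, blockSem, Store.set_apply, k2]
          have c3 : σ₃ 0 3 = 0 := by simp [hσ₃, blockSem, Store.set_apply, b3]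
          have c12 : σ₃ 0 12 = n * 2 ^ β := by simp [hσ₃, blockSem, Store.set_apply, hinp, b0]
          have cj : ∀ j ≠ 0, ∀ s, σ₃ j s = 0 := fun j hj s => by
            simp [hσ₃, blockSem, Store.set_apply, hj, k3 j hj, aj j hj]
          clear_value σ₃
          refine Tri.seq (T₁ := 200 * (n * 2 ^ β + 1)) (T₂ := 300) ?_ (by omega)
          refine (powLoop_tri (v := d) (by omega) c12 (by omega) (fun σ' h => ⟨by simp, ?_⟩)
            (by simp) ?_).mono ?_ le_rfl
          · simp [h 1, c1]
          · rw [c2, ← pow_succ', ← hD]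
            exact hDB
          rintro σ₄ ω₄ ⟨rfl, l1, l2, l3⟩
          rw [c2, ← pow_succ', ← hD] at l2
          refine Tri.block ?_ ?_ ?_
          · simp [blockOk]
            omega
          · refine ⟨rfl, ?_, ?_, ?_, ?_, ?_, ?_, ?_, fun j hj s => ?_⟩
            · simp [blockSem, Store.set_apply, l1 0, c0]
            · simp [blockSem, Store.set_apply, l1 1, c1]
            · simp [blockSem, Store.set_apply, l2]
            · simp [blockSem, Store.set_apply, l1 3, c3]
            · simp [blockSem, Store.set_apply]
            · simp [blockSem, Store.set_apply]
            · simp [blockSem, Store.set_apply, l3 2, cj 2]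
            · simp [blockSem, Store.set_apply, hj, l3 j hj, cj j hj]
              split_ifs <;> omega
          · simp [blockCost]
        · simp [blockCost]
      · simp [blockCost]
    · simp
      omega
  · simp [blockCost]

/-- Register `14` sums the parities of the successive quotients, so it is nonzero exactly if one of
them is odd. The quotients vanish from exponent `J` on. -/
theorem readOff_tri {d D V J : ℕ} (h1 : σ 0 1 = d) (h2 : σ 0 2 = D)
    (hV : σ 1 0 + σ 2 0 = V) (hd : 2 ≤ d) (hVB : V ≤ B) (hJ : V < d ^ J) :
    Tri n B inp readOff σ ω (fun σ' _ =>
      (σ' 0 14 ≠ 0 ↔ ∃ j, Odd (V / D ^ (n - inp 2) / d ^ j))) (200 * (n + J + 10)) := by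
  refine Tri.of_frame fun hF _ => ?_
  have hr := hF.room
  have hinp := hF.inp_zero
  have hsq : 4 ≤ (n + 2) ^ 2 := by nlinarith
  refine Tri.seq (T₁ := 200) (T₂ := 200 * (n + J + 9)) (Tri.block ?_ ?_ ?_) (by clear hr; omega)
  · simp [blockOk, hV]
    omega
  · refine Tri.seq (T₁ := 200 * (n + 1)) (T₂ := 200 * (J + 8)) ?_ (by clear hr; omega)
    refine Tri.loop (T' := 150) (fun t σ' ω' => σ' 0 1 = d ∧ σ' 0 2 = D ∧ σ' 0 14 = 0 ∧
      σ' 0 12 = n - inp 2 - t ∧ σ' 0 13 = V / D ^ t) (n - inp 2) ?_ ?_ ?_ ?_ ?_ ?_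
    · simp [blockSem, Store.set_apply, h1, h2, hV, hinp]
    · rintro t σ' ω' - ht -
      simp
    · rintro t σ' ω' - ht ⟨g1, g2, g3, g4, g5⟩
      refine ⟨by simp [g4]; omega, Tri.block ?_ ?_ ?_⟩
      · simp [blockOk]
        omega
      · simp [blockSem, Store.set_apply, g1, g2, g3, g4, g5, Nat.div_div_eq_div_mul, pow_succ]
        omega
      · simp [blockCost]
    · rintro σ' ω' - ⟨-, -, -, g4, -⟩
      simp [g4]
    · rintro σ' ω' ⟨g1, g2, g3, -, g5⟩
      set U := V / D ^ (n - inp 2) with hU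
      have hUV : U ≤ V := Nat.div_le_self _ _
      -- The number of rounds is the least exponent with vanishing quotient. It is at most `J`,
      -- which gives the time, and at most `U`, which keeps the counter below `B`.
      have hex : ∃ m, U / d ^ m = 0 := ⟨J, Nat.div_eq_of_lt (by omega)⟩
      obtain ⟨m, hm⟩ : ∃ m, m = Nat.find hex := ⟨_, rfl⟩
      have hm0 : U / d ^ m = 0 := hm ▸ Nat.find_spec hex
      have hmJ : m ≤ J := hm ▸ Nat.find_min' hex (Nat.div_eq_of_lt (by omega))
      have hmU : m ≤ U := by
        rw [hm]
        exact Nat.find_min' hex (Nat.div_eq_of_lt (Nat.lt_pow_self (by omega)))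
      have hsum : ∀ t, ∑ j ∈ Finset.range t, U / d ^ j % 2 ≤ t := fun t => by
        calc _ ≤ ∑ j ∈ Finset.range t, 1 := Finset.sum_le_sum fun j _ => by omega
          _ = t := by simp
      refine Tri.loop (T' := 180) (fun t σ' ω' => σ' 0 1 = d ∧ σ' 0 13 = U / d ^ t ∧
        σ' 0 14 = ∑ j ∈ Finset.range t, U / d ^ j % 2) m ⟨g1, by simpa using g5, by simpa using g3⟩
        ?_ ?_ ?_ ?_ ?_
      · rintro t σ' ω' - ht -
        simp
      · rintro t σ' ω' - ht ⟨k1, k2, k3⟩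
        have hne : U / d ^ t ≠ 0 := Nat.find_min hex (hm ▸ ht)
        have hmod : U / d ^ t - U / d ^ t / 2 * 2 = U / d ^ t % 2 := by omega
        have hle : U / d ^ t / 2 * 2 ≤ U := (Nat.div_mul_le_self _ _).trans (Nat.div_le_self _ _)
        have hs := hsum (t + 1)
        rw [Finset.sum_range_succ] at hs
        refine ⟨by simpa [k2] using hne, Tri.block ?_ ?_ ?_⟩
        · simp [blockOk, k2, k3, hmod]
          omega
        · simp [blockSem, Store.set_apply, k1, k2, k3, hmod, Finset.sum_range_succ]
          rw [pow_succ, Nat.div_div_eq_div_mul]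
        · simp [blockCost]
      · rintro σ' ω' - ⟨-, k2, -⟩
        simp [k2, hm0]
      · rintro σ' ω' ⟨-, -, k3⟩
        rw [k3, Ne, Finset.sum_eq_zero_iff]
        push Not
        constructor
        · rintro ⟨j, -, hj⟩
          exact ⟨j, Nat.odd_iff.2 (by omega)⟩
        · rintro ⟨j, hj⟩
          refine ⟨j, ?_, by rw [Nat.odd_iff.1 hj]; omega⟩
          rw [Finset.mem_range]
          by_contra hlt
          have : U / d ^ j ≤ U / d ^ m :=
            Nat.div_le_div_left (Nat.pow_le_pow_right (by omega) (not_lt.1 hlt)) (by positivity)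
          rw [show U / d ^ j = 0 from Nat.le_zero.1 (this.trans hm0.le)] at hj
          exact absurd hj (by decide)
      · simp
        omega
    · simp
      have : n - inp 2 ≤ n := Nat.sub_le _ _
      omega
  · simp [blockCost]

end

section
variable {ε : Type*} [DecidableEq ε] {n : ℕ} {H : ℕ → ℕ → Prop} [DecidableRel H] {e : ℕ → ℕ → ε}
  {inp : ℕ → ℕ} {B : ℕ} {ω : Coins} {β d D c : ℕ}

/-- Cell `0` holds `n`, from which all array addresses are computed, so the answer overwrites it
only in the last step. The factor `1 - inp 1` rejects negative `k`. -/
theorem fvsProgram_spec (he : Distinct n e) (hF : Frame n B inp) (hI : Input n inp H)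
    (hc : ∀ i ≤ n, (cols H e i i n).length ≤ c)
    (hβ : β = Nat.clog 2 (2 * n)) (hd : d = 2 ^ (n * n + n + 1)) (hD : D = d ^ (n * 2 ^ β + 1))
    (hB : (n + 2) ^ 2 + 256 + 4 * (2 * 2 ^ c) ≤ B)
    (hB' : d ^ 2 ^ β * D ≤ B) (hB'' : 2 * (d ^ 2 ^ β * D * 2 ^ (n + 1)) ^ n ≤ B) :
    ∃ c' t, Exec fvsProgram ⟨memOf n inp fun _ _ => 0, ω⟩ c' t ∧
      t ≤ (20000 * (n + 1) * (n * n * 2 ^ c + β + 1) + 300 * (β + n * n + n * 2 ^ β + n + 10) +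
        200 * (n + ((n * 2 ^ β + 2 ^ β + 2) * n + 2) + 10) + 100) * (B.size + 1) ∧
      (c'.mem 0 ≠ 0 ↔ inp 1 = 0 ∧ ∃ j, Odd ((∑ F ∈ (edgesWith n H e fun _ _ => True).powerset,
        ∏ v ∈ Finset.range n, vertexWeight n H e v (d ^ weight β ω v * D) F) /
          D ^ (n - inp 2) / d ^ j)) := by
  have hd2 : 2 ≤ d := by
    rw [hd, pow_succ]
    have : 1 ≤ 2 ^ (n * n + n) := Nat.one_le_two_pow
    omega
  have hD1 : 1 ≤ D := by
    rw [hD]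
    exact Nat.one_le_pow _ _ (by omega)
  set Z := ∑ F ∈ (edgesWith n H e fun _ _ => True).powerset,
        ∏ v ∈ Finset.range n, vertexWeight n H e v (d ^ weight β ω v * D) F with hZ
  -- In the exponent, `D` accounts for `n * 2 ^ β + 1` and `2 ^ (n + 1) ≤ d` for one more; the final
  -- 2 absorbs the leading factor strictly.
  have hJ : 2 * (d ^ 2 ^ β * D * 2 ^ (n + 1)) ^ n < d ^ ((n * 2 ^ β + 2 ^ β + 2) * n + 2) := by
    have h1 : 2 ^ (n + 1) ≤ d := by
      rw [hd]
      exact Nat.pow_le_pow_right (by omega) (by nlinarith)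
    have h2 : d ^ 2 ^ β * D * 2 ^ (n + 1) ≤ d ^ (n * 2 ^ β + 2 ^ β + 2) := by
      calc d ^ 2 ^ β * D * 2 ^ (n + 1) ≤ d ^ 2 ^ β * D * d := Nat.mul_le_mul_left _ h1
        _ = _ := by rw [hD]; ring
    calc 2 * (d ^ 2 ^ β * D * 2 ^ (n + 1)) ^ n
        ≤ 2 * (d ^ (n * 2 ^ β + 2 ^ β + 2)) ^ n :=
          Nat.mul_le_mul_left _ (Nat.pow_le_pow_left h2 _)
      _ = 2 * d ^ ((n * 2 ^ β + 2 ^ β + 2) * n) := by rw [pow_mul]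
      _ < d * d * d ^ ((n * 2 ^ β + 2 ^ β + 2) * n) :=
          Nat.mul_lt_mul_of_pos_right (by nlinarith) (by positivity)
      _ = _ := by ring
  have key : Tri n B inp (.seq setup (.seq mainLoop readOff)) (fun _ _ => 0) ω
      (fun σ' _ => σ' 0 14 ≠ 0 ↔ ∃ j, Odd (Z / D ^ (n - inp 2) / d ^ j))
      (20000 * (n + 1) * (n * n * 2 ^ c + β + 1) + 300 * (β + n * n + n * 2 ^ β + n + 10) +
        200 * (n + ((n * 2 ^ β + 2 ^ β + 2) * n + 2) + 10)) := by
    refine Tri.seq (T₁ := 300 * (β + n * n + n * 2 ^ β + n + 10))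
      (T₂ := 20000 * (n + 1) * (n * n * 2 ^ c + β + 1) +
        200 * (n + ((n * 2 ^ β + 2 ^ β + 2) * n + 2) + 10)) ?_ (by omega)
    refine (setup_tri hβ hd hD hB' rfl).mono ?_ le_rfl
    rintro σ ω' ⟨rfl, g0, g1, g2, g3, g6, ht1, ht2, ht⟩
    refine Tri.seq (T₁ := 20000 * (n + 1) * (n * n * 2 ^ c + β + 1))
      (T₂ := 200 * (n + ((n * 2 ^ β + 2 ^ β + 2) * n + 2) + 10)) ?_ le_rfl
    refine (mainLoop_tri he hI hc g0 g1 g2 hd2 hD1 g3 g6 ht1 ht2 ht hB hB' (by omega)).mono ?_ le_rfl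
    rintro σ' ω'' ⟨k1, k2, k3⟩
    exact readOff_tri (by rw [k1 1 (by omega), g1]) (by rw [k1 2 (by omega), g2]) k3 hd2
      (by rw [hZ, ← k3]; omega) (by rw [hZ, ← k3]; exact k2.trans_lt hJ)
  obtain ⟨σ', ω', t, h1, h2, h3, h4⟩ := key hF (fun _ _ => Nat.zero_le _)
  have hr := hF.room
  have hsq : 4 ≤ (n + 2) ^ 2 := by nlinarith
  set a : Tm := var 14 * (lit 1 - Tm.inp (lit 1)) with ha
  have hmul : σ' 0 14 * (1 - inp 1) ≤ B := by
    refine le_trans ?_ (h3 0 14)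
    exact (Nat.mul_le_mul_left _ (by omega)).trans (mul_one _).le
  have hok : a.Ok n B inp σ' := by
    simp [ha]
    omega
  have hnodes : a.nodes = 21 := by simp [ha]
  obtain ⟨-, hev, hcost⟩ := a.compile_spec hF h3 hok
  refine ⟨_, _, .seq h1 (.assign _ _ _), ?_, ?_⟩
  · have : (Expr.const 0).cost (memOf n inp σ') = 1 := by simp [Expr.cost]
    rw [this]
    rw [hnodes] at hcost
    nlinarith
  · rw [show (Expr.const 0).eval (memOf n inp σ') = 0 from rfl, hev]
    simp [ha]
    rw [Nat.sub_eq_zero_iff_le, ← h4, and_comm]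
    have : inp 1 = 0 ↔ ¬ 1 ≤ inp 1 := by omega
    rw [this]

end
end RAM

/-! ## Even edge sets and forests -/

open Classical in
/-- The sets of edges of `G` that have even degree at every vertex. -/
noncomputable def evenEdgeSets {V : Type*} [Fintype V] (G : SimpleGraph V) :
    Finset (Finset (Sym2 V)) :=
  G.edgeFinset.powerset.filter fun F => ∀ v, Even (F.filter fun e => v ∈ e).card

/-- The start of a longest path is a leaf: a further neighbour would prolong the path or close a
cycle. -/
theorem SimpleGraph.IsAcyclic.exists_degree_eq_one {V : Type*} [Fintype V] {G : SimpleGraph V}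
    [DecidableRel G.Adj] (h : G.IsAcyclic) {a b : V} (hab : G.Adj a b) : ∃ v, G.degree v = 1 := by
  classical
  have : Nonempty V := ⟨a⟩
  obtain ⟨u, v, p, hp, hmax⟩ := SimpleGraph.Walk.exists_isPath_forall_isPath_length_le_length G
  have hnil : ¬ p.Nil := by
    intro hn
    have h1 := hmax a b (SimpleGraph.Walk.cons hab .nil) (by simp [hab.ne])
    have h2 := SimpleGraph.Walk.length_eq_zero_iff.2 hn
    simp at h1
    omega
  refine ⟨u, ?_⟩
  rw [SimpleGraph.degree_eq_one_iff_existsUnique_adj]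
  refine ⟨_, p.adj_snd hnil, fun w hadj ↦ ?_⟩
  apply h.eq_snd_of_adj_start hp hadj
  have : ¬(p.cons hadj.symm).IsPath := by grind [SimpleGraph.Walk.length_cons]
  grind [hp.cons]

open Classical in
-- A nonempty set of edges of a forest is again a forest with an edge, so it has a vertex of degree
-- 1, which is odd.
theorem evenEdgeSets_eq_of_isAcyclic {V : Type*} [Fintype V] {G : SimpleGraph V}
    (h : G.IsAcyclic) : evenEdgeSets G = {∅} := by
  ext F
  simp only [evenEdgeSets, Finset.mem_filter, Finset.mem_powerset, Finset.mem_singleton]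
  constructor
  · rintro ⟨hF, hev⟩
    by_contra hne
    obtain ⟨e, he⟩ := Finset.nonempty_iff_ne_empty.2 hne
    have hset : (SimpleGraph.fromEdgeSet (F : Set (Sym2 V))).edgeSet = F := by
      rw [SimpleGraph.edgeSet_fromEdgeSet]
      ext x
      constructor
      · exact fun h => h.1
      · intro hx
        exact ⟨hx, G.not_isDiag_of_mem_edgeFinset (hF hx)⟩
    have hle : SimpleGraph.fromEdgeSet (F : Set (Sym2 V)) ≤ G := by
      rw [← SimpleGraph.edgeSet_subset_edgeSet, hset]
      intro x hx
      exact SimpleGraph.mem_edgeFinset.1 (hF hx)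
    have hac := h.anti hle
    induction e with | h a b =>
    have hab : (SimpleGraph.fromEdgeSet (F : Set (Sym2 V))).Adj a b := by
      rw [← SimpleGraph.mem_edgeSet, hset]
      exact he
    obtain ⟨v, hv⟩ := hac.exists_degree_eq_one hab
    have := hev v
    rw [← SimpleGraph.card_incidenceFinset_eq_degree, SimpleGraph.incidenceFinset_eq_filter] at hv
    have hf : (SimpleGraph.fromEdgeSet (F : Set (Sym2 V))).edgeFinset = F := by
      ext x
      rw [SimpleGraph.mem_edgeFinset, hset, Finset.mem_coe]
    rw [hf] at hv
    rw [hv] at this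
    exact absurd this (by decide)
  · rintro rfl
    simp

theorem Finset.even_card_symmDiff {α : Type*} [DecidableEq α] {s t : Finset α} (hs : Even s.card)
    (ht : Even t.card) : Even (symmDiff s t).card := by
  have h1 := Finset.card_sdiff_add_card_inter s t
  have h2 := Finset.card_sdiff_add_card_inter t s
  rw [Finset.inter_comm] at h2
  have h3 : (symmDiff s t).card = (s \ t).card + (t \ s).card :=
    Finset.card_union_of_disjoint disjoint_sdiff_sdiff
  rw [Nat.even_iff] at *
  omega

open Classical in
-- Symmetric difference with the edge set of a cycle is an involution of the even edge sets, without
-- fixed points because the cycle is nonempty.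
theorem even_card_evenEdgeSets {V : Type*} [Fintype V] {G : SimpleGraph V}
    (h : ¬ G.IsAcyclic) : Even (evenEdgeSets G).card := by
  simp only [SimpleGraph.IsAcyclic, not_forall, not_not] at h
  obtain ⟨v, p, hp⟩ := h
  have hC : p.edges.toFinset ∈ evenEdgeSets G := by
    simp only [evenEdgeSets, Finset.mem_filter, Finset.mem_powerset]
    refine ⟨fun e he => SimpleGraph.mem_edgeFinset.2 (p.edges_subset_edgeSet (List.mem_toFinset.1 he)),
      fun x => ?_⟩
    have := (hp.isTrail.even_countP_edges_iff x).2 (fun h => absurd rfl h)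
    rw [List.countP_eq_length_filter] at this
    rw [← List.toFinset_card_of_nodup (hp.isTrail.edges_nodup.filter _)] at this
    convert this using 2
    ext e
    simp
  have hne : p.edges.toFinset.Nonempty := by
    rw [List.toFinset_nonempty_iff]
    intro h0
    have h1 := p.length_edges
    have h2 := hp.three_le_length
    rw [h0] at h1
    simp at h1
    omega
  rw [← ZMod.natCast_eq_zero_iff_even, Finset.card_eq_sum_ones, Nat.cast_sum]
  refine Finset.sum_involution (fun F _ => symmDiff F p.edges.toFinset) ?_ ?_ ?_ ?_
  · intro F _
    decide
  · intro F hF _ h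
    rw [symmDiff_eq_left] at h
    exact hne.ne_empty h
  · intro F hF
    simp only [evenEdgeSets, Finset.mem_filter, Finset.mem_powerset] at hF hC ⊢
    refine ⟨symmDiff_le_sup.trans (Finset.union_subset hF.1 hC.1), fun x => ?_⟩
    have h : (symmDiff F p.edges.toFinset).filter (fun e => x ∈ e) =
        symmDiff (F.filter fun e => x ∈ e) (p.edges.toFinset.filter fun e => x ∈ e) := by
      ext e
      simp only [Finset.mem_symmDiff, Finset.mem_filter]
      tauto
    rw [h]
    exact Finset.even_card_symmDiff (hF.2 x) (hC.2 x)
  · intro F _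
    exact symmDiff_symmDiff_cancel_right _ _

theorem odd_card_evenEdgeSets {V : Type*} [Fintype V] {G : SimpleGraph V} :
    Odd (evenEdgeSets G).card ↔ G.IsAcyclic := by
  constructor
  · intro h
    by_contra hG
    exact (Nat.not_even_iff_odd.2 h) (even_card_evenEdgeSets hG)
  · intro h
    rw [evenEdgeSets_eq_of_isAcyclic h]
    simp

/-- The graph on all vertices consisting of the edges of `G` inside `X`. -/
def SimpleGraph.inside {V : Type*} (G : SimpleGraph V) (X : Set V) : SimpleGraph V where
  Adj a b := G.Adj a b ∧ a ∈ X ∧ b ∈ X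
  symm := ⟨fun _ _ h => ⟨h.1.symm, h.2.2, h.2.1⟩⟩
  loopless := ⟨fun _ h => G.loopless.irrefl _ h.1⟩

theorem SimpleGraph.Walk.IsCycle.exists_adj_of_mem_support {V : Type*} {G : SimpleGraph V} {v : V}
    {p : G.Walk v v} (hp : p.IsCycle) {a : V} (ha : a ∈ p.support) : ∃ b, G.Adj a b := by
  by_contra hn
  have h1 := hp.ncard_neighborSet_toSubgraph_eq_two ha
  have : p.toSubgraph.neighborSet a = ∅ := by
    ext b
    simp only [SimpleGraph.Subgraph.mem_neighborSet, Set.mem_empty_iff_false, iff_false]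
    exact fun h => hn ⟨b, h.adj_sub⟩
  rw [this] at h1
  simp at h1

/-- The vertices outside `X` are isolated in `G.inside X`, so no cycle visits them. Keeping the
vertex type fixed lets the edge sets for different `X` be compared. -/
theorem SimpleGraph.isAcyclic_inside {V : Type*} {G : SimpleGraph V} {X : Set V} :
    (G.inside X).IsAcyclic ↔ (G.induce X).IsAcyclic := by
  have hG : (G.inside X).induce X = G.induce X := by
    ext a b
    simp [SimpleGraph.inside]
  constructor
  · intro h
    rw [← hG]
    exact h.induce X
  · intro h v p hp
    have hw : ∀ a ∈ p.support, a ∈ X := by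
      intro a ha
      obtain ⟨b, hb⟩ := hp.exists_adj_of_mem_support ha
      exact hb.2.1
    rw [← hG] at h
    refine h (p.induce X hw) ?_
    rw [← SimpleGraph.Walk.isCycle_map_iff_of_injective (f := (SimpleGraph.Embedding.induce X).toHom) Subtype.val_injective]
    rw [SimpleGraph.Walk.map_induce]
    exact hp

open Classical in
/-- The subgraph expansion of the sum over all edge sets. -/
theorem sum_prod_eq_sum_card_evenEdgeSets {V : Type*} [Fintype V] (G : SimpleGraph V) (x : V → ℕ) :
    (∑ F ∈ G.edgeFinset.powerset, ∏ v, ((if (F.filter fun e => v ∈ e) = ∅ then 1 else 0) +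
        if Even (F.filter fun e => v ∈ e).card then x v else 0)) =
      ∑ X : Finset V, (∏ v ∈ X, x v) * (evenEdgeSets (G.inside X)).card := by
  -- Expanding the product chooses one summand per vertex; `X` is the set of vertices where the
  -- summand with `x v` is chosen.
  have h1 (F : Finset (Sym2 V)) (X : Finset V) :
      ((∏ v ∈ X, if Even (F.filter fun e => v ∈ e).card then x v else 0) *
        ∏ v ∈ Finset.univ \ X, if (F.filter fun e => v ∈ e) = ∅ then 1 else 0) =
      (∏ v ∈ X, x v) * if (∀ v ∈ X, Even (F.filter fun e => v ∈ e).card) ∧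
        ∀ v ∉ X, (F.filter fun e => v ∈ e) = ∅ then 1 else 0 := by
    split_ifs with h
    · rw [Finset.prod_congr rfl fun v hv => if_pos (h.1 v hv), Finset.prod_eq_one
        fun v hv => if_pos (h.2 v (Finset.mem_sdiff.1 hv).2)]
    · rw [mul_zero]
      rw [not_and_or] at h
      push Not at h
      rcases h with ⟨v, hv, h⟩ | ⟨v, hv, h⟩
      · rw [Finset.prod_eq_zero hv (if_neg h), zero_mul]
      · rw [Finset.prod_eq_zero (Finset.mem_sdiff.2 ⟨Finset.mem_univ v, hv⟩)
          (if_neg h.ne_empty), mul_zero]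
  -- Degree 0 outside `X` says precisely that all chosen edges have both ends in `X`.
  have h2 (X : Finset V) : evenEdgeSets (G.inside X) = G.edgeFinset.powerset.filter fun F =>
      (∀ v ∈ X, Even (F.filter fun e => v ∈ e).card) ∧
        ∀ v ∉ X, (F.filter fun e => v ∈ e) = ∅ := by
    ext F
    simp only [evenEdgeSets, Finset.mem_filter, Finset.mem_powerset]
    constructor
    · rintro ⟨hF, hev⟩
      refine ⟨fun e he => ?_, fun v _ => hev v, fun v hv => ?_⟩
      · have := SimpleGraph.mem_edgeFinset.1 (hF he)
        induction e with | h a b =>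
        exact SimpleGraph.mem_edgeFinset.2 this.1
      · rw [Finset.filter_eq_empty_iff]
        intro e he hve
        have := SimpleGraph.mem_edgeFinset.1 (hF he)
        induction e with | h a b =>
        rcases Sym2.mem_iff.1 hve with rfl | rfl
        · exact hv this.2.1
        · exact hv this.2.2
    · rintro ⟨hF, hev, hout⟩
      refine ⟨fun e he => ?_, fun v => ?_⟩
      · have h3 : ∀ v ∈ e, v ∈ X := by
          intro v hv
          by_contra hX
          exact Finset.filter_eq_empty_iff.1 (hout v hX) he hv
        have := SimpleGraph.mem_edgeFinset.1 (hF he)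
        induction e with | h a b =>
        exact SimpleGraph.mem_edgeFinset.2 ⟨this, h3 a (Sym2.mem_mk_left a b),
          h3 b (Sym2.mem_mk_right a b)⟩
      · by_cases hv : v ∈ X
        · exact hev v hv
        · rw [hout v hv]
          simp
  have h4 (F : Finset (Sym2 V)) := (Finset.prod_congr rfl fun v _ => add_comm _ _ :
    (∏ v, ((if (F.filter fun e => v ∈ e) = ∅ then 1 else 0) +
        if Even (F.filter fun e => v ∈ e).card then x v else 0)) = _).trans
      (Finset.prod_add _ _ Finset.univ)
  rw [Finset.sum_congr rfl fun F _ => h4 F]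
  rw [Finset.sum_comm, Finset.powerset_univ]
  refine Finset.sum_congr rfl fun X _ => ?_
  rw [Finset.sum_congr rfl fun F _ => h1 F X, ← Finset.mul_sum, h2, Finset.card_filter]

/-! ## Reading off the digits -/

/-- Terms with exponent below `j` add up to less than `d ^ j`, since the coefficients sum to less
than `d`. After division, the terms with exponent above `j` are multiples of the even number `d`, so
only those with exponent `j` affect the parity. -/
theorem odd_sum_mul_pow_div_pow {ι : Type*} {s : Finset ι} {a q : ι → ℕ} {d : ℕ} (hd : Even d)
    (ha : ∑ i ∈ s, a i < d) (j : ℕ) :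
    Odd ((∑ i ∈ s, a i * d ^ q i) / d ^ j) ↔ Odd (∑ i ∈ s with q i = j, a i) := by
  have hd0 : 0 < d := by omega
  rw [← Finset.sum_filter_add_sum_filter_not s (fun i => q i < j),
    ← Finset.sum_filter_add_sum_filter_not (s.filter fun i => ¬ q i < j) (fun i => q i = j)]
  have hlow : ∑ i ∈ s with q i < j, a i * d ^ q i < d ^ j := by
    have h1 : d * ∑ i ∈ s with q i < j, a i * d ^ q i ≤ (∑ i ∈ s, a i) * d ^ j := by
      rw [Finset.mul_sum, Finset.sum_mul]
      refine (Finset.sum_le_sum fun i hi => ?_).trans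
        (Finset.sum_le_sum_of_subset (Finset.filter_subset (fun i => q i < j) s))
      have h2 : d ^ (q i + 1) ≤ d ^ j := Nat.pow_le_pow_right hd0 (Finset.mem_filter.1 hi).2
      calc d * (a i * d ^ q i) = a i * d ^ (q i + 1) := by ring
        _ ≤ _ := Nat.mul_le_mul_left _ h2
    have h3 : (∑ i ∈ s, a i) * d ^ j < d * d ^ j :=
      Nat.mul_lt_mul_of_pos_right ha (Nat.pow_pos hd0)
    exact Nat.lt_of_mul_lt_mul_left (h1.trans_lt h3)
  have hmid : ∑ i ∈ (s.filter fun i => ¬ q i < j) with q i = j, a i * d ^ q i =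
      d ^ j * ∑ i ∈ s with q i = j, a i := by
    have : ((s.filter fun i => ¬ q i < j).filter fun i => q i = j) = s.filter fun i => q i = j := by
      ext i
      simp only [Finset.mem_filter]
      constructor
      · exact fun h => ⟨h.1.1, h.2⟩
      · exact fun h => ⟨⟨h.1, by omega⟩, h.2⟩
    rw [this, Finset.mul_sum]
    refine Finset.sum_congr rfl fun i hi => ?_
    rw [(Finset.mem_filter.1 hi).2, mul_comm]
  have hhigh : ∑ i ∈ (s.filter fun i => ¬ q i < j) with ¬ q i = j, a i * d ^ q i =
      d ^ j * (d * ∑ i ∈ (s.filter fun i => ¬ q i < j) with ¬ q i = j,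
        a i * d ^ (q i - j - 1)) := by
    rw [Finset.mul_sum, Finset.mul_sum]
    refine Finset.sum_congr rfl fun i hi => ?_
    simp only [Finset.mem_filter] at hi
    have : d ^ q i = d ^ j * d * d ^ (q i - j - 1) := by
      rw [← pow_succ, ← pow_add]
      congr 1
      omega
    rw [this]
    ring
  rw [hmid, hhigh, ← mul_add, Nat.add_mul_div_left _ _ (Nat.pow_pos hd0),
    Nat.div_eq_of_lt hlow, zero_add, Nat.odd_add]
  simp [hd.mul_right]

open Classical in
theorem card_evenEdgeSets_le {V : Type*} [Fintype V] (G : SimpleGraph V) :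
    (evenEdgeSets G).card ≤ 2 ^ (Fintype.card V * Fintype.card V) := by
  refine (Finset.card_filter_le _ _).trans ?_
  rw [Finset.card_powerset]
  refine Nat.pow_le_pow_right (by norm_num) ?_
  have h := G.card_edgeFinset_le_card_choose_two
  rw [← sq]
  exact h.trans (Nat.choose_le_pow _ 2)

/-- The vertex sets that induce a forest. -/
noncomputable def forests {n : ℕ} (G : SimpleGraph (Fin n)) : Finset (Finset (Fin n)) :=
  letI := Classical.decPred fun X : Finset (Fin n) => (G.induce (X : Set (Fin n))).IsAcyclic
  Finset.univ.filter fun X => (G.induce (X : Set (Fin n))).IsAcyclic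

theorem mem_forests {n : ℕ} {G : SimpleGraph (Fin n)} {X : Finset (Fin n)} :
    X ∈ forests G ↔ (G.induce (X : Set (Fin n))).IsAcyclic := by
  simp [forests]

theorem hasFeedbackVertexSet_iff {n : ℕ} {G : SimpleGraph (Fin n)} {k : ℤ} :
    HasFeedbackVertexSet G k ↔ 0 ≤ k ∧ ∃ X ∈ forests G, n - k.natAbs ≤ X.card := by
  constructor
  · rintro ⟨Y, hY, h⟩
    refine ⟨by omega, Yᶜ, mem_forests.2 ?_, ?_⟩
    · rw [Finset.coe_compl]
      exact h
    · rw [Finset.card_compl, Fintype.card_fin]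
      omega
  · rintro ⟨hk, X, hX, h⟩
    refine ⟨Xᶜ, ?_, ?_⟩
    · have := X.card_le_univ
      rw [Finset.card_compl, Fintype.card_fin]
      rw [Fintype.card_fin] at this
      omega
    · rw [IsFeedbackVertexSet, ← Finset.coe_compl, compl_compl]
      exact mem_forests.1 hX

theorem exists_odd_digit_iff {n : ℕ} {G : SimpleGraph (Fin n)} {w : Fin n → ℕ} {N d D e : ℕ}
    (hw : ∀ v, w v < N) (hd : d = 2 ^ (n * n + n + 1)) (hD : D = d ^ (n * N + 1)) :
    (∃ j, Odd ((∑ X : Finset (Fin n), (∏ v ∈ X, d ^ w v * D) *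
        (evenEdgeSets (G.inside X)).card) / D ^ e / d ^ j)) ↔
      ∃ j, Odd ((forests G).filter fun X =>
        e ≤ X.card ∧ ∑ v ∈ X, (n * N + 1 + w v) = j).card := by
  have hdd : Even d := by
    rw [hd, pow_succ]
    simp
  -- The weights sum to at most `n * N`, less than one shift, so the exponent of `X` determines
  -- whether `X` has at least `e` elements.
  have hlt (X : Finset (Fin n)) : (n * N + 1) * e ≤ ∑ v ∈ X, (n * N + 1 + w v) ↔ e ≤ X.card := by
    have h1 : ∑ v ∈ X, w v ≤ n * N := by
      have := Finset.sum_le_card_nsmul X w N fun v _ => (hw v).le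
      have h2 := X.card_le_univ
      rw [Fintype.card_fin] at h2
      exact this.trans (Nat.mul_le_mul_right N h2)
    rw [Finset.sum_add_distrib, Finset.sum_const, smul_eq_mul]
    constructor
    · intro h
      by_contra hc
      have h3 : (X.card + 1) * (n * N + 1) ≤ e * (n * N + 1) := Nat.mul_le_mul_right _ (by omega)
      rw [add_mul] at h3
      rw [mul_comm (n * N + 1) e] at h
      omega
    · intro h
      have h3 : e * (n * N + 1) ≤ X.card * (n * N + 1) := Nat.mul_le_mul_right _ h
      rw [mul_comm]
      omega
  have hsum : (∑ X : Finset (Fin n), (∏ v ∈ X, d ^ w v * D) * (evenEdgeSets (G.inside X)).card) =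
      ∑ X : Finset (Fin n), (evenEdgeSets (G.inside X)).card *
        d ^ ∑ v ∈ X, (n * N + 1 + w v) := by
    refine Finset.sum_congr rfl fun X _ => ?_
    rw [mul_comm, ← Finset.prod_pow_eq_pow_sum]
    congr 1
    refine Finset.prod_congr rfl fun v _ => ?_
    rw [hD, ← pow_add, add_comm]
  -- There are `2 ^ n` sets `X`, each with at most `2 ^ (n * n)` even edge sets; this dictates the
  -- choice of `d`.
  have ha : ∑ X : Finset (Fin n), (evenEdgeSets (G.inside X)).card < d := by
    have h1 := Finset.sum_le_card_nsmul (Finset.univ : Finset (Finset (Fin n)))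
      (fun X => (evenEdgeSets (G.inside X)).card) (2 ^ (n * n)) fun X _ => by
        simpa using card_evenEdgeSets_le (G.inside (X : Set (Fin n)))
    rw [Finset.card_univ, Fintype.card_finset, Fintype.card_fin, smul_eq_mul, ← pow_add] at h1
    rw [hd]
    exact h1.trans_lt (Nat.pow_lt_pow_right (by norm_num) (by omega))
  have hodd (j : ℕ) : Odd ((∑ X : Finset (Fin n), (∏ v ∈ X, d ^ w v * D) *
        (evenEdgeSets (G.inside X)).card) / d ^ j) ↔
      Odd ((forests G).filter fun X => ∑ v ∈ X, (n * N + 1 + w v) = j).card := by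
    classical
    rw [hsum, odd_sum_mul_pow_div_pow hdd ha, Finset.odd_sum_iff_odd_card_odd]
    simp only [odd_card_evenEdgeSets, SimpleGraph.isAcyclic_inside, Finset.filter_filter, forests]
    simp only [and_comm]
  have hdiv (V j : ℕ) : V / D ^ e / d ^ j = V / d ^ ((n * N + 1) * e + j) := by
    rw [Nat.div_div_eq_div_mul, hD, ← pow_mul, ← pow_add]
  simp only [hdiv, hodd]
  constructor
  · rintro ⟨j, hj⟩
    refine ⟨(n * N + 1) * e + j, ?_⟩
    convert hj using 4 with X
    rw [← hlt]
    constructor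
    · exact fun h => h.2
    · exact fun h => ⟨by omega, h⟩
  · rintro ⟨j, hj⟩
    obtain ⟨X, hX⟩ := Finset.card_pos.1 hj.pos
    rw [Finset.mem_filter, ← hlt] at hX
    refine ⟨j - (n * N + 1) * e, ?_⟩
    rw [Nat.add_sub_cancel' (by omega)]
    convert hj using 4 with X
    rw [← hlt]
    constructor
    · exact fun h => ⟨by omega, h⟩
    · exact fun h => h.2

/-! ## The probability of isolating an odd coefficient -/

open Classical in
-- The counts are the coefficients of `P` evaluated at the powers `T (w v)`, so all of them are even
-- exactly if this value is zero modulo 2. Schwartz–Zippel bounds such zeros by a fraction `n / N ≤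
-- 1 / 2`.
theorem two_mul_card_even_coefficients_le {n : ℕ} {𝓕 : Finset (Finset (Fin n))} (h𝓕 : 𝓕.Nonempty)
    {N : ℕ} (hN : 0 < N) (hnN : 2 * n ≤ N) (M : ℕ) :
    2 * ((Fintype.piFinset fun _ : Fin n => Finset.range N).filter fun w : Fin n → ℕ =>
      ∀ j, Even (𝓕.filter fun X => ∑ v ∈ X, (M + w v) = j).card).card ≤ N ^ n := by
  let T : ℕ → Polynomial (ZMod 2) := fun w => Polynomial.X ^ (M + w)
  have hT : Function.Injective T := by
    intro a b hab
    have := congrArg Polynomial.natDegree hab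
    simp only [T, Polynomial.natDegree_X_pow] at this
    omega
  let P : MvPolynomial (Fin n) (Polynomial (ZMod 2)) := ∑ X ∈ 𝓕, ∏ v ∈ X, MvPolynomial.X v
  have hP : P ≠ 0 := by
    -- At the indicator of an inclusion-minimal member `X`, the only surviving monomial is that of
    -- `X`, so `P` takes the value 1.
    obtain ⟨X, hX⟩ := 𝓕.exists_minimal h𝓕
    intro h0
    have h1 := congrArg (MvPolynomial.eval fun v => if v ∈ X then 1 else 0) h0
    simp only [P, map_sum, map_prod, MvPolynomial.eval_X, map_zero] at h1
    rw [Finset.sum_eq_single_of_mem X hX.prop, Finset.prod_eq_one fun v hv => if_pos hv] at h1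
    · exact one_ne_zero h1
    · intro Y hY hYX
      by_contra hne
      apply hYX
      refine hX.eq_of_le hY ?_
      intro v hv
      by_contra hvX
      exact hne (Finset.prod_eq_zero hv (if_neg hvX))
  have hdeg : P.totalDegree ≤ n := by
    refine MvPolynomial.totalDegree_finsetSum_le fun X _ => ?_
    refine (MvPolynomial.totalDegree_finsetProd _ _).trans ?_
    simp only [MvPolynomial.totalDegree_X, Finset.sum_const, smul_eq_mul, mul_one]
    simpa using X.card_le_univ
  have hsz := MvPolynomial.schwartz_zippel_totalDegree hP ((Finset.range N).image T)
  rw [Finset.card_image_of_injective _ hT, Finset.card_range] at hsz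
  have hcard : ((Fintype.piFinset fun _ : Fin n => Finset.range N).filter fun w : Fin n → ℕ =>
      ∀ j, Even (𝓕.filter fun X => ∑ v ∈ X, (M + w v) = j).card).card ≤
      ((Fintype.piFinset fun _ : Fin n => (Finset.range N).image T).filter fun f =>
        MvPolynomial.eval f P = 0).card := by
    refine Finset.card_le_card_of_injOn (fun w v => T (w v)) ?_ ?_
    · intro w hw
      simp only [Finset.coe_filter, Set.mem_ofPred_eq, Fintype.mem_piFinset] at hw ⊢
      refine ⟨fun v => Finset.mem_image_of_mem T (hw.1 v), ?_⟩
      simp only [P, T, map_sum, map_prod, MvPolynomial.eval_X, Finset.prod_pow_eq_pow_sum]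
      ext j
      rw [Polynomial.finsetSum_coeff, Polynomial.coeff_zero]
      simp only [Polynomial.coeff_X_pow]
      rw [Finset.sum_boole, ZMod.natCast_eq_zero_iff_even]
      simp only [eq_comm (a := j)]
      exact hw.2 j
    · intro w _ w' _ h
      funext v
      exact hT (congrFun h v)
  have hN' : (0 : ℚ≥0) < N := by exact_mod_cast hN
  have h1 : (2 : ℚ≥0) * (((Fintype.piFinset fun _ : Fin n => Finset.range N).filter fun w : Fin n → ℕ =>
      ∀ j, Even (𝓕.filter fun X => ∑ v ∈ X, (M + w v) = j).card).card : ℚ≥0) ≤ (N : ℚ≥0) ^ n := by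
    have h2 : (P.totalDegree : ℚ≥0) / N * 2 ≤ 1 := by
      rw [div_mul_eq_mul_div, div_le_one hN']
      have : P.totalDegree * 2 ≤ N := by omega
      exact_mod_cast this
    rw [div_le_iff₀ (pow_pos hN' n)] at hsz
    calc _ ≤ 2 * ((P.totalDegree : ℚ≥0) / N * N ^ n) := by
            gcongr
            exact (Nat.cast_le.2 hcard).trans hsz
      _ = (P.totalDegree : ℚ≥0) / N * 2 * N ^ n := by ring
      _ ≤ 1 * N ^ n := by gcongr
      _ = _ := one_mul _
  exact_mod_cast h1

/-! ### The distribution of the random weights. -/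

namespace RAM

instance : IsProbabilityMeasure coinMeasure := by
  unfold coinMeasure
  infer_instance

theorem bitsVal_inj {b : ℕ} {ω ω' : Coins} (h : bitsVal b ω = bitsVal b ω') {m : ℕ} (hm : m < b) :
    ω m = ω' m := by
  induction b generalizing ω ω' m with
  | zero => omega
  | succ b ih =>
    have h1 := (ω b).toNat_le
    have h2 := (ω' b).toNat_le
    rw [bitsVal, bitsVal] at h
    rcases Nat.lt_succ_iff_lt_or_eq.1 hm with hm | rfl
    · exact ih (by omega) hm
    · have h3 : (ω m).toNat = (ω' m).toNat := by omega
      revert h3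
      cases ω m <;> cases ω' m <;> simp

theorem coinMeasure_cylinder (ω₀ : Coins) (m : ℕ) :
    coinMeasure {ω | ∀ i < m, ω i = ω₀ i} = (2 ^ m)⁻¹ := by
  have h : {ω : Coins | ∀ i < m, ω i = ω₀ i} =
      Set.pi (Finset.range m : Set ℕ) fun i => {ω₀ i} := by
    ext ω
    simp
  rw [h, coinMeasure, Measure.infinitePi_pi _ fun i _ => measurableSet_singleton _]
  simp [ENNReal.inv_pow]

/-- The weights determine the first `n * β` coins: coin `i` is binary digit `i % β` of the weight at
position `i / β`. -/
theorem coinMeasure_weight_le {n : ℕ} (σ : Fin n ≃ Fin n) (β : ℕ) (u : Fin n → ℕ) :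
    coinMeasure {ω | ∀ v, weight β ω (σ v) = u v} ≤ (2 ^ (n * β))⁻¹ := by
  rcases Set.eq_empty_or_nonempty {ω | ∀ v, weight β ω (σ v) = u v} with h | ⟨ω₀, h₀⟩
  · rw [h]
    simp
  · rw [← coinMeasure_cylinder ω₀]
    refine measure_mono fun ω hω i hi => ?_
    have hβ : 0 < β := by
      rcases Nat.eq_zero_or_pos β with rfl | h
      · simp at hi
      · exact h
    have hin : i / β < n := Nat.div_lt_of_lt_mul (by rwa [mul_comm])
    have h1 := (hω (σ.symm ⟨i / β, hin⟩)).trans (h₀ (σ.symm ⟨i / β, hin⟩)).symm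
    simp only [Equiv.apply_symm_apply] at h1
    have h2 := bitsVal_inj h1 (Nat.mod_lt i hβ)
    simpa only [Nat.mod_add_div'] using h2

open Classical in
-- Union bound over the bad weight vectors. Subadditivity bounds the good event from below, so its
-- measurability is not needed.
theorem half_le_coinMeasure_odd {n : ℕ} {𝓕 : Finset (Finset (Fin n))} (h𝓕 : 𝓕.Nonempty)
    (σ : Fin n ≃ Fin n) {β : ℕ} (hβ : 2 * n ≤ 2 ^ β) (M : ℕ) :
    1 / 2 ≤ coinMeasure {ω | ∃ j, Odd (𝓕.filter fun X =>
      ∑ v ∈ X, (M + weight β ω (σ v)) = j).card} := by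
  set good := {ω | ∃ j, Odd (𝓕.filter fun X => ∑ v ∈ X, (M + weight β ω (σ v)) = j).card}
  set bad := (Fintype.piFinset fun _ : Fin n => Finset.range (2 ^ β)).filter fun w : Fin n → ℕ =>
      ∀ j, Even (𝓕.filter fun X => ∑ v ∈ X, (M + w v) = j).card with hbad
  have h1 : (Set.univ : Set Coins) ⊆
      good ∪ ⋃ u ∈ bad, {ω | ∀ v, weight β ω (σ v) = u v} := by
    intro ω _
    by_cases hg : ω ∈ good
    · exact Or.inl hg
    · refine Or.inr ?_
      simp only [Set.mem_iUnion]
      refine ⟨fun v => weight β ω (σ v), ?_, fun v => rfl⟩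
      rw [hbad, Finset.mem_filter, Fintype.mem_piFinset]
      refine ⟨fun v => Finset.mem_range.2 (bitsVal_lt _ _), fun j => ?_⟩
      rw [← Nat.not_odd_iff_even]
      exact fun h => hg ⟨j, h⟩
  have h2 : (1 : ℝ≥0∞) ≤ coinMeasure good + bad.card * (2 ^ (n * β))⁻¹ := by
    calc 1 = coinMeasure Set.univ := measure_univ.symm
      _ ≤ _ := measure_mono h1
      _ ≤ _ := measure_union_le _ _
      _ ≤ coinMeasure good + ∑ u ∈ bad, coinMeasure {ω | ∀ v, weight β ω (σ v) = u v} := by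
          gcongr
          exact measure_biUnion_finset_le _ _
      _ ≤ coinMeasure good + ∑ u ∈ bad, (2 ^ (n * β))⁻¹ := by
          gcongr
          exact coinMeasure_weight_le _ _ _
      _ = _ := by rw [Finset.sum_const, nsmul_eq_mul]
  have h3 : (bad.card : ℝ≥0∞) * (2 ^ (n * β))⁻¹ ≤ 1 / 2 := by
    have := two_mul_card_even_coefficients_le h𝓕 (Nat.pow_pos two_pos) hβ M
    rw [← pow_mul, mul_comm β] at this
    rw [← div_eq_mul_inv]
    refine ENNReal.div_le_of_le_mul ?_
    rw [mul_comm, mul_one_div, ENNReal.le_div_iff_mul_le (by simp) (by simp), mul_comm]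
    exact_mod_cast this
  have h4 : (1 / 2 : ℝ≥0∞) + 1 / 2 ≤ coinMeasure good + 1 / 2 := by
    rw [ENNReal.add_halves]
    exact h2.trans (by gcongr)
  exact (ENNReal.add_le_add_iff_right (by simp)).1 h4

end RAM

/-! ## The input -/

theorem List.getD_flatMap_of_length_eq {α β : Type*} {f : α → List β} {n : ℕ}
    (hf : ∀ x, (f x).length = n) (l : List α) {a b : ℕ} (ha : a < l.length) (hb : b < n) (z : β) :
    (l.flatMap f).getD (a * n + b) z = (f l[a]).getD b z := by
  induction l generalizing a with
  | nil => simp at ha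
  | cons x l ih =>
    rw [List.flatMap_cons]
    cases a with
    | zero =>
      rw [List.getD_append _ _ _ _ (by rw [hf]; omega)]
      simp
    | succ a =>
      have h : (a + 1) * n + b = n + (a * n + b) := by ring
      rw [List.getD_append_right _ _ _ _ (by rw [hf]; omega), hf, h, Nat.add_sub_cancel_left,
        ih (by simpa using ha)]
      simp

section
variable {n : ℕ} {G : SimpleGraph (Fin n)} {ℓ : Fin n ≃ Fin n} {k : ℤ}

theorem fvsMemory_zero : fvsMemory G ℓ k 0 = n := by simp [fvsMemory, fvsInput]

theorem fvsMemory_one : fvsMemory G ℓ k 1 = if k < 0 then 1 else 0 := by simp [fvsMemory, fvsInput]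

theorem fvsMemory_two : fvsMemory G ℓ k 2 = k.natAbs := by simp [fvsMemory, fvsInput]

theorem fvsMemory_vertex (u : Fin n) : fvsMemory G ℓ k (3 + u) = ℓ u := by
  have hu := u.isLt
  rw [fvsMemory, fvsInput, List.append_assoc, List.getD_append_right _ _ _ _ (by simp)]
  rw [List.getD_append _ _ _ _ (by simp)]
  simp

open Classical in
theorem fvsMemory_adj (u v : Fin n) :
    fvsMemory G ℓ k (3 + n + u * n + v) = if G.Adj u v then 1 else 0 := by
  rw [fvsMemory, fvsInput, List.getD_append_right _ _ _ _ (by simp; omega)]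
  have h : 3 + n + u * n + v - ([n, if k < 0 then 1 else 0, k.natAbs] ++
      ((List.finRange n).map fun i => (ℓ i : ℕ))).length = u * n + v := by
    simp
    omega
  rw [h, List.getD_flatMap_of_length_eq (n := n) (by simp) _ (by simp) v.isLt]
  simp

theorem fvsMemory_le (a : ℕ) : fvsMemory G ℓ k a ≤ n + k.natAbs + 1 := by
  have h : ∀ x ∈ fvsInput G ℓ k, x ≤ n + k.natAbs + 1 := by
    intro x hx
    simp only [fvsInput, List.mem_append, List.mem_cons, List.not_mem_nil, or_false, List.mem_map,
      List.mem_flatMap] at hx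
    rcases hx with ((rfl | rfl | rfl) | ⟨u, -, rfl⟩) | ⟨u, -, v, -, rfl⟩
    · omega
    · split_ifs <;> omega
    · omega
    · have := (ℓ u).isLt
      omega
    · split_ifs <;> omega
  rw [fvsMemory, List.getD_eq_getElem?_getD]
  rcases lt_or_ge a (fvsInput G ℓ k).length with ha | ha
  · rw [List.getElem?_eq_getElem ha]
    exact h _ (List.getElem_mem ha)
  · rw [List.getElem?_eq_none ha]
    exact Nat.zero_le _

theorem memOf_fvsMemory :
    RAM.memOf n (fvsMemory G ℓ k) (fun _ _ => 0) = fvsMemory G ℓ k := by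
  funext a
  rw [RAM.memOf]
  split_ifs with h
  · rfl
  · symm
    apply List.getD_eq_default
    have h1 : (fvsInput G ℓ k).length = 3 + n + n * n := by
      simp [fvsInput]
      ring
    rw [h1]
    nlinarith

theorem card_cutAt_le (i : Fin n) : (cutAt G ℓ i).ncard ≤ n * n := by
  classical
  have h1 : (cutAt G ℓ i).ncard ≤ G.edgeSet.ncard :=
    Set.ncard_le_ncard (fun e he => he.1) (Set.toFinite _)
  have h2 := G.card_edgeFinset_le_card_choose_two
  rw [Fintype.card_fin, ← SimpleGraph.coe_edgeFinset, Set.ncard_coe_finset] at *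
  exact h1.trans (h2.trans ((Nat.choose_le_pow n 2).trans (sq n).le))

/-- Keeps the bit length of table addresses polynomial in `n`. -/
theorem cutwidth_le : cutwidth G ℓ ≤ n * n := Finset.sup_le fun i _ => card_cutAt_le i

end

namespace RAM

/-! ## The running time -/

/-- With `m = n + s + 1`, there are at most `86300 * P * m ^ 3` operations, where `86300 = 80000 +
3000 + 3300`, on numbers of bit length `O(m ^ 5)`. -/
theorem running_time_le {n s β Q P E L : ℕ} (hβ : β ≤ 4 * n) (hQ : Q ≤ 4 * n + 1) (hP : 1 ≤ P)
    (hE : E = (n * n + n + 1) * ((n + 1) * Q + 1))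
    (hL : L = (n * n + 2 * n + 10) + s + E + (E + n + 1) * n + 1) :
    (20000 * (n + 1) * (n * n * P + β + 1) + 300 * (β + n * n + n * Q + n + 10) +
        200 * (n + ((n * Q + Q + 2) * n + 2) + 10) + 100) * (L + 1 + 1) ≤
        2000000 * P * (n + s + 1) ^ 8 := by
  set m := n + s + 1 with hm
  have hnm : n + 1 ≤ m := by omega
  have hm1 : 1 ≤ m := by omega
  have hpow {i j : ℕ} (h : i ≤ j) : m ^ i ≤ m ^ j := Nat.pow_le_pow_right hm1 h
  have hn2 : n * n + n + 1 ≤ m ^ 2 := by nlinarith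
  have hn2' : n * n + 2 * n + 1 ≤ m ^ 2 := by nlinarith
  have hE4 : E ≤ 4 * m ^ 4 := by
    calc E ≤ (n * n + n + 1) * ((n + 1) * (4 * n + 1) + 1) := by
          rw [hE]
          gcongr
      _ ≤ m ^ 2 * (4 * m ^ 2) := by
          gcongr
          nlinarith
      _ = _ := by ring
  have hE5 : (E + n + 1) * n ≤ 5 * m ^ 5 := by
    have := hpow (show 1 ≤ 4 by norm_num)
    rw [pow_one] at this
    calc (E + n + 1) * n ≤ (5 * m ^ 4) * m := Nat.mul_le_mul (by omega) (by omega)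
      _ = _ := by ring
  have hsize : L + 1 + 1 ≤ 23 * m ^ 5 := by
    have h1 := hpow (show 0 ≤ 5 by norm_num)
    have h2 := hpow (show 1 ≤ 5 by norm_num)
    have h3 := hpow (show 2 ≤ 5 by norm_num)
    have h4 := hpow (show 4 ≤ 5 by norm_num)
    rw [pow_zero] at h1
    rw [pow_one] at h2
    omega
  have ht1 : 20000 * (n + 1) * (n * n * P + β + 1) ≤ 80000 * (P * m ^ 3) := by
    have : n * n * P + β + 1 ≤ P * (4 * m ^ 2) := by
      calc n * n * P + β + 1 ≤ n * n * P + (4 * n + 1) * P := by nlinarith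
        _ = P * (n * n + 4 * n + 1) := by ring
        _ ≤ _ := Nat.mul_le_mul_left _ (by nlinarith)
    calc _ ≤ 20000 * m * (P * (4 * m ^ 2)) := by gcongr
      _ = _ := by ring
  have hnQ : n * Q ≤ n * (4 * n + 1) := Nat.mul_le_mul_left _ hQ
  have hm23 := hpow (show 2 ≤ 3 by norm_num)
  have ht2 : 300 * (β + n * n + n * Q + n + 10) ≤ 3000 * m ^ 3 := by
    have : β + n * n + n * Q + n + 10 ≤ 10 * m ^ 2 := by nlinarith
    linarith
  have ht3 : 200 * (n + ((n * Q + Q + 2) * n + 2) + 10) + 100 ≤ 3300 * m ^ 3 := by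
    have h1 : (n * Q + Q + 2) * n ≤ (4 * m ^ 2) * m :=
      Nat.mul_le_mul (by nlinarith) (by omega)
    have h2 := hpow (show 0 ≤ 3 by norm_num)
    have h3 := hpow (show 1 ≤ 3 by norm_num)
    have h4 : (4 * m ^ 2) * m = 4 * m ^ 3 := by ring
    rw [pow_zero] at h2
    rw [pow_one] at h3
    linarith
  have hPm : m ^ 3 ≤ P * m ^ 3 := Nat.le_mul_of_pos_left _ hP
  calc _ ≤ (86300 * (P * m ^ 3)) * (23 * m ^ 5) := by
        refine Nat.mul_le_mul ?_ hsize
        linarith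
    _ = 1984900 * P * m ^ 8 := by ring
    _ ≤ _ := by gcongr; norm_num

/-- `B` is the power `2 ^ L`, whose size is exactly `L + 1`. The exponent `E` satisfies `d ^ 2 ^ β *
D = 2 ^ E`, and `L` adds up the exponents needed by the individual bounds. -/
theorem exists_bound (n c : ℕ) (hc : c ≤ n * n) (k : ℕ) {β d D : ℕ}
    (hβ : β = Nat.clog 2 (2 * n)) (hd : d = 2 ^ (n * n + n + 1)) (hD : D = d ^ (n * 2 ^ β + 1)) :
    ∃ B, n + k + 1 ≤ B ∧ (n + 2) ^ 2 + 256 + 4 * (2 * 2 ^ c) ≤ B ∧ d ^ 2 ^ β * D ≤ B ∧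
      2 * (d ^ 2 ^ β * D * 2 ^ (n + 1)) ^ n ≤ B ∧
      (20000 * (n + 1) * (n * n * 2 ^ c + β + 1) + 300 * (β + n * n + n * 2 ^ β + n + 10) +
        200 * (n + ((n * 2 ^ β + 2 ^ β + 2) * n + 2) + 10) + 100) * (B.size + 1) ≤
        2000000 * 2 ^ c * (n + k.size + 1) ^ 8 := by
  set E := (n * n + n + 1) * ((n + 1) * 2 ^ β + 1) with hE
  set s := k.size
  have hdD : d ^ 2 ^ β * D = 2 ^ E := by
    rw [hD, hd, ← pow_add, ← pow_mul, hE]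
    ring
  have hn : n + 1 ≤ 2 ^ n := Nat.lt_two_pow_self
  have hk : k < 2 ^ s := Nat.lt_size_self k
  have hQ : 2 ^ β ≤ 4 * n + 1 := by
    rcases Nat.eq_zero_or_pos n with rfl | hn0
    · rw [hβ]
      simp
    · rcases Nat.eq_zero_or_pos β with h0 | h0
      · rw [h0]
        omega
      · have h1 := Nat.pow_pred_clog_lt_self (b := 2) (by norm_num) (x := 2 * n) (by omega)
        rw [← hβ] at h1
        have h2 : 2 ^ β = 2 * 2 ^ (β - 1) := by
          rw [← pow_succ']
          congr 1
          omega
        rw [Nat.pred_eq_sub_one] at h1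
        omega
  have hβ4 : β ≤ 4 * n := by
    have : β < 2 ^ β := Nat.lt_two_pow_self
    omega
  set L := (n * n + 2 * n + 10) + s + E + (E + n + 1) * n + 1 with hL
  have hmono {x : ℕ} (h : x ≤ L) : 2 ^ x ≤ 2 ^ L := Nat.pow_le_pow_right (by norm_num) h
  refine ⟨2 ^ L, ?_, ?_, ?_, ?_, ?_⟩
  · have h1 : n + k + 1 ≤ 2 ^ (n + s + 1) := by
      have h2 : 2 ^ n ≤ 2 ^ (n + s) := Nat.pow_le_pow_right (by norm_num) (by omega)
      have h3 : 2 ^ s ≤ 2 ^ (n + s) := Nat.pow_le_pow_right (by norm_num) (by omega)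
      rw [pow_succ]
      omega
    exact h1.trans (hmono (by rw [hL]; nlinarith))
  · have h1 : (n + 2) ^ 2 ≤ 2 ^ (n * n + 2 * n + 8) := by
      calc (n + 2) ^ 2 ≤ (2 ^ (n + 1)) ^ 2 := by
            gcongr
            rw [pow_succ]
            omega
        _ = 2 ^ (2 * n + 2) := by
            rw [← pow_mul]
            ring
        _ ≤ _ := Nat.pow_le_pow_right (by norm_num) (by omega)
    have h2 : 2 ^ 8 ≤ 2 ^ (n * n + 2 * n + 8) := Nat.pow_le_pow_right (by norm_num) (by omega)
    have h3 : 2 ^ (c + 3) ≤ 2 ^ (n * n + 2 * n + 8) :=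
      Nat.pow_le_pow_right (by norm_num) (by omega)
    have h4 : 2 ^ (n * n + 2 * n + 10) = 4 * 2 ^ (n * n + 2 * n + 8) := by
      rw [show n * n + 2 * n + 10 = n * n + 2 * n + 8 + 2 by ring, pow_add _ _ 2]
      ring
    have h5 : 2 ^ (n * n + 2 * n + 10) ≤ 2 ^ L := hmono (by omega)
    rw [pow_add _ c] at h3
    omega
  · rw [hdD]
    exact hmono (by omega)
  · rw [hdD, ← pow_add, ← pow_mul, ← pow_succ']
    exact hmono (by rw [hL, ← add_assoc]; omega)
  · rw [Nat.size_pow]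
    exact running_time_le hβ4 hQ Nat.one_le_two_pow hE hL

/-- Turns the length of the list into the cardinality of a set of edges, so that it can be compared
with a cut. -/
theorem Distinct.nodup_cols {ε : Type*} {n : ℕ} {H : ℕ → ℕ → Prop} [DecidableRel H]
    {e : ℕ → ℕ → ε} (he : Distinct n e) (i : ℕ) : (cols H e i i n).Nodup := by
  rw [cols, List.nodup_flatMap]
  constructor
  · intro w hw
    rw [List.mem_range'_1] at hw
    rw [row]
    refine List.Nodup.map_on ?_ ((List.nodup_range' ..).filter _)
    intro a ha b hb hab
    simp only [List.mem_filter, List.mem_range'_1] at ha hb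
    exact (he a w b w (by omega) (by omega) (by omega) (by omega) hab).1
  · refine (List.nodup_range' (s := i) (n := n - i)).imp_of_mem ?_
    intro w w' hw hw' hne x hx hx'
    rw [List.mem_range'_1] at hw hw'
    rw [mem_row] at hx hx'
    obtain ⟨a, -, ha, -, rfl⟩ := hx
    obtain ⟨b, -, hb, -, h⟩ := hx'
    exact hne (he a w b w' (by omega) (by omega) (by omega) (by omega) h).2

end RAM

/-! ## The algorithm -/

namespace RAM

section
variable {n : ℕ} {G : SimpleGraph (Fin n)} {ℓ : Fin n ≃ Fin n}

/-- A numbering `e` of the edges of the graph `H` of positions by elements of `ε` presents the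
arrangement `ℓ` of `G`. -/
structure Presents (G : SimpleGraph (Fin n)) (ℓ : Fin n ≃ Fin n) {ε : Type*} [DecidableEq ε]
    (H : ℕ → ℕ → Prop) [DecidableRel H] (e : ℕ → ℕ → ε) : Prop where
  distinct : Distinct n e
  adj : ∀ u w : Fin n, H u w ↔ G.Adj (ℓ u) (ℓ w)
  length_cols_le : ∀ i ≤ n, (cols H e i i n).length ≤ cutwidth G ℓ
  sum_eq : ∀ x : ℕ → ℕ,
    (∑ F ∈ (edgesWith n H e fun _ _ => True).powerset,
      ∏ v ∈ Finset.range n, vertexWeight n H e v (x v) F) =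
    ∑ X : Finset (Fin n), (∏ v ∈ X, x (ℓ.symm v)) * (evenEdgeSets (G.inside X)).card

/-- Positions become natural numbers through `Fin.ofNat`, and edges are unordered pairs of vertices.
`Fin.ofNat` needs `n ≠ 0`, so the empty graph is presented separately. -/
theorem exists_presents (G : SimpleGraph (Fin n)) (ℓ : Fin n ≃ Fin n) :
    ∃ (ε : Type) (_ : DecidableEq ε) (H : ℕ → ℕ → Prop) (_ : DecidableRel H) (e : ℕ → ℕ → ε),
      Presents G ℓ H e := by
  classical
  rcases Nat.eq_zero_or_pos n with rfl | hn
  · refine ⟨ℕ, inferInstance, fun _ _ => False, fun _ _ => instDecidableFalse, fun _ _ => 0, ?_, ?_, ?_, ?_⟩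
    · intro u w u' w' _ h
      omega
    · exact fun u => u.elim0
    · intro i hi
      obtain rfl : i = 0 := by omega
      simp [cols]
    · intro x
      have h1 : (edgesWith 0 (fun _ _ => False) (fun _ _ => 0) fun _ _ => True) = (∅ : Finset ℕ) := by
        ext
        simp [mem_edgesWith]
      have h2 : (Finset.univ : Finset (Finset (Fin 0))) = {∅} := rfl
      rw [h1, h2, Finset.sum_singleton, Finset.powerset_empty, Finset.sum_singleton]
      rw [evenEdgeSets_eq_of_isAcyclic]
      · simp
      · exact SimpleGraph.IsAcyclic.of_subsingleton
  · have : NeZero n := ⟨hn.ne'⟩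
    have hof (u : Fin n) : Fin.ofNat n u = u := Fin.ext (Nat.mod_eq_of_lt u.isLt)
    have hval {u : ℕ} (hu : u < n) : (Fin.ofNat n u : ℕ) = u := Nat.mod_eq_of_lt hu
    let H : ℕ → ℕ → Prop := fun u w => G.Adj (ℓ (Fin.ofNat n u)) (ℓ (Fin.ofNat n w))
    let e : ℕ → ℕ → Sym2 (Fin n) := fun u w => s(ℓ (Fin.ofNat n u), ℓ (Fin.ofNat n w))
    have he : Distinct n e := by
      intro u w u' w' h1 h2 h3 h4 h
      rcases Sym2.eq_iff.1 h with ⟨ha, hb⟩ | ⟨ha, hb⟩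
      · have ha := congrArg Fin.val (ℓ.injective ha)
        have hb := congrArg Fin.val (ℓ.injective hb)
        rw [hval (by omega), hval (by omega)] at ha hb
        exact ⟨ha, hb⟩
      · have ha := congrArg Fin.val (ℓ.injective ha)
        have hb := congrArg Fin.val (ℓ.injective hb)
        rw [hval (by omega), hval (by omega)] at ha hb
        omega
    have hE : ∀ p : ℕ → ℕ → Prop, ∀ x, x ∈ edgesWith n H e p ↔
        ∃ u w : Fin n, u < w ∧ G.Adj (ℓ u) (ℓ w) ∧ p u w ∧ x = s(ℓ u, ℓ w) := by
      intro p x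
      rw [mem_edgesWith]
      constructor
      · rintro ⟨u, w, h1, h2, h3, h4, rfl⟩
        refine ⟨Fin.ofNat n u, Fin.ofNat n w, ?_, h3, ?_, rfl⟩
        · rw [Fin.lt_def, hval (by omega), hval h2]
          exact h1
        · rwa [hval (by omega), hval h2]
      · rintro ⟨u, w, h1, h2, h3, rfl⟩
        refine ⟨u, w, h1, w.isLt, ?_, h3, ?_⟩
        · simpa only [H, hof] using h2
        · simp only [e, hof]
    have hEtrue : (edgesWith n H e fun _ _ => True) = G.edgeFinset := by
      ext x
      rw [hE, SimpleGraph.mem_edgeFinset]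
      constructor
      · rintro ⟨u, w, -, h, -, rfl⟩
        exact h
      · induction x with | h a b =>
        intro h
        obtain ⟨u, rfl⟩ := ℓ.surjective a
        obtain ⟨w, rfl⟩ := ℓ.surjective b
        rw [SimpleGraph.mem_edgeSet] at h
        rcases lt_trichotomy u w with huw | rfl | huw
        · exact ⟨u, w, huw, h, trivial, rfl⟩
        · exact absurd rfl h.ne
        · exact ⟨w, u, huw, h.symm, trivial, Sym2.eq_swap⟩
    refine ⟨Sym2 (Fin n), inferInstance, H, inferInstance, e, he, ?_, ?_, ?_⟩
    · intro u w
      simp only [H, hof]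
    · intro i hi
      rcases Nat.eq_zero_or_pos i with rfl | hi0
      · have : cols H e 0 0 n = [] := by
          rw [List.eq_nil_iff_forall_not_mem]
          intro x hx
          obtain ⟨u, w, h, -⟩ := mem_cols.1 hx
          omega
        rw [this]
        exact Nat.zero_le _
      · have hi1 : i - 1 < n := by omega
        refine le_trans ?_ (Finset.le_sup (f := fun i : Fin n => (cutAt G ℓ i).ncard)
          (Finset.mem_univ ⟨i - 1, hi1⟩))
        rw [← List.toFinset_card_of_nodup (he.nodup_cols i), ← Set.ncard_coe_finset]
        refine Set.ncard_le_ncard ?_ (Set.toFinite _)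
        intro x hx
        rw [List.coe_toFinset] at hx
        obtain ⟨u, w, h1, h2, h3, h4, rfl⟩ := mem_cols.1 hx
        refine ⟨h4, Fin.ofNat n u, Fin.ofNat n w, ?_, ?_, rfl⟩
        · rw [Fin.le_def, hval (by omega)]
          change u ≤ i - 1
          omega
        · rw [Fin.lt_def, hval h3]
          change i - 1 < w
          omega
    · intro x
      have hinter : ∀ F ⊆ G.edgeFinset, ∀ v : Fin n,
          F ∩ edgesWith n H e (fun u w => u = v ∨ w = v) = F.filter fun e => ℓ v ∈ e := by
        intro F hF v
        ext y
        rw [Finset.mem_inter, Finset.mem_filter, hE]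
        refine and_congr_right fun hy => ?_
        have := hF hy
        rw [← hEtrue, hE] at this
        obtain ⟨u, w, h1, h2, -, rfl⟩ := this
        rw [Sym2.mem_iff, ℓ.injective.eq_iff, ℓ.injective.eq_iff]
        constructor
        · rintro ⟨u', w', h1', -, h3, h4⟩
          rcases Sym2.eq_iff.1 h4 with ⟨ha, hb⟩ | ⟨ha, hb⟩ <;>
          · have ha := ℓ.injective ha
            have hb := ℓ.injective hb
            subst ha hb
            rcases h3 with h3 | h3 <;> have h3 := Fin.ext h3 <;> subst h3 <;> simp
        · rintro h
          refine ⟨u, w, h1, h2, ?_, rfl⟩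
          rcases h with rfl | rfl <;> simp
      rw [hEtrue]
      have key := sum_prod_eq_sum_card_evenEdgeSets G fun v => x (ℓ.symm v)
      refine Eq.trans ?_ key
      have hfin : ∀ [i : Fintype G.edgeSet], (@SimpleGraph.edgeFinset _ G i) = G.edgeFinset := by
        intro i
        congr!
      rw [hfin]
      refine Finset.sum_congr rfl fun F hF => ?_
      rw [Finset.prod_range]
      refine Eq.trans ?_ (ℓ.prod_comp _)
      refine Finset.prod_congr rfl fun v _ => ?_
      rw [vertexWeight, hinter F (Finset.mem_powerset.1 hF), Equiv.symm_apply_apply]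
      congr!

open Classical in
theorem fvsProgram_fvsMemory (G : SimpleGraph (Fin n)) (ℓ : Fin n ≃ Fin n) (k : ℤ) (ω : Coins) :
    ∃ c t, Exec fvsProgram ⟨fvsMemory G ℓ k, ω⟩ c t ∧
      t ≤ 2000000 * 2 ^ cutwidth G ℓ * (n + k.natAbs.size + 1) ^ 8 ∧
      (c.mem 0 ≠ 0 ↔ 0 ≤ k ∧ ∃ j, Odd (((forests G).filter fun X => n - k.natAbs ≤ X.card).filter
        fun X => ∑ v ∈ X, (n * 2 ^ Nat.clog 2 (2 * n) + 1 +
          weight (Nat.clog 2 (2 * n)) ω (ℓ.symm v)) = j).card) := by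
  obtain ⟨ε, _, H, _, e, hP⟩ := exists_presents G ℓ
  obtain ⟨B, hB1, hB2, hB3, hB4, ht⟩ := exists_bound n (cutwidth G ℓ) cutwidth_le k.natAbs
    rfl rfl rfl
  have hF : Frame n B (fvsMemory G ℓ k) :=
    ⟨fvsMemory_zero, fun a => (fvsMemory_le a).trans hB1, by
      exact (Nat.le_add_right _ _).trans hB2⟩
  have hI : Input n (fvsMemory G ℓ k) H := by
    constructor
    · intro u hu
      rw [fvsMemory_vertex ⟨u, hu⟩]
      exact (ℓ _).isLt
    · intro u hu w hw
      rw [fvsMemory_vertex ⟨u, hu⟩, fvsMemory_vertex ⟨w, hw⟩, fvsMemory_adj]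
      have := hP.adj ⟨u, hu⟩ ⟨w, hw⟩
      exact if_congr this.symm rfl rfl
  obtain ⟨c, t, hex, htime, hacc⟩ := fvsProgram_spec (ω := ω) hP.distinct hF hI hP.length_cols_le
    rfl rfl rfl hB2 hB3 hB4
  rw [memOf_fvsMemory] at hex
  refine ⟨c, t, hex, htime.trans ht, hacc.trans ?_⟩
  rw [fvsMemory_one, fvsMemory_two]
  have hk : (if k < 0 then 1 else 0) = 0 ↔ 0 ≤ k := by
    rw [← not_lt]
    split_ifs with h <;> simp [h]
  refine and_congr hk ?_
  rw [hP.sum_eq fun i => (2 ^ (n * n + n + 1)) ^ weight (Nat.clog 2 (2 * n)) ω i *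
    (2 ^ (n * n + n + 1)) ^ (n * 2 ^ Nat.clog 2 (2 * n) + 1)]
  rw [exists_odd_digit_iff (w := fun v => weight (Nat.clog 2 (2 * n)) ω (ℓ.symm v)) (N := 2 ^ Nat.clog 2 (2 * n)) (fun v => bitsVal_lt _ _) rfl rfl]
  simp only [Finset.filter_filter]

end

end RAM

theorem mainTheorem4 :
    ∃ (p : RAM.Program) (C d : ℕ),
      ∀ (n : ℕ) (G : SimpleGraph (Fin n)) (ℓ : Fin n ≃ Fin n) (k : ℤ) (ctw : ℕ),
        cutwidth G ℓ ≤ ctw →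
          (∀ ω : ℕ → Bool,
            RAM.HaltsWithin p (fvsMemory G ℓ k) ω
              (C * 2 ^ ctw * (n + k.natAbs.size + 1) ^ d)) ∧
          (¬ HasFeedbackVertexSet G k →
            ∀ ω : ℕ → Bool, ¬ RAM.Accepts p (fvsMemory G ℓ k) ω) ∧
          (HasFeedbackVertexSet G k →
            (1 / 2 : ℝ≥0∞) ≤ RAM.coinMeasure {ω | RAM.Accepts p (fvsMemory G ℓ k) ω}) := by
  classical
  refine ⟨RAM.fvsProgram, 2000000, 8, fun n G ℓ k ctw hctw => ⟨fun ω => ?_, fun hno ω => ?_,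
    fun hyes => ?_⟩⟩
  · obtain ⟨c, t, hex, ht, -⟩ := RAM.fvsProgram_fvsMemory G ℓ k ω
    refine ⟨c, t, hex, ht.trans ?_⟩
    gcongr
    norm_num
  · rintro ⟨c, t, hex, hc⟩
    obtain ⟨c', t', hex', -, hacc⟩ := RAM.fvsProgram_fvsMemory G ℓ k ω
    -- The accepting run is the analysed one, since the coins determine the execution.
    obtain rfl := hex.deterministic hex'
    obtain ⟨hk, j, hj⟩ := hacc.1 hc
    -- An odd number of forests is positive, so a sufficiently large induced forest exists.
    obtain ⟨X, hX⟩ := Finset.card_pos.1 hj.pos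
    simp only [Finset.mem_filter] at hX
    exact hno (hasFeedbackVertexSet_iff.2 ⟨hk, X, hX.1⟩)
  · obtain ⟨hk, X, hX, hcard⟩ := hasFeedbackVertexSet_iff.1 hyes
    have hne : ((forests G).filter fun X => n - k.natAbs ≤ X.card).Nonempty :=
      ⟨X, Finset.mem_filter.2 ⟨hX, hcard⟩⟩
    -- The weights are drawn by position while the forests consist of vertices, hence `ℓ.symm`. The
    -- choice of `β` provides the required `2 * n` values.
    refine (RAM.half_le_coinMeasure_odd hne ℓ.symm (Nat.le_pow_clog (by norm_num) (2 * n))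
      (n * 2 ^ Nat.clog 2 (2 * n) + 1)).trans (measure_mono fun ω hω => ?_)
    obtain ⟨c, t, hex, -, hacc⟩ := RAM.fvsProgram_fvsMemory G ℓ k ω
    refine ⟨c, t, hex, hacc.2 ⟨hk, ?_⟩⟩
    exact hω
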